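/- Let $n\ge 3$ and fix real parameters $\kappa_1<\kappa_2<\dots<\kappa_n$. A point of the totally positive Grassmannian $(Gr_{2,n})_{>0}$ is represented by a real $2\times n$ matrix $A$ all of whose $2\times 2$ minors $\Delta_{ij}(A)$, $i<j$, are positive. Given $A$ and higher times $t=(t_3,\dots,t_n)\in\mathbb R^{n-2}$, put $\theta_i(x,y)=\kappa_i x+\kappa_i^2y+\sum_{m=3}^n\kappa_i^m t_m$ and $$f_A(x,y)=\max_{i<j}\bigl\{\ln\bigl(\Delta_{ij}(A)(\kappa_j-\kappa_i)\bigr)+\theta_i(x,y)+\theta_j(x,y)\bigr\}.$$ The contour plot of $(A,t)$ is the locus in $\mathbb R^2$ where $f_A$ is not linear; each region of its complement is labeled by the pair $\{i,j\}$ that attains the maximum there. The plot is generic and trivalent if every point of it is either a point where exactly two regions meet or a trivalent vertex, where exactly three regions meet, and if the labels of any two adjacent regions have an index in common (so every segment is a line-soliton of some type $[i,j]$; there are no $X$-crossings and no phase-shift segments). Its soliton graph $G_t(A)$ is then the plane graph in a disk formed by the trivalent vertices, the bounded line-solitons as edges, and the unbounded line-solitons as edges to the boundary; a vertex is black (white)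 if exactly one edge extends downwards (upwards) from it, and the regions keep their labels. Two such labeled graphs are (M2)-equivalent if they are related by contractions and uncontractions of edges joining two distinct vertices of the same color. For a triangulation $T$ of a convex $n$-gon $P$ with vertices $1,\dots,n$ in counterclockwise order, the graph $\Psi(T)$ is obtained as follows: put a black vertex inside each triangle of $T$; put a white vertex at each vertex of $P$ that is incident to a diagonal of $T$ and a black vertex at every other vertex of $P$; join the vertex inside each triangle to the three vertices of that triangle; erase the edges of $T$ and contract all edges joining two vertices of the same color; finally attach one unbounded ray at each vertex of $P$. Each region of $\Psi(T)$ is labeled by the pair $\{i,j\}$ of endpoints of the corresponding edge of $T$ (bounded regions correspond to diagonals, unbounded regions to sides of $P$). **Theorem.** 1. For every triangulation $T$ of the $n$-gon, $\Psi(T)$ is, up to (M2)-equivalence, a generic trivalent soliton graph for $(Gr_{2,n})_{>0}$: there are $A\in(Gr_{2,n})_{>0}$ and $t$ such that the contour plot of $(A,t)$ is generic and trivalent and $G_t(A)$ is (M2)-equivalent to $\Psi(T)$. 2. Conversely, for all $A\in(Gr_{2,n})_{>0}$ and $t$ such that the contour plot of $(A,t)$ is generic and trivalent, there is a triangulation $T$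 of the $n$-gon such that $G_t(A)$ is (M2)-equivalent to $\Psi(T)$. 3. Each $\Psi(T)$ can be realized as in 1 in either of two ways: (a) for every $A\in(Gr_{2,n})_{>0}$ there are higher times $t_3,\dots,t_n$ such that the plot of $(A,t)$ is generic and trivalent and $G_t(A)$ is (M2)-equivalent to $\Psi(T)$; (b) for all fixed $t_3,\dots,t_n$ and every $A\in(Gr_{2,n})_{>0}$ there are $\ell_1,\dots,\ell_n>0$ such that, with $A'=A\cdot\mathrm{diag}(\ell_1,\dots,\ell_n)\in(Gr_{2,n})_{>0}$, the plot of $(A',t)$ is generic and trivalent and $G_t(A')$ is (M2)-equivalent to $\Psi(T)$. -/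

import Mathlib

open Topology

noncomputable section

namespace KPSoliton

/-! ## Soliton data: minors, phases, the contour plot -/

section Plot

variable {k n : ℕ}

/-- The maximal minor `Δ_I(A)` in the columns `I` (read in increasing order), `|I| = k`. -/
def minor (A : Matrix (Fin k) (Fin n) ℝ) (I : Finset (Fin n)) : ℝ :=
  if h : I.card = k then (A.submatrix id (I.orderEmbOfFin h)).det else 0

/-- `A` represents a point of the totally positive Grassmannian `(Gr_{k,n})_{>0}`. -/
def TotallyPositive (A : Matrix (Fin k) (Fin n) ℝ) : Prop :=
  ∀ I : Finset (Fin n), I.card = k → 0 < minor A I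

/-- The matroid of `A`: the `k`-subsets `I` with `Δ_I(A) ≠ 0`. -/
def bases (A : Matrix (Fin k) (Fin n) ℝ) : Finset (Finset (Fin n)) :=
  open Classical in (Finset.powersetCard k Finset.univ).filter (fun I => minor A I ≠ 0)

/-- `K_I = ∏_{i < j in I} (κ_j - κ_i)`. -/
def vandermondeFactor (κ : Fin n → ℝ) (I : Finset (Fin n)) : ℝ :=
  ∏ i ∈ I, ∏ j ∈ I.filter (fun j => i < j), (κ j - κ i)

/-- `θ_i = κ_i x + κ_i² y + ∑_{m=3}^n κ_i^m t_m` at the point `p = (x, y)`.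
Only the entries `t 3, …, t n` of `t` are used. -/
def theta (κ : Fin n → ℝ) (t : ℕ → ℝ) (i : Fin n) (p : ℝ × ℝ) : ℝ :=
  κ i * p.1 + κ i ^ 2 * p.2 + ∑ m ∈ Finset.Icc 3 n, κ i ^ m * t m

/-- `ln (Δ_I(A) E_I) = ln (Δ_I(A) K_I) + ∑_{i ∈ I} θ_i`. -/
def logTerm (κ : Fin n → ℝ) (A : Matrix (Fin k) (Fin n) ℝ) (t : ℕ → ℝ)
    (I : Finset (Fin n)) (p : ℝ × ℝ) : ℝ :=
  Real.log (minor A I * vandermondeFactor κ I) + ∑ i ∈ I, theta κ t i p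

/-- The function `f_A`: the maximum of `ln (Δ_I(A) E_I)` over the matroid of `A`. -/
def tropicalTau (κ : Fin n → ℝ) (A : Matrix (Fin k) (Fin n) ℝ) (t : ℕ → ℝ) (p : ℝ × ℝ) : ℝ :=
  ⨆ I : {I : Finset (Fin n) // I ∈ bases A}, logTerm κ A t I.1 p

/-- The contour plot: the locus in the `xy`-plane where `f_A` is not (locally affine-)linear. -/
def contourPlot (κ : Fin n → ℝ) (A : Matrix (Fin k) (Fin n) ℝ) (t : ℕ → ℝ) : Set (ℝ × ℝ) :=
  {p | ¬ ∃ a b c : ℝ, ∀ᶠ q in 𝓝 p, tropicalTau κ A t q = a * q.1 + b * q.2 + c}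

/-- The exponentials that attain the maximum `f_A` at `p`. -/
def dominant (κ : Fin n → ℝ) (A : Matrix (Fin k) (Fin n) ℝ) (t : ℕ → ℝ) (p : ℝ × ℝ) :
    Finset (Finset (Fin n)) :=
  open Classical in (bases A).filter (fun I => logTerm κ A t I p = tropicalTau κ A t p)

/-- `I` labels a region of the complement of the contour plot: it is somewhere the only
dominant exponential. (The region itself is the open set where this happens.) -/
def IsRegionLabel (κ : Fin n → ℝ) (A : Matrix (Fin k) (Fin n) ℝ) (t : ℕ → ℝ)
    (I : Finset (Fin n)) : Prop :=
  ∃ q, dominant κ A t q = {I}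

/-- The labels of the regions whose closure contains `p`. (The closure of the region labeled
`I` is the convex set where `I` attains the maximum.) -/
def regionsAt (κ : Fin n → ℝ) (A : Matrix (Fin k) (Fin n) ℝ) (t : ℕ → ℝ) (p : ℝ × ℝ) :
    Finset (Finset (Fin n)) :=
  open Classical in (dominant κ A t p).filter (IsRegionLabel κ A t)

/-- The contour plot is generic and trivalent: every point of it lies either inside a
line-soliton (two regions meet there) or at a trivalent vertex (three regions meet there), and
any two adjacent regions are separated by a line-soliton of some type `[i,j]`, that is,
their labels have `k - 1` indices in common.
There are no `X`-crossings, with or without a phase shift: an `X`-crossing is either a point where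
four regions meet, or it is opened up into a short phase-shift segment, and such a segment
separates two regions whose labels have only `k - 2` indices in common. -/
def IsGenericTrivalent (κ : Fin n → ℝ) (A : Matrix (Fin k) (Fin n) ℝ) (t : ℕ → ℝ) : Prop :=
  ∀ p ∈ contourPlot κ A t,
    ((regionsAt κ A t p).card = 2 ∨ (regionsAt κ A t p).card = 3) ∧
    ∀ I ∈ regionsAt κ A t p, ∀ J ∈ regionsAt κ A t p, I ≠ J → (I ∩ J).card + 1 = k

end Plot

/-! ## Labeled bicolored graphs in a disk, and the move (M2) -/

/-- The data of a bicolored graph embedded in a disk whose regions are labeled by subsets of `[n]`.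
The vertices are the internal vertices; an edge that runs to the boundary of the disk (a ray)
has only one internal end, and boundary vertices correspond to rays.
The embedding is recorded by the regions on the two sides of each edge: going counterclockwise
around a vertex, the half-edge with `I` on its right and `J` on its left is followed
by the half-edge with `J` on its right. See `DiskGraph.IsPlane` for the laws. -/
structure DiskGraph (n : ℕ) where
  /-- internal vertices -/
  Vertex : Type
  /-- the color: black if true, white if false -/
  black : Vertex → Prop
  /-- `edge v w I J`: an edge joins `v` to `w`; seen from `v` towards `w`, the region on
  its right is `I` and the region on its left is `J` -/
  edge : Vertex → Vertex → Finset (Fin n) → Finset (Fin n) → Prop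
  /-- `ray v I J`: an edge goes from `v` to the boundary, with `I` on its right and `J` on
  its left -/
  ray : Vertex → Finset (Fin n) → Finset (Fin n) → Prop

namespace DiskGraph

variable {n : ℕ}

/-- A half-edge at `v` with region `I` on its right and `J` on its left. -/
def HalfEdge (G : DiskGraph n) (v : G.Vertex) (I J : Finset (Fin n)) : Prop :=
  G.ray v I J ∨ ∃ w, G.edge v w I J

/-- The laws of a graph embedded in a disk (as a combinatorial map): reversing an edge
exchanges its sides; every half-edge belongs to exactly one edge or ray; and the regions
around every vertex form a single cyclic sequence `l` (listed counterclockwise), with one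
half-edge between any two consecutive regions. There are no leaves. -/
structure IsPlane (G : DiskGraph n) : Prop where
  edge_symm : ∀ v w I J, G.edge v w I J → G.edge w v J I
  edge_unique : ∀ v w w' I J, G.edge v w I J → G.edge v w' I J → w = w'
  edge_not_ray : ∀ v w I J, G.edge v w I J → ¬ G.ray v I J
  rotation : ∀ v, ∃ l : List (Finset (Fin n)), l.Nodup ∧ 2 ≤ l.length ∧
    ∀ I J, G.HalfEdge v I J ↔ ∃ l', List.IsRotated l (I :: J :: l')

/-- Equality of labeled embedded graphs, up to renaming the vertices. -/
def Iso (G H : DiskGraph n) : Prop :=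
  ∃ e : G.Vertex ≃ H.Vertex,
    (∀ v, H.black (e v) ↔ G.black v) ∧
    (∀ v w I J, H.edge (e v) (e w) I J ↔ G.edge v w I J) ∧
    (∀ v I J, H.ray (e v) I J ↔ G.ray v I J)

/-- `H` is obtained from `G` by contracting the edge from `v` to `w` with `I` on its right
and `J` on its left, where `v ≠ w` have the same color; `m` sends a vertex of `G` to its image. -/
structure IsContraction (G H : DiskGraph n) (v w : G.Vertex) (I J : Finset (Fin n))
    (m : G.Vertex → H.Vertex) : Prop where
  edge : G.edge v w I J
  ne : v ≠ w
  color : G.black v ↔ G.black w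
  surjective : Function.Surjective m
  eq_iff : ∀ x y, m x = m y ↔ x = y ∨ (x = v ∧ y = w) ∨ (x = w ∧ y = v)
  black_iff : ∀ x, H.black (m x) ↔ G.black x
  edge_iff : ∀ a b K L, H.edge a b K L ↔ ∃ x y, m x = a ∧ m y = b ∧ G.edge x y K L ∧
    ¬ (x = v ∧ y = w ∧ K = I ∧ L = J) ∧ ¬ (x = w ∧ y = v ∧ K = J ∧ L = I)
  ray_iff : ∀ a K L, H.ray a K L ↔ ∃ x, m x = a ∧ G.ray x K L

/-- One application of (M2): contraction of an edge with two vertices of the same color. -/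
def Contracts (G H : DiskGraph n) : Prop :=
  G.IsPlane ∧ H.IsPlane ∧ ∃ v w I J m, IsContraction G H v w I J m

/-- (M2)-equivalence: the equivalence relation generated by unicolored edge contraction
(hence also uncontraction), graphs being considered up to isomorphism. -/
def M2Equiv (G H : DiskGraph n) : Prop :=
  Relation.EqvGen (fun G₁ G₂ : DiskGraph n => Iso G₁ G₂ ∨ Contracts G₁ G₂) G H

end DiskGraph

/-! ## The soliton graph of a contour plot -/

/-- Counterclockwise rotation by a right angle. -/
def rotateLeft (u : ℝ × ℝ) : ℝ × ℝ := (-u.2, u.1)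

/-- Of two exponentials `I`, `J` that are in balance along the line through `p` in
the direction `u`, the exponential `J` is the larger one on the left of that line. -/
def LeftOf {k n : ℕ} (κ : Fin n → ℝ) (A : Matrix (Fin k) (Fin n) ℝ) (t : ℕ → ℝ)
    (p u : ℝ × ℝ) (I J : Finset (Fin n)) : Prop :=
  logTerm κ A t I (p + rotateLeft u) < logTerm κ A t J (p + rotateLeft u)

/-- The soliton graph of a generic trivalent contour plot. The vertices are the points
where three regions meet; a vertex is black if exactly one edge extends downwards from it, and
otherwise white (a line-soliton is never horizontal, so in that case exactly one edge of
the three extends upwards). Edges are the bounded line-solitons, rays are the unbounded ones, and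
regions carry the labels of their dominant exponentials. The type `[i,j]` of a
line-soliton is the symmetric difference of the labels on its two sides. -/
def solitonGraph {k n : ℕ} (κ : Fin n → ℝ) (A : Matrix (Fin k) (Fin n) ℝ) (t : ℕ → ℝ) :
    DiskGraph n where
  Vertex := {p : ℝ × ℝ // 3 ≤ (regionsAt κ A t p).card}
  black p := ∃! e : Finset (Finset (Fin n)), e.card = 2 ∧
    ∃ u : ℝ × ℝ, u.2 < 0 ∧ ∃ ε > 0, ∀ s : ℝ, 0 < s → s < ε → regionsAt κ A t (p.1 + s • u) = e
  edge p q I J := p ≠ q ∧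
    (∀ s : ℝ, 0 < s → s < 1 → regionsAt κ A t (p.1 + s • (q.1 - p.1)) = {I, J}) ∧
    LeftOf κ A t p.1 (q.1 - p.1) I J
  ray p I J := ∃ u : ℝ × ℝ, u ≠ 0 ∧
    (∀ s : ℝ, 0 < s → regionsAt κ A t (p.1 + s • u) = {I, J}) ∧
    LeftOf κ A t p.1 u I J

/-! ## Triangulations of an `n`-gon and the graph `Ψ(T)` -/

section Triangulation

variable {n : ℕ}

/-- The polygon vertex `j` comes directly after `i` in counterclockwise order. -/
def Follows (i j : Fin n) : Prop := (j : ℕ) = ((i : ℕ) + 1) % n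

/-- `c, a, b` are distinct and in counterclockwise order. -/
def CounterClockwise (c a b : Fin n) : Prop :=
  (c < a ∧ a < b) ∨ (a < b ∧ b < c) ∨ (b < c ∧ c < a)

/-- `I` is a side of the `n`-gon. -/
def IsSide (I : Finset (Fin n)) : Prop := ∃ i j : Fin n, Follows i j ∧ I = {i, j}

/-- The chords `I` and `J` of the `n`-gon cross in their interiors. -/
def Crossing (I J : Finset (Fin n)) : Prop :=
  ∃ a b c d : Fin n, a < b ∧ b < c ∧ c < d ∧
    ((I = {a, c} ∧ J = {b, d}) ∨ (I = {b, d} ∧ J = {a, c}))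

/-- `T` is the set of edges (sides and diagonals) of a triangulation of the `n`-gon:
a maximal set of pairwise noncrossing chords. -/
structure IsTriangulation (T : Set (Finset (Fin n))) : Prop where
  card_eq_two : ∀ I ∈ T, I.card = 2
  noncrossing : ∀ I ∈ T, ∀ J ∈ T, ¬ Crossing I J
  maximal : ∀ J : Finset (Fin n), J.card = 2 → (∀ I ∈ T, ¬ Crossing I J) → J ∈ T

/-- `τ` is (the vertex set of) a triangle of `T`. -/
def IsTriangle (T : Set (Finset (Fin n))) (τ : Finset (Fin n)) : Prop :=
  τ.card = 3 ∧ ∀ I ⊆ τ, I.card = 2 → I ∈ T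

/-- The polygon vertex `c` is incident to a diagonal of `T`. -/
def MeetsDiagonal (T : Set (Finset (Fin n))) (c : Fin n) : Prop :=
  ∃ I ∈ T, c ∈ I ∧ ¬ IsSide I

/-- The polygon vertex `c` belongs to the triangle `τ`; the sides of `τ` at `c` are `R`, `L`,
with `R` on the right and `L` on the left as seen from inside of `τ` towards `c`. -/
def SidesAt (τ : Finset (Fin n)) (c : Fin n) (R L : Finset (Fin n)) : Prop :=
  ∃ a b, τ = {c, a, b} ∧ CounterClockwise c a b ∧ R = {b, c} ∧ L = {c, a}

/-- The sides of the polygon at `c`: seen from `c` outwards, `R` is on the right of the ray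
at `c` and `L` is on its left. -/
def OuterSidesAt (c : Fin n) (R L : Finset (Fin n)) : Prop :=
  ∃ a b, Follows a c ∧ Follows c b ∧ R = {a, c} ∧ L = {c, b}

/-- The graph `Ψ(T)`. There is a black vertex in every triangle of `T` and a white vertex at every
polygon vertex incident to a diagonal; they are joined whenever the polygon vertex belongs to the
triangle. A polygon vertex `c` that is not incident to a diagonal lies in a single
triangle; the black vertex at `c` is adjacent to the black vertex in that triangle and has been
contracted into it (no other adjacent vertices have the same color).
Finally there is one ray for every polygon vertex. The regions are labeled by the
corresponding edges of `T`. -/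
def Psi (T : Set (Finset (Fin n))) : DiskGraph n where
  Vertex := {τ : Finset (Fin n) // IsTriangle T τ} ⊕ {c : Fin n // MeetsDiagonal T c}
  black
    | Sum.inl _ => True
    | Sum.inr _ => False
  edge
    | Sum.inl τ, Sum.inr c, R, L => SidesAt τ.1 c.1 R L
    | Sum.inr c, Sum.inl τ, R, L => SidesAt τ.1 c.1 L R
    | Sum.inl _, Sum.inl _, _, _ => False
    | Sum.inr _, Sum.inr _, _, _ => False
  ray
    | Sum.inl τ, R, L => ∃ c ∈ τ.1, ¬ MeetsDiagonal T c ∧ OuterSidesAt c R L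
    | Sum.inr c, R, L => OuterSidesAt c.1 R L

end Triangulation

end KPSoliton

end

/-!
Write `L_I(p) = c_I + ∑_{i ∈ I} (κ_i x + κ_i² y)` for the affine functions whose maximum is `f_A`.
For `k = 2` the label `I` is a chord of the `n`-gon, and the gradient of `L_I` is the sum of two of
the points `(κ_i, κ_i²)`, which are in convex position; so the geometry of the contour plot reflects
the cyclic order of the indices. The labels of the three regions at a trivalent vertex intersect
pairwise. Either they are `{c, x}`, `{c, y}`, `{c, z}`, and the vertex is white, or they are the
sides of a triangle, and the vertex is black (`IsPlot.exists_star`, `IsPlot.system_black_iff`). In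
both cases they are in the cyclic order of the indices that vary.

*Every generic plot comes from a triangulation.* Let `{a, b}` be the label of a region, and suppose
that there are indices in the arc from `a` to `b`. There is a direction `w` in which `L_{ax}` and
`L_{bx}` have the same slope for every `x`, and this slope is larger than that of `L_{ab}` exactly
for `x` in the arc. The part of the boundary of the region that faces `w` is a connected curve;
along it the neighboring regions are `{a, x}` or `{b, x}`, the first kind occurs at one end, the second
one at the other end, and the kind can only change from `a` to `b` in the direction in which
`L_{bx} - L_{ax}`, whose gradient does not depend on `x`, increases. So the kind changes exactly
once, at a vertex with labels `{a, b}`, `{a, x}`, `{b, x}` (`IsPlot.exists_triangle`,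
`IsPlot.triangle_unique`). A family of chords that contains the sides of the polygon, with a family
of triangles of which each chord has exactly one on each side, is a triangulation
(`isTriangulation_of_unique_triangle`). Hence the labels of the regions form a triangulation `T`
whose triangles are the black vertices (`IsPlot.isTriangulation`).

*The graph is `Ψ(T)`.* The soliton graph is recorded by the stars of its vertices (`StarSystem`).
The stars of the white vertices at `c` consist of neighbors of `c` in `T`, in their cyclic order. As
long as such a star is not the set of all neighbors, some half-edge of it must lead to another white
vertex at `c`, and this edge can be contracted; the end of this process is `Ψ(T)`
(`Refines.m2Equiv`).

*Every triangulation is realized.* Replace `c_I` by `c_I + ∑_{i ∈ I} ω_i`. If the third divided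
differences of `ω` at all quadruples `a < b < c < d` are large compared with the `c_I`, no four
terms are ever dominant at the same time, and the sign of the difference decides which one of
`{a, c}` and `{b, d}` can be dominant. The sum over the chords of `T` of the negative parts of
`(κ - κ_p) (κ - κ_q)` has the signs that belong to `T` (`exists_quadDiff_sign`); a small multiple
of `κ³` makes the other third differences nonzero (`exists_quadDiff_large`). The plot is then
generic and all its labels are in `T`, so its triangulation is `T` (`Separates.realizes`). The torus
changes `ω` arbitrarily; so do the higher times, by interpolation, up to quadratic polynomials in
`κ`, which do not change third differences (`exists_times`).
-/

namespace KPSoliton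

/-! ### Cyclic order -/

section Cyclic

variable {n : ℕ}

theorem CounterClockwise.rotate {a b c : Fin n} (h : CounterClockwise a b c) :
    CounterClockwise b c a := by
  unfold CounterClockwise at *; grind

theorem CounterClockwise.asymm {a b c : Fin n} (h : CounterClockwise a b c) :
    ¬ CounterClockwise b a c := by
  unfold CounterClockwise at *; grind

theorem counterClockwise_total {a b c : Fin n} (hab : a ≠ b) (hac : a ≠ c) (hbc : b ≠ c) :
    CounterClockwise a b c ∨ CounterClockwise a c b := by
  unfold CounterClockwise at *; grind

theorem CounterClockwise.ne {a b c : Fin n} (h : CounterClockwise a b c) :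
    a ≠ b ∧ b ≠ c ∧ a ≠ c := by
  unfold CounterClockwise at *; grind

/-- In the finite set `S` of vertices of the polygon, `y` comes directly after `x` in
counterclockwise order. -/
def NextIn (S : Finset (Fin n)) (x y : Fin n) : Prop :=
  x ∈ S ∧ y ∈ S ∧ x ≠ y ∧ ∀ z ∈ S, z ≠ x → z ≠ y → CounterClockwise x y z

theorem NextIn.right_unique {S : Finset (Fin n)} {x y y' : Fin n} (h : NextIn S x y)
    (h' : NextIn S x y') : y = y' := by
  obtain ⟨_, hy, hxy, hz⟩ := h
  obtain ⟨_, hy', hxy', hz'⟩ := h'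
  by_contra hne
  have h1 := hz y' hy' hxy'.symm (Ne.symm hne)
  have h2 := hz' y hy hxy.symm hne
  unfold CounterClockwise at *; grind

theorem exists_nextIn {S : Finset (Fin n)} (hS : 2 ≤ S.card) {x : Fin n} (hx : x ∈ S) :
    ∃ y, NextIn S x y := by
  have hne : (S.erase x).Nonempty := by
    rw [← Finset.card_pos, Finset.card_erase_of_mem hx]; omega
  obtain ⟨y, hy, hmin⟩ := Finset.exists_min_image (S.erase x)
    (fun y => if x < y then (y : ℕ) else y + n) hne
  rw [Finset.mem_erase] at hy
  refine ⟨y, hx, hy.2, hy.1.symm, fun z hz hzx hzy => ?_⟩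
  have := hmin z (Finset.mem_erase.2 ⟨hzx, hz⟩)
  have h1 := y.2; have h2 := z.2; have h3 := x.2
  simp only [Fin.lt_def, CounterClockwise, ne_eq, Fin.ext_iff] at *
  split_ifs at this <;> omega

theorem exists_nextIn_left {S : Finset (Fin n)} (hS : 2 ≤ S.card) {x : Fin n} (hx : x ∈ S) :
    ∃ y, NextIn S y x := by
  have hne : (S.erase x).Nonempty := by
    rw [← Finset.card_pos, Finset.card_erase_of_mem hx]; omega
  obtain ⟨y, hy, hmax⟩ := Finset.exists_max_image (S.erase x)
    (fun y => if x < y then (y : ℕ) else y + n) hne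
  rw [Finset.mem_erase] at hy
  refine ⟨y, hy.2, hx, hy.1, fun z hz hzy hzx => ?_⟩
  have := hmax z (Finset.mem_erase.2 ⟨hzx, hz⟩)
  have h1 := y.2; have h2 := z.2; have h3 := x.2
  simp only [Fin.lt_def, CounterClockwise, ne_eq, Fin.ext_iff] at *
  split_ifs at this <;> omega

/-- Two sets that have an edge of their cyclic orders in common, in opposite directions, are
separated by it; gluing them along this edge gives a cyclic order that
has all the other edges of both. -/
theorem nextIn_union {S S' : Finset (Fin n)} {x y : Fin n} (hS : 3 ≤ S.card)
    (hS' : 3 ≤ S'.card) (h : NextIn S x y) (h' : NextIn S' y x) (a b : Fin n) :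
    NextIn (S ∪ S') a b ↔
      (NextIn S a b ∧ ¬ (a = x ∧ b = y)) ∨ (NextIn S' a b ∧ ¬ (a = y ∧ b = x)) := by
  obtain ⟨hx, hy, hxy, hz⟩ := h
  obtain ⟨hy', hx', -, hz'⟩ := h'
  have key : ∀ z ∈ S, ∀ w ∈ S', z ≠ x → z ≠ y → w ≠ x → w ≠ y →
      CounterClockwise x y z ∧ CounterClockwise y x w :=
    fun z hzS w hwS h1 h2 h3 h4 => ⟨hz z hzS h1 h2, hz' w hwS h4 h3⟩
  have ex : ∀ R : Finset (Fin n), 3 ≤ R.card → ∃ z ∈ R, z ≠ x ∧ z ≠ y := by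
    intro R hR
    by_contra! hcon
    have : R ⊆ {x, y} := fun z hzR => by
      by_cases hzx : z = x
      · simp [hzx]
      · simp [hcon z hzR hzx]
    have := Finset.card_le_card this
    have := Finset.card_le_two (a := x) (b := y)
    omega
  obtain ⟨z₀, hz₀, hz₀x, hz₀y⟩ := ex S hS
  obtain ⟨w₀, hw₀, hw₀x, hw₀y⟩ := ex S' hS'
  have hz₀' := hz z₀ hz₀ hz₀x hz₀y
  have hw₀' := hz' w₀ hw₀ hw₀y hw₀x
  constructor
  · rintro ⟨ha, hb, hab, hc⟩
    rw [Finset.mem_union] at ha hb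
    have hne1 : ¬ (a = x ∧ b = y) := by
      rintro ⟨rfl, rfl⟩
      have := hc w₀ (Finset.mem_union_right _ hw₀) hw₀x hw₀y
      exact hw₀'.asymm this
    have hne2 : ¬ (a = y ∧ b = x) := by
      rintro ⟨rfl, rfl⟩
      have := hc z₀ (Finset.mem_union_left _ hz₀) hz₀y hz₀x
      exact hz₀'.asymm this
    have hcS : ∀ z ∈ S, z ≠ a → z ≠ b → CounterClockwise a b z :=
      fun z h1 => hc z (Finset.mem_union_left _ h1)
    have hcS' : ∀ z ∈ S', z ≠ a → z ≠ b → CounterClockwise a b z :=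
      fun z h1 => hc z (Finset.mem_union_right _ h1)
    by_cases h1 : a ∈ S ∧ b ∈ S
    · exact Or.inl ⟨⟨h1.1, h1.2, hab, hcS⟩, hne1⟩
    by_cases h2 : a ∈ S' ∧ b ∈ S'
    · exact Or.inr ⟨⟨h2.1, h2.2, hab, hcS'⟩, hne2⟩
    exfalso
    have hax : a ≠ x := by rintro rfl; grind
    have hay : a ≠ y := by rintro rfl; grind
    have hbx : b ≠ x := by rintro rfl; grind
    have hby : b ≠ y := by rintro rfl; grind
    have hcx := hcS x hx hax.symm hbx.symm
    have hcy := hcS y hy hay.symm hby.symm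
    rcases ha with ha | ha <;> rcases hb with hb | hb
    · exact h1 ⟨ha, hb⟩
    · have := key a ha b hb hax hay hbx hby
      unfold CounterClockwise at *; grind
    · have := key b hb a ha hbx hby hax hay
      unfold CounterClockwise at *; grind
    · exact h2 ⟨ha, hb⟩
  · rintro (⟨⟨ha, hb, hab, hc⟩, hne⟩ | ⟨⟨ha, hb, hab, hc⟩, hne⟩)
    · refine ⟨Finset.mem_union_left _ ha, Finset.mem_union_left _ hb, hab, ?_⟩
      intro z hzU hza hzb
      rw [Finset.mem_union] at hzU
      by_cases hzS : z ∈ S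
      · exact hc z hzS hza hzb
      · have hzS' := hzU.resolve_left hzS
        have hzx : z ≠ x := by rintro rfl; exact hzS hx
        have hzy : z ≠ y := by rintro rfl; exact hzS hy
        have h1 := hz' z hzS' hzy hzx
        have h2 := hz a ha
        have h3 := hz b hb
        have h4 := hc x hx
        have h5 := hc y hy
        clear key ex hz hz' hc
        unfold CounterClockwise at *; grind
    · refine ⟨Finset.mem_union_right _ ha, Finset.mem_union_right _ hb, hab, ?_⟩
      intro z hzU hza hzb
      rw [Finset.mem_union] at hzU
      by_cases hzS : z ∈ S'
      · exact hc z hzS hza hzb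
      · have hzS' := hzU.resolve_right hzS
        have hzx : z ≠ x := by rintro rfl; exact hzS hx'
        have hzy : z ≠ y := by rintro rfl; exact hzS hy'
        have h1 := hz z hzS' hzx hzy
        have h2 := hz' a ha
        have h3 := hz' b hb
        have h4 := hc x hx'
        have h5 := hc y hy'
        clear key ex hz hz' hc
        unfold CounterClockwise at *; grind

/-- The counterclockwise successor in `S` can be read off from the increasing list of the
elements of `S`, read cyclically. -/
theorem nextIn_iff_isRotated {S : Finset (Fin n)} (hS : 2 ≤ S.card) (x y : Fin n) :
    NextIn S x y ↔ ∃ l', (S.sort (· ≤ ·)) ~r (x :: y :: l') := by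
  have hmem : ∀ z, z ∈ S ↔ z ∈ S.sort (· ≤ ·) := fun z => (Finset.mem_sort _).symm
  have back : ∀ x y, (∃ l', (S.sort (· ≤ ·)) ~r (x :: y :: l')) → NextIn S x y := by
    rintro x y ⟨l', k, hk⟩
    have hlt : (S.sort (· ≤ ·)).Pairwise (· < ·) := Finset.sortedLT_sort S |>.pairwise
    obtain ⟨l₁, l₂, hl, hl'⟩ : ∃ l₁ l₂, S.sort (· ≤ ·) = l₁ ++ l₂ ∧
        l₂ ++ l₁ = x :: y :: l' := by
      refine ⟨(S.sort (· ≤ ·)).take (k % (S.sort (· ≤ ·)).length),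
        (S.sort (· ≤ ·)).drop (k % (S.sort (· ≤ ·)).length), (List.take_append_drop _ _).symm, ?_⟩
      rw [← List.rotate_eq_drop_append_take_mod, hk]
    rw [hl, List.pairwise_append] at hlt
    have hmem' : ∀ z, z ∈ S ↔ z ∈ l₂ ++ l₁ := fun z => by
      rw [hmem, hl, List.mem_append, List.mem_append, or_comm]
    obtain ⟨p1, p2, p3⟩ := hlt
    unfold NextIn
    simp only [hmem', hl']
    match l₂, hl' with
    | [], hl' =>
      simp only [List.nil_append] at hl'
      subst hl'
      simp only [List.pairwise_cons, List.mem_cons] at p1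
      refine ⟨by simp, by simp, (p1.1 y (by simp)).ne, fun z hz h1 h2 => ?_⟩
      simp only [List.mem_cons, h1, h2, false_or] at hz
      exact Or.inl ⟨p1.1 y (by simp), p1.2.1 z hz⟩
    | [w], hl' =>
      simp only [List.cons_append, List.nil_append, List.cons.injEq] at hl'
      obtain ⟨rfl, rfl⟩ := hl'
      simp only [List.pairwise_cons, List.mem_cons] at p1 p3
      refine ⟨by simp, by simp, (p3 y (by simp) w (by simp)).ne', fun z hz h1 h2 => ?_⟩
      simp only [List.mem_cons, h1, h2, false_or] at hz
      exact Or.inr (Or.inl ⟨p1.1 z hz, p3 z (Or.inr hz) w (by simp)⟩)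
    | w :: w' :: l₃, hl' =>
      simp only [List.cons_append, List.cons.injEq] at hl'
      obtain ⟨rfl, rfl, rfl⟩ := hl'
      simp only [List.pairwise_cons, List.mem_cons] at p2 p3
      refine ⟨by simp, by simp, (p2.1 w' (by simp)).ne, fun z hz h1 h2 => ?_⟩
      simp only [List.mem_cons, h1, h2, false_or, List.mem_append] at hz
      rcases hz with hz | hz
      · exact Or.inl ⟨p2.1 w' (by simp), p2.2.1 z hz⟩
      · exact Or.inr (Or.inr ⟨p3 z hz w (by simp), p2.1 w' (by simp)⟩)
  refine ⟨fun h => ?_, back x y⟩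
  obtain ⟨l₁, l₂, hl⟩ := List.append_of_mem ((hmem x).1 h.1)
  have hlen : (S.sort (· ≤ ·)).length = S.card := Finset.length_sort _
  obtain ⟨y', l', hl'⟩ : ∃ y' l', l₂ ++ l₁ = y' :: l' := by
    cases h0 : l₂ ++ l₁ with
    | nil =>
      rw [List.append_eq_nil_iff] at h0
      rw [hl, h0.1, h0.2] at hlen
      simp at hlen; omega
    | cons y' l' => exact ⟨y', l', rfl⟩
  have hrot : (S.sort (· ≤ ·)) ~r (x :: y' :: l') := by
    rw [hl, ← hl']
    exact List.isRotated_append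
  obtain rfl := h.right_unique (back x y' ⟨l', hrot⟩)
  exact ⟨l', hrot⟩

/-- The image version of `nextIn_iff_isRotated`. -/
theorem exists_nextIn_map_iff {α : Type*} {S : Finset (Fin n)} (hS : 2 ≤ S.card)
    (g : Fin n → α) (I J : α) :
    (∃ x y, NextIn S x y ∧ g x = I ∧ g y = J) ↔
      ∃ l', ((S.sort (· ≤ ·)).map g) ~r (I :: J :: l') := by
  constructor
  · rintro ⟨x, y, h, rfl, rfl⟩
    obtain ⟨l', hl'⟩ := (nextIn_iff_isRotated hS x y).1 h
    exact ⟨l'.map g, by simpa using hl'.map g⟩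
  · rintro ⟨l', k, hk⟩
    rw [← List.map_rotate, List.map_eq_cons_iff] at hk
    obtain ⟨x, l₁, h1, h2, h3⟩ := hk
    rw [List.map_eq_cons_iff] at h3
    obtain ⟨y, l₂, h4, h5, h6⟩ := h3
    exact ⟨x, y, (nextIn_iff_isRotated hS x y).2 ⟨l₂, k, by rw [h1, h4]⟩, h2, h5⟩

end Cyclic

/-! ### Graphs given by stars, and their contractions -/

/-- A description of a labeled bicolored graph in a disk by the stars of its vertices. The star
of a vertex is a set of vertices of the polygon, in their cyclic order, and each of its elements
stands for one of the regions around the vertex, whose label is given by `label`. -/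
structure StarSystem (n : ℕ) where
  /-- the vertices of the graph -/
  Vertex : Type
  /-- the color -/
  black : Vertex → Prop
  /-- the regions around a vertex, in the cyclic order of the polygon -/
  star : Vertex → Finset (Fin n)
  /-- the labels of the regions around a vertex -/
  label : Vertex → Fin n → Finset (Fin n)

namespace StarSystem

variable {n : ℕ}

/-- The half-edge at `v` with `I` on its right and `J` on its left belongs to the graph. -/
def Half (G : StarSystem n) (v : G.Vertex) (I J : Finset (Fin n)) : Prop :=
  ∃ x y, NextIn (G.star v) x y ∧ G.label v x = I ∧ G.label v y = J

/-- The graph described by the stars: opposite half-edges are joined to edges, and a half-edge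
between the two sides of the polygon at one of its vertices is a ray. -/
def graph (G : StarSystem n) : DiskGraph n where
  Vertex := G.Vertex
  black := G.black
  edge v w I J := G.Half v I J ∧ G.Half w J I
  ray v I J := G.Half v I J ∧ ∃ c, OuterSidesAt c I J

/-- The conditions under which the stars fit together: a half-edge is determined by the labels on
its two sides, and it has an opposite half-edge unless it is a ray. -/
structure Valid (G : StarSystem n) : Prop where
  three_le : ∀ v, 3 ≤ (G.star v).card
  injOn : ∀ v, Set.InjOn (G.label v) (G.star v)
  unique : ∀ v w I J, G.Half v I J → G.Half w I J → v = w
  cover : ∀ v I J, G.Half v I J → (∃ c, OuterSidesAt c I J) ∨ ∃ w, G.Half w J I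
  outer : ∀ c v I J, OuterSidesAt c I J → ¬ G.Half v J I

theorem Valid.isPlane {G : StarSystem n} (hG : G.Valid) : G.graph.IsPlane where
  edge_symm _ _ _ _ h := ⟨h.2, h.1⟩
  edge_unique v w w' I J h h' := hG.unique w w' J I h.2 h'.2
  edge_not_ray v w I J h h' := by
    obtain ⟨c, hc⟩ := h'.2
    exact hG.outer c w I J hc h.2
  rotation v := by
    have h2 : 2 ≤ (G.star v).card := by have := hG.three_le v; omega
    refine ⟨((G.star v).sort (· ≤ ·)).map (G.label v), ?_, by simpa using h2, fun I J => ?_⟩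
    · refine List.Nodup.map_on (fun x hx y hy h => ?_) (Finset.sort_nodup _ _)
      exact hG.injOn v (by simpa using hx) (by simpa using hy) h
    · rw [← exists_nextIn_map_iff h2]
      constructor
      · rintro (h | ⟨w, h⟩)
        · exact h.1
        · exact h.1
      · intro h
        rcases hG.cover v I J h with hc | ⟨w, hw⟩
        · exact Or.inl ⟨h, hc⟩
        · exact Or.inr ⟨w, h, hw⟩

open Classical in
/-- The result of gluing the star of `w` to the star of `v`. -/
noncomputable def contract (G : StarSystem n) (v w : G.Vertex) : StarSystem n where
  Vertex := {u : G.Vertex // u ≠ w}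
  black u := G.black u.1
  star u := if u.1 = v then G.star v ∪ G.star w else G.star u.1
  label u := G.label u.1

open Classical in
/-- The map on vertices that belongs to `StarSystem.contract`. -/
noncomputable def contractMap (G : StarSystem n) {v w : G.Vertex} (hvw : v ≠ w) (u : G.Vertex) :
    (G.contract v w).Vertex :=
  (if h : u = w then ⟨v, hvw⟩ else ⟨u, h⟩ : {u : G.Vertex // u ≠ w})

theorem contractMap_self (G : StarSystem n) {v w : G.Vertex} (hvw : v ≠ w) :
    (G.contractMap hvw w).1 = v := by
  simp [contractMap]

theorem contractMap_of_ne (G : StarSystem n) {v w u : G.Vertex} (hvw : v ≠ w) (hu : u ≠ w) :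
    (G.contractMap hvw u).1 = u := by
  simp [contractMap, hu]

theorem contractMap_eq_iff (G : StarSystem n) {v w : G.Vertex} (hvw : v ≠ w) (x y : G.Vertex) :
    G.contractMap hvw x = G.contractMap hvw y ↔ x = y ∨ (x = v ∧ y = w) ∨ (x = w ∧ y = v) := by
  have h : G.contractMap hvw x = G.contractMap hvw y ↔
    (G.contractMap hvw x).1 = (G.contractMap hvw y).1 := Subtype.ext_iff
  rw [h]
  by_cases h1 : x = w <;> by_cases h2 : y = w
  · simp [h1, h2]
  · rw [h1, contractMap_self, contractMap_of_ne _ _ h2]; grind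
  · rw [h2, contractMap_self, contractMap_of_ne _ _ h1]; grind
  · rw [contractMap_of_ne _ _ h2, contractMap_of_ne _ _ h1]; grind

open Classical in
theorem contract_star (G : StarSystem n) (v w : G.Vertex) (u : (G.contract v w).Vertex) :
    (G.contract v w).star u = if u.1 = v then G.star v ∪ G.star w else G.star u.1 := rfl

/-- The data of a contractible edge: it joins two vertices of the same color whose stars use the
same labels. -/
structure Contractible (G : StarSystem n) (v w : G.Vertex) (x y : Fin n) : Prop where
  ne : v ≠ w
  color : G.black v ↔ G.black w
  label_eq : G.label v = G.label w
  injOn : Set.InjOn (G.label v) (G.star v ∪ G.star w : Finset (Fin n))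
  left : NextIn (G.star v) x y
  right : NextIn (G.star w) y x

theorem half_contract_iff {G : StarSystem n} (hG : G.Valid) {v w : G.Vertex} {x y : Fin n}
    (h : G.Contractible v w x y) (a : (G.contract v w).Vertex) (I J : Finset (Fin n)) :
    (G.contract v w).Half a I J ↔ ∃ u, G.contractMap h.ne u = a ∧ G.Half u I J ∧
      ¬ (u = v ∧ I = G.label v x ∧ J = G.label v y) ∧
      ¬ (u = w ∧ I = G.label v y ∧ J = G.label v x) := by
  classical
  have inj : ∀ s t, s ∈ G.star v ∪ G.star w → t ∈ G.star v ∪ G.star w →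
      (G.label v s = G.label v t ↔ s = t) := fun s t hs ht =>
    h.injOn.eq_iff (by exact_mod_cast hs) (by exact_mod_cast ht)
  have hx := Finset.mem_union_left (G.star w) h.left.1
  have hy := Finset.mem_union_left (G.star w) h.left.2.1
  have hstar : (G.contract v w).Half a I J ↔ ∃ s t, NextIn (if a.1 = v then G.star v ∪ G.star w
      else G.star a.1) s t ∧ G.label a.1 s = I ∧ G.label a.1 t = J := by
    unfold Half
    rw [contract_star]
    exact Iff.rfl
  rw [hstar]
  have hm : ∀ u, G.contractMap h.ne u = a ↔ (u = w ∧ a.1 = v) ∨ u = a.1 := by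
    intro u
    have ha := a.2
    have h0 : G.contractMap h.ne u = a ↔ (G.contractMap h.ne u).1 = a.1 := Subtype.ext_iff
    rw [h0]
    by_cases h1 : u = w
    · rw [h1, contractMap_self]; grind
    · rw [contractMap_of_ne _ _ h1]; grind
  simp only [hm]
  split_ifs with hav
  · simp only [nextIn_union (hG.three_le v) (hG.three_le w) h.left h.right, hav]
    constructor
    · rintro ⟨s, t, ⟨hst, hne⟩ | ⟨hst, hne⟩, rfl, rfl⟩
      · refine ⟨v, Or.inr rfl, ⟨s, t, hst, rfl, rfl⟩, ?_, fun hc => h.ne hc.1⟩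
        rintro ⟨-, h1, h2⟩
        rw [inj _ _ (Finset.mem_union_left _ hst.1) hx] at h1
        rw [inj _ _ (Finset.mem_union_left _ hst.2.1) hy] at h2
        exact hne ⟨h1, h2⟩
      · refine ⟨w, Or.inl ⟨rfl, trivial⟩, ⟨s, t, hst, by rw [h.label_eq], by rw [h.label_eq]⟩,
          fun hc => h.ne hc.1.symm, ?_⟩
        rintro ⟨-, h1, h2⟩
        rw [inj _ _ (Finset.mem_union_right _ hst.1) hy] at h1
        rw [inj _ _ (Finset.mem_union_right _ hst.2.1) hx] at h2
        exact hne ⟨h1, h2⟩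
    · rintro ⟨u, ⟨rfl, -⟩ | rfl, ⟨s, t, hst, rfl, rfl⟩, h1, h2⟩
      · refine ⟨s, t, Or.inr ⟨hst, ?_⟩, by rw [h.label_eq], by rw [h.label_eq]⟩
        rintro ⟨rfl, rfl⟩
        exact h2 ⟨rfl, by rw [h.label_eq], by rw [h.label_eq]⟩
      · refine ⟨s, t, Or.inl ⟨hst, ?_⟩, rfl, rfl⟩
        rintro ⟨rfl, rfl⟩
        exact h1 ⟨rfl, rfl, rfl⟩
  · constructor
    · rintro ⟨s, t, hst, rfl, rfl⟩
      exact ⟨a.1, Or.inr rfl, ⟨s, t, hst, rfl, rfl⟩, fun hc => hav hc.1, fun hc => a.2 hc.1⟩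
    · rintro ⟨u, ⟨-, h0⟩ | rfl, ⟨s, t, hst, rfl, rfl⟩, h1, h2⟩
      · exact absurd h0 hav
      · exact ⟨s, t, hst, rfl, rfl⟩

theorem Contractible.half_left {G : StarSystem n} {v w : G.Vertex} {x y : Fin n}
    (h : G.Contractible v w x y) : G.Half v (G.label v x) (G.label v y) :=
  ⟨x, y, h.left, rfl, rfl⟩

theorem Contractible.half_right {G : StarSystem n} {v w : G.Vertex} {x y : Fin n}
    (h : G.Contractible v w x y) : G.Half w (G.label v y) (G.label v x) :=
  ⟨y, x, h.right, by rw [h.label_eq], by rw [h.label_eq]⟩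

theorem Valid.contract {G : StarSystem n} (hG : G.Valid) {v w : G.Vertex} {x y : Fin n}
    (h : G.Contractible v w x y) : (G.contract v w).Valid where
  three_le u := by
    rw [contract_star]
    split_ifs
    · exact (hG.three_le v).trans (Finset.card_le_card Finset.subset_union_left)
    · exact hG.three_le _
  injOn u := by
    rw [contract_star]
    split_ifs with h0
    · have : (G.contract v w).label u = G.label v := by rw [← h0]; rfl
      rw [this]
      exact h.injOn
    · exact hG.injOn _
  unique a b I J ha hb := by
    rw [half_contract_iff hG h] at ha hb
    obtain ⟨u, rfl, hu, -⟩ := ha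
    obtain ⟨u', rfl, hu', -⟩ := hb
    rw [hG.unique u u' I J hu hu']
  cover a I J ha := by
    rw [half_contract_iff hG h] at ha
    obtain ⟨u, rfl, hu, h1, h2⟩ := ha
    refine (hG.cover u I J hu).imp_right ?_
    rintro ⟨u', hu'⟩
    refine ⟨G.contractMap h.ne u', (half_contract_iff hG h _ _ _).2 ⟨u', rfl, hu', ?_, ?_⟩⟩
    · rintro ⟨rfl, rfl, rfl⟩
      exact h2 ⟨hG.unique _ _ _ _ hu h.half_right, rfl, rfl⟩
    · rintro ⟨rfl, rfl, rfl⟩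
      exact h1 ⟨hG.unique _ _ _ _ hu h.half_left, rfl, rfl⟩
  outer c a I J hc ha := by
    rw [half_contract_iff hG h] at ha
    obtain ⟨u, rfl, hu, -⟩ := ha
    exact hG.outer c u I J hc hu

theorem Valid.contracts {G : StarSystem n} (hG : G.Valid) {v w : G.Vertex} {x y : Fin n}
    (h : G.Contractible v w x y) : DiskGraph.Contracts G.graph (G.contract v w).graph := by
  refine ⟨hG.isPlane, (hG.contract h).isPlane, v, w, G.label v x, G.label v y,
    G.contractMap h.ne, ⟨h.half_left, h.half_right⟩, h.ne, h.color, ?_,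
    G.contractMap_eq_iff h.ne, ?_, ?_, ?_⟩
  · intro a
    exact ⟨a.1, Subtype.ext (G.contractMap_of_ne h.ne a.2)⟩
  · intro u
    change G.black (G.contractMap h.ne u).1 ↔ G.black u
    by_cases h0 : u = w
    · rw [h0, contractMap_self]; exact h.color
    · rw [contractMap_of_ne _ _ h0]
  · intro (a : (G.contract v w).Vertex) (b : (G.contract v w).Vertex) K L
    change (G.contract v w).Half a K L ∧ (G.contract v w).Half b L K ↔ _
    rw [half_contract_iff hG h, half_contract_iff hG h]
    constructor
    · rintro ⟨⟨u, rfl, hu, h1, h2⟩, ⟨u', rfl, hu', h1', h2'⟩⟩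
      exact ⟨u, u', rfl, rfl, ⟨hu, hu'⟩, fun hc => h1 ⟨hc.1, hc.2.2⟩, fun hc => h2 ⟨hc.1, hc.2.2⟩⟩
    · rintro ⟨u, u', rfl, rfl, ⟨hu, hu'⟩, h1, h2⟩
      refine ⟨⟨u, rfl, hu, ?_, ?_⟩, ⟨u', rfl, hu', ?_, ?_⟩⟩
      · rintro ⟨rfl, rfl, rfl⟩
        exact h1 ⟨rfl, hG.unique _ _ _ _ hu' h.half_right, rfl, rfl⟩
      · rintro ⟨rfl, rfl, rfl⟩
        exact h2 ⟨rfl, hG.unique _ _ _ _ hu' h.half_left, rfl, rfl⟩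
      · rintro ⟨rfl, rfl, rfl⟩
        exact h2 ⟨hG.unique _ _ _ _ hu h.half_right, rfl, rfl, rfl⟩
      · rintro ⟨rfl, rfl, rfl⟩
        exact h1 ⟨hG.unique _ _ _ _ hu h.half_left, rfl, rfl, rfl⟩
  · intro (a : (G.contract v w).Vertex) K L
    change (G.contract v w).Half a K L ∧ _ ↔ _
    rw [half_contract_iff hG h]
    constructor
    · rintro ⟨⟨u, rfl, hu, -⟩, hc⟩
      exact ⟨u, rfl, hu, hc⟩
    · rintro ⟨u, rfl, hu, c, hc⟩
      refine ⟨⟨u, rfl, hu, ?_, ?_⟩, c, hc⟩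
      · rintro ⟨rfl, rfl, rfl⟩
        exact hG.outer c w _ _ hc h.half_right
      · rintro ⟨rfl, rfl, rfl⟩
        exact hG.outer c v _ _ hc h.half_left

end StarSystem

/-! ### Recognizing triangulations -/

section Recognize

variable {n : ℕ}

theorem exists_eq_pair_of_card_eq_two {I : Finset (Fin n)} (h : I.card = 2) :
    ∃ i j, i < j ∧ I = {i, j} := by
  obtain ⟨i, j, hij, rfl⟩ := Finset.card_eq_two.1 h
  rcases lt_or_gt_of_ne hij with h | h
  · exact ⟨i, j, h, rfl⟩
  · exact ⟨j, i, h, Finset.pair_comm _ _⟩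

theorem exists_eq_pair_of_mem {I : Finset (Fin n)} (hI : I.card = 2) {a : Fin n} (ha : a ∈ I) :
    ∃ b, b ≠ a ∧ I = {a, b} := by
  obtain ⟨b, hb⟩ : ∃ b, I.erase a = {b} := by
    rw [← Finset.card_eq_one, Finset.card_erase_of_mem ha, hI]
  refine ⟨b, ?_, by rw [← Finset.insert_erase ha, hb]⟩
  have : b ∈ I.erase a := by rw [hb]; simp
  exact (Finset.mem_erase.1 this).1

theorem exists_eq_triple_of_card_eq_three {τ : Finset (Fin n)} (h : τ.card = 3) :
    ∃ i j k, i < j ∧ j < k ∧ τ = {i, j, k} := by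
  obtain ⟨a, b, c, hab, hac, hbc, rfl⟩ := Finset.card_eq_three.1 h
  rcases lt_or_gt_of_ne hab with h1 | h1 <;> rcases lt_or_gt_of_ne hac with h2 | h2 <;>
    rcases lt_or_gt_of_ne hbc with h3 | h3
  · exact ⟨a, b, c, h1, h3, rfl⟩
  · exact ⟨a, c, b, h2, h3, by grind⟩
  · exact absurd (h1.trans h3) h2.asymm
  · exact ⟨c, a, b, h2, h1, by grind⟩
  · exact ⟨b, a, c, h1, h2, by grind⟩
  · exact absurd (h1.trans h2) h3.asymm
  · exact ⟨b, c, a, h3, h2, by grind⟩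
  · exact ⟨c, b, a, h3, h1, by grind⟩

/-- A family of chords `E i j` (`i < j`) together with a family of
triangles `t i j k` (`i < j < k`), in which every chord belongs to exactly one triangle on each
side on which there are vertices of the polygon. -/
structure TriangleComplex (E : Fin n → Fin n → Prop) (t : Fin n → Fin n → Fin n → Prop) :
    Prop where
  edges : ∀ i j k, t i j k → E i j ∧ E j k ∧ E i k
  inner : ∀ i j, E i j → (∃ x, i < x ∧ x < j) → ∃ x, i < x ∧ x < j ∧ t i x j
  inner_unique : ∀ i j x y, i < x → x < j → i < y → y < j → t i x j → t i y j → x = y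
  outer : ∀ i j, i < j → E i j → (∃ z, z < i ∨ j < z) → ∃ z, (z < i ∧ t z i j) ∨ (j < z ∧ t i j z)

/-- If no chord crosses `{l, r}`, then no chord passes across the third vertex `x` of the
triangle below `{l, r}`: such a chord could be enlarged indefinitely. -/
theorem TriangleComplex.straddle {E : Fin n → Fin n → Prop} {t : Fin n → Fin n → Fin n → Prop}
    (h : TriangleComplex E t) {l x r : Fin n} (hlx : l < x) (hxr : x < r)
    (ht : t l x r)
    (hP : ∀ u v, E u v → ¬ (l < u ∧ u < r ∧ r < v) ∧ ¬ (u < l ∧ l < v ∧ v < r)) :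
    ∀ (m : ℕ) (u v : Fin n), n - ((v : ℕ) - u) = m → E u v → l ≤ u → u < x → x < v → v ≤ r →
      u = l ∧ v = r := by
  intro m
  induction m using Nat.strong_induction_on with
  | _ m ih =>
    intro u v hm huv hlu hux hxv hvr
    by_contra hne
    have hlr : (∃ z, z < u ∨ v < z) := by
      by_cases h1 : u = l
      · exact ⟨r, Or.inr (lt_of_le_of_ne hvr fun h2 => hne ⟨h1, h2⟩)⟩
      · exact ⟨l, Or.inl (lt_of_le_of_ne hlu (Ne.symm h1))⟩
    obtain ⟨z, ⟨hz, hzt⟩ | ⟨hz, hzt⟩⟩ := h.outer u v (hux.trans hxv) huv hlr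
    · have hE := h.edges _ _ _ hzt
      by_cases hlz : l ≤ z
      · have hlt : n - ((v : ℕ) - z) < m := by
          have := v.2; simp only [Fin.lt_def] at *; omega
        obtain ⟨rfl, rfl⟩ := ih _ hlt z v rfl hE.2.2 hlz (hz.trans hux) hxv hvr
        exact hux.ne (h.inner_unique _ _ _ _ hz (hux.trans hxv) hlx hxr hzt ht)
      · have h1 := (hP _ _ hE.2.2).2
        have h2 := (hP _ _ hE.1).2
        grind
    · have hE := h.edges _ _ _ hzt
      by_cases hlz : z ≤ r
      · have hlt : n - ((z : ℕ) - u) < m := by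
          have := z.2; simp only [Fin.lt_def] at *; omega
        obtain ⟨rfl, rfl⟩ := ih _ hlt u z rfl hE.2.2 hlu hux (hxv.trans hz) hlz
        exact hxv.ne' (h.inner_unique _ _ _ _ (hux.trans hxv) hz hlx hxr hzt ht)
      · have h1 := (hP _ _ hE.2.2).1
        have h2 := (hP _ _ hE.2.1).1
        grind

/-- Going down from the chord that joins the first and the last vertex, one finds that no
two chords cross. -/
theorem TriangleComplex.noncrossing {E : Fin n → Fin n → Prop}
    {t : Fin n → Fin n → Fin n → Prop} (h : TriangleComplex E t)
    (hE : ∀ i j, E i j → i < j) :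
    ∀ (m : ℕ) (l r : Fin n), n - ((r : ℕ) - l) = m → E l r →
      ∀ u v, E u v → ¬ (l < u ∧ u < r ∧ r < v) ∧ ¬ (u < l ∧ l < v ∧ v < r) := by
  intro m
  induction m using Nat.strong_induction_on with
  | _ m ih =>
    intro l r hm hlr
    by_cases hz : ∃ z, z < l ∨ r < z
    · obtain ⟨z, ⟨hz, hzt⟩ | ⟨hz, hzt⟩⟩ := h.outer l r (hE _ _ hlr) hlr hz
      · have hz' := h.edges _ _ _ hzt
        have hlt : n - ((r : ℕ) - z) < m := by
          have := r.2; have := hE _ _ hlr; simp only [Fin.lt_def] at *; omega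
        have hP := ih _ hlt z r rfl hz'.2.2
        have hs := h.straddle hz (hE _ _ hlr) hzt hP
        intro u v huv
        have h1 := hP u v huv
        have h2 := hs _ u v rfl huv
        have h3 := hE _ _ hlr
        grind
      · have hz' := h.edges _ _ _ hzt
        have hlt : n - ((z : ℕ) - l) < m := by
          have := z.2; have := hE _ _ hlr; simp only [Fin.lt_def] at *; omega
        have hP := ih _ hlt l z rfl hz'.2.2
        have hs := h.straddle (hE _ _ hlr) hz hzt hP
        intro u v huv
        have h1 := hP u v huv
        have h2 := hs _ u v rfl huv
        have h3 := hE _ _ hlr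
        grind
    · push Not at hz
      intro u v _
      have h1 := hz u
      have h2 := hz v
      grind

/-- A chord that is crossed by no chord of the family belongs to the family: go to the
smallest chord of the family that is above it. -/
theorem TriangleComplex.maximal {E : Fin n → Fin n → Prop}
    {t : Fin n → Fin n → Fin n → Prop} (h : TriangleComplex E t) {u v : Fin n} (huv : u < v)
    (hJ : ∀ l r, E l r → ¬ (l < u ∧ u < r ∧ r < v) ∧ ¬ (u < l ∧ l < v ∧ v < r)) :
    ∀ (m : ℕ) (l r : Fin n), (r : ℕ) - l = m → E l r → l ≤ u → v ≤ r → E u v := by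
  intro m
  induction m using Nat.strong_induction_on with
  | _ m ih =>
    intro l r hm hlr hlu hvr
    by_cases heq : l = u ∧ r = v
    · rwa [← heq.1, ← heq.2]
    have hx : ∃ x, l < x ∧ x < r := by
      by_cases h1 : l = u
      · exact ⟨v, by grind⟩
      · exact ⟨u, by grind⟩
    obtain ⟨x, hlx, hxr, hxt⟩ := h.inner l r hlr hx
    have hxE := h.edges _ _ _ hxt
    by_cases h1 : x ≤ u
    · refine ih _ ?_ x r rfl hxE.2.1 h1 hvr
      simp only [Fin.lt_def] at *; omega
    by_cases h2 : v ≤ x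
    · refine ih _ ?_ l x rfl hxE.1 hlu h2
      simp only [Fin.lt_def] at *; omega
    have h3 := hJ _ _ hxE.1
    have h4 := hJ _ _ hxE.2.1
    grind

theorem isSide_last (hn : 3 ≤ n) :
    IsSide ({⟨0, by omega⟩, ⟨n - 1, by omega⟩} : Finset (Fin n)) := by
  refine ⟨⟨n - 1, by omega⟩, ⟨0, by omega⟩, ?_, Finset.pair_comm _ _⟩
  unfold Follows
  simp only
  rw [show n - 1 + 1 = n by omega, Nat.mod_self]

/-- A family `R` of chords that contains the sides, with a family `B` of triangles whose edges
are in `R`, such that every chord in `R` belongs to exactly one of the triangles on each side,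
is a triangulation, and `B` consists of its triangles. -/
theorem isTriangulation_of_unique_triangle (hn : 3 ≤ n) {R : Set (Finset (Fin n))}
    {B : Finset (Fin n) → Prop} (hcard : ∀ I ∈ R, I.card = 2) (hside : ∀ I, IsSide I → I ∈ R)
    (hB : ∀ τ, B τ → IsTriangle R τ)
    (hex : ∀ a b, {a, b} ∈ R → (∃ x, CounterClockwise a x b) →
      ∃ x, CounterClockwise a x b ∧ B {a, x, b})
    (huniq : ∀ a b x y, CounterClockwise a x b → CounterClockwise a y b →
      B {a, x, b} → B {a, y, b} → x = y) :
    IsTriangulation R ∧ ∀ τ, IsTriangle R τ ↔ B τ := by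
  have hC : TriangleComplex (fun i j : Fin n => i < j ∧ ({i, j} : Finset (Fin n)) ∈ R)
      (fun i j k => i < j ∧ j < k ∧ B {i, j, k}) := by
    refine ⟨?_, ?_, ?_, ?_⟩
    · rintro i j k ⟨hij, hjk, ht⟩
      have := (hB _ ht).2
      refine ⟨⟨hij, this _ ?_ (Finset.card_pair hij.ne)⟩,
        ⟨hjk, this _ ?_ (Finset.card_pair hjk.ne)⟩,
        ⟨hij.trans hjk, this _ ?_ (Finset.card_pair (hij.trans hjk).ne)⟩⟩ <;> grind
    · rintro i j ⟨hij, hR⟩ ⟨x, hx⟩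
      obtain ⟨y, hy, hyB⟩ := hex i j hR ⟨x, Or.inl hx⟩
      have hy' : i < y ∧ y < j := by unfold CounterClockwise at hy; grind
      exact ⟨y, hy'.1, hy'.2, hy'.1, hy'.2, hyB⟩
    · rintro i j x y hix hxj hiy hyj ⟨-, -, hx⟩ ⟨-, -, hy⟩
      exact huniq i j x y (Or.inl ⟨hix, hxj⟩) (Or.inl ⟨hiy, hyj⟩) hx hy
    · rintro i j hij ⟨-, hR⟩ ⟨z, hz⟩
      rw [Finset.pair_comm] at hR
      obtain ⟨y, hy, hyB⟩ := hex j i hR ⟨z, by unfold CounterClockwise; grind⟩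
      have hy' : y < i ∨ j < y := by unfold CounterClockwise at hy; grind
      rcases hy' with hy' | hy'
      · refine ⟨y, Or.inl ⟨hy', hy', hij, ?_⟩⟩
        convert hyB using 1; grind
      · refine ⟨y, Or.inr ⟨hy', hij, hy', ?_⟩⟩
        convert hyB using 1; grind
  have hnc := fun l r hlr => hC.noncrossing (fun i j h => h.1) _ l r rfl hlr
  have hcross : ∀ a b c d : Fin n, a < b → b < c → c < d → ({a, c} : Finset (Fin n)) ∈ R →
      ({b, d} : Finset (Fin n)) ∈ R → False := by
    intro a b c d hab hbc hcd h1 h2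
    exact (hnc a c ⟨hab.trans hbc, h1⟩ b d ⟨hbc.trans hcd, h2⟩).1 ⟨hab, hbc, hcd⟩
  refine ⟨⟨hcard, ?_, ?_⟩, fun τ => ⟨?_, hB τ⟩⟩
  · rintro I hI J hJ ⟨a, b, c, d, hab, hbc, hcd, ⟨rfl, rfl⟩ | ⟨rfl, rfl⟩⟩
    · exact hcross a b c d hab hbc hcd hI hJ
    · exact hcross a b c d hab hbc hcd hJ hI
  · intro J hJ hJc
    obtain ⟨u, v, huv, rfl⟩ := exists_eq_pair_of_card_eq_two hJ
    have hroot := hside _ (isSide_last hn)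
    refine (hC.maximal huv ?_ _ ⟨0, by omega⟩ ⟨n - 1, by omega⟩ rfl ⟨?_, hroot⟩ ?_ ?_).2
    · rintro l r ⟨hlr, hR⟩
      refine ⟨fun hc => hJc _ hR ⟨l, u, r, v, hc.1, hc.2.1, hc.2.2, Or.inl ⟨rfl, rfl⟩⟩,
        fun hc => hJc _ hR ⟨u, l, v, r, hc.1, hc.2.1, hc.2.2, Or.inr ⟨rfl, rfl⟩⟩⟩
    · simp only [Fin.lt_def]; omega
    · simp only [Fin.le_def]; omega
    · have := v.2
      simp only [Fin.le_def]; omega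
  · rintro ⟨h3, hτ⟩
    obtain ⟨i, j, k, hij, hjk, rfl⟩ := exists_eq_triple_of_card_eq_three h3
    have hik := hij.trans hjk
    have e1 := hτ {i, j} (by grind) (Finset.card_pair hij.ne)
    have e2 := hτ {j, k} (by grind) (Finset.card_pair hjk.ne)
    have e3 := hτ {i, k} (by grind) (Finset.card_pair hik.ne)
    obtain ⟨x, hix, hxk, -, -, hx⟩ := hC.inner i k ⟨hik, e3⟩ ⟨j, hij, hjk⟩
    have hxR := (hB _ hx).2
    rcases lt_trichotomy x j with h | rfl | h
    · exact (hcross i x j k hix h hjk e1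
        (hxR {x, k} (by grind) (Finset.card_pair hxk.ne))).elim
    · exact hx
    · exact (hcross i j x k hij h hxk
        (hxR {i, x} (by grind) (Finset.card_pair hix.ne)) e2).elim

end Recognize

/-! ### The neighbors of a vertex in a triangulation -/

section Neighbors

variable {n : ℕ}

open Classical in
/-- The vertices of the polygon that are joined to `c` by a chord in `T`. -/
noncomputable def nbrs (T : Set (Finset (Fin n))) (c : Fin n) : Finset (Fin n) :=
  Finset.univ.filter fun x => x ≠ c ∧ {c, x} ∈ T

theorem mem_nbrs {T : Set (Finset (Fin n))} {c x : Fin n} :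
    x ∈ nbrs T c ↔ x ≠ c ∧ ({c, x} : Finset (Fin n)) ∈ T := by
  simp [nbrs]

/-- `Follows` in a form without the remainder. -/
theorem follows_iff {i j : Fin n} :
    Follows i j ↔ (j : ℕ) = i + 1 ∨ ((i : ℕ) + 1 = n ∧ (j : ℕ) = 0) := by
  unfold Follows
  have hi := i.2
  have hj := j.2
  rcases Nat.lt_or_ge ((i : ℕ) + 1) n with h | h
  · rw [Nat.mod_eq_of_lt h]; omega
  · rw [show (i : ℕ) + 1 = n by omega, Nat.mod_self]; omega

theorem exists_follows (c : Fin n) : ∃ s, Follows c s :=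
  ⟨⟨((c : ℕ) + 1) % n, Nat.mod_lt _ (by have := c.2; omega)⟩, rfl⟩

theorem exists_follows_left (c : Fin n) : ∃ p, Follows p c := by
  have hc := c.2
  rcases Nat.eq_zero_or_pos (c : ℕ) with h | h
  · exact ⟨⟨n - 1, by omega⟩, follows_iff.2 (by simp only; omega)⟩
  · exact ⟨⟨(c : ℕ) - 1, by omega⟩, follows_iff.2 (by simp only; omega)⟩

theorem Follows.ne (hn : 3 ≤ n) {i j : Fin n} (h : Follows i j) : i ≠ j := by
  rintro rfl
  rw [follows_iff] at h; omega

theorem counterClockwise_of_follows (hn : 3 ≤ n) {p c s : Fin n} (h : Follows p c)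
    (h' : Follows c s) : CounterClockwise c s p := by
  rw [follows_iff] at h h'
  have := p.2; have := c.2; have := s.2
  simp only [CounterClockwise, Fin.lt_def]; omega

/-- No vertex is strictly between two consecutive ones. -/
theorem Follows.not_between {i j x : Fin n} (h : Follows i j) : ¬ CounterClockwise i x j := by
  rw [follows_iff] at h
  have := i.2; have := j.2; have := x.2
  simp only [CounterClockwise, Fin.lt_def]; omega

theorem crossing_of_counterClockwise {a b x y : Fin n} (h : CounterClockwise a x b)
    (h' : CounterClockwise b y a) : Crossing {a, b} {x, y} := by
  have key : ∀ p q r s : Fin n, p < q → q < r → r < s →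
      (({a, b} : Finset (Fin n)) = {p, r} ∧ ({x, y} : Finset (Fin n)) = {q, s}) ∨
      (({a, b} : Finset (Fin n)) = {q, s} ∧ ({x, y} : Finset (Fin n)) = {p, r}) →
      Crossing {a, b} {x, y} := fun p q r s h1 h2 h3 h4 => ⟨p, q, r, s, h1, h2, h3, h4⟩
  rcases h with h | h | h <;> rcases h' with h' | h' | h'
  · grind
  · exact key y a x b h'.1 h.1 h.2 (Or.inr ⟨rfl, Finset.pair_comm _ _⟩)
  · exact key a x b y h.1 h.2 h'.2 (Or.inl ⟨rfl, rfl⟩)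
  · exact key x b y a h.1 h'.1 h'.2 (Or.inr ⟨Finset.pair_comm _ _, rfl⟩)
  · grind
  · grind
  · exact key b y a x h'.1 h'.2 h.2 (Or.inl ⟨Finset.pair_comm _ _, Finset.pair_comm _ _⟩)
  · grind
  · grind

theorem Crossing.counterClockwise {a b x y : Fin n} (h : Crossing {a, b} {x, y}) :
    (CounterClockwise a x b ∧ CounterClockwise b y a) ∨
      (CounterClockwise a y b ∧ CounterClockwise b x a) := by
  obtain ⟨p, q, r, s, hpq, hqr, hrs, h⟩ := h
  have pair : ∀ {a b p r : Fin n}, ({a, b} : Finset (Fin n)) = {p, r} → p ≠ r →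
      (a = p ∧ b = r) ∨ (a = r ∧ b = p) := by
    intro a b p r h hne
    have h1 : p ∈ ({a, b} : Finset (Fin n)) := by rw [h]; simp
    have h2 : r ∈ ({a, b} : Finset (Fin n)) := by rw [h]; simp
    simp only [Finset.mem_insert, Finset.mem_singleton] at h1 h2
    grind
  unfold CounterClockwise
  rcases h with ⟨h1, h2⟩ | ⟨h1, h2⟩ <;>
    rcases pair h1 (by grind) with ⟨rfl, rfl⟩ | ⟨rfl, rfl⟩ <;>
    rcases pair h2 (by grind) with ⟨rfl, rfl⟩ | ⟨rfl, rfl⟩ <;> grind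

theorem Crossing.symm {I J : Finset (Fin n)} (h : Crossing I J) : Crossing J I := by
  obtain ⟨a, b, c, d, h1, h2, h3, h | h⟩ := h
  · exact ⟨a, b, c, d, h1, h2, h3, Or.inr ⟨h.2, h.1⟩⟩
  · exact ⟨a, b, c, d, h1, h2, h3, Or.inl ⟨h.2, h.1⟩⟩

variable {T : Set (Finset (Fin n))}

theorem IsTriangulation.side_mem (hn : 3 ≤ n) (hT : IsTriangulation T) {i j : Fin n}
    (h : Follows i j) : {i, j} ∈ T := by
  refine hT.maximal _ (Finset.card_pair (h.ne hn)) fun I hI hc => ?_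
  obtain ⟨x, y, -, rfl⟩ := exists_eq_pair_of_card_eq_two (hT.card_eq_two I hI)
  rcases hc.symm.counterClockwise with h1 | h1
  · exact h.not_between h1.1
  · exact h.not_between h1.1

theorem IsTriangulation.follows_mem_nbrs (hn : 3 ≤ n) (hT : IsTriangulation T) {c s : Fin n}
    (h : Follows c s) : s ∈ nbrs T c :=
  mem_nbrs.2 ⟨(h.ne hn).symm, hT.side_mem hn h⟩

theorem IsTriangulation.follows_left_mem_nbrs (hn : 3 ≤ n) (hT : IsTriangulation T)
    {p c : Fin n} (h : Follows p c) : p ∈ nbrs T c :=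
  mem_nbrs.2 ⟨h.ne hn, by rw [Finset.pair_comm]; exact hT.side_mem hn h⟩

/-- The two sides of the polygon at `c` are neighbors in the cyclic order of the chords
at `c`. -/
theorem IsTriangulation.nextIn_nbrs_of_follows (hn : 3 ≤ n) (hT : IsTriangulation T)
    {p c s : Fin n} (h : Follows p c) (h' : Follows c s) : NextIn (nbrs T c) p s := by
  have hccw := counterClockwise_of_follows hn h h'
  refine ⟨hT.follows_left_mem_nbrs hn h, hT.follows_mem_nbrs hn h', hccw.ne.2.1.symm, ?_⟩
  intro z hz hzp hzs
  have hzc := (mem_nbrs.1 hz).1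
  rw [follows_iff] at h h'
  have := p.2; have := c.2; have := s.2; have := z.2
  simp only [CounterClockwise, Fin.lt_def, ne_eq, Fin.ext_iff] at *; omega

theorem IsTriangulation.nextIn_nbrs_of_triangle (hT : IsTriangulation T) {c a b : Fin n}
    (h : CounterClockwise c a b) (ha : {c, a} ∈ T) (hb : {c, b} ∈ T) (hab : {a, b} ∈ T) :
    NextIn (nbrs T c) a b := by
  have hne := h.ne
  refine ⟨mem_nbrs.2 ⟨hne.1.symm, ha⟩, mem_nbrs.2 ⟨hne.2.2.symm, hb⟩, hne.2.1, ?_⟩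
  intro z hz hza hzb
  obtain ⟨hzc, hz⟩ := mem_nbrs.1 hz
  rcases counterClockwise_total hne.2.1 hza.symm hzb.symm with h1 | h1
  · exact h1
  · refine absurd (crossing_of_counterClockwise h1 h.rotate.rotate) (hT.noncrossing _ hab _ ?_)
    rw [Finset.pair_comm]; exact hz

/-- Two consecutive chords at `c` are either sides of a triangle or the two sides of the
polygon at `c`. -/
theorem IsTriangulation.nextIn_nbrs_cases (hn : 3 ≤ n) (hT : IsTriangulation T) {c x y : Fin n}
    (h : NextIn (nbrs T c) x y) :
    (CounterClockwise c x y ∧ {x, y} ∈ T) ∨ (Follows x c ∧ Follows c y) := by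
  obtain ⟨hx, hy, hxy, hz⟩ := h
  have hxc := (mem_nbrs.1 hx).1
  have hyc := (mem_nbrs.1 hy).1
  rcases counterClockwise_total hxc.symm hyc.symm hxy with h1 | h1
  · refine Or.inl ⟨h1, hT.maximal _ (Finset.card_pair hxy) fun I hI hc => ?_⟩
    obtain ⟨z, u, -, rfl⟩ := exists_eq_pair_of_card_eq_two (hT.card_eq_two I hI)
    have key : ∀ z u : Fin n, {z, u} ∈ T → CounterClockwise x z y → CounterClockwise y u x →
        False := by
      intro z u hI h2 h3
      by_cases huc : u = c
      · subst huc
        have := hz z (mem_nbrs.2 ⟨by rintro rfl; exact h2.asymm h1, by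
          rw [Finset.pair_comm]; exact hI⟩) h2.ne.1.symm h2.ne.2.1
        exact this.asymm (h2.rotate.rotate)
      · have h5 : CounterClockwise c u x ∨ CounterClockwise y u c := by
          unfold CounterClockwise at *; grind
        rcases h5 with h5 | h5
        · refine hT.noncrossing _ (mem_nbrs.1 hx).2 _ hI ?_
          rw [Finset.pair_comm z u]
          exact crossing_of_counterClockwise h5 (by unfold CounterClockwise at *; grind)
        · refine hT.noncrossing _ (mem_nbrs.1 hy).2 _ hI ?_
          exact crossing_of_counterClockwise (by unfold CounterClockwise at *; grind) h5
    rcases hc.symm.counterClockwise with h2 | h2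
    · exact key z u hI h2.1 h2.2
    · exact key u z (by rw [Finset.pair_comm]; exact hI) h2.1 h2.2
  · right
    obtain ⟨p, hp⟩ := exists_follows_left c
    obtain ⟨s, hs⟩ := exists_follows c
    have hpz := hz p (hT.follows_left_mem_nbrs hn hp)
    have hsz := hz s (hT.follows_mem_nbrs hn hs)
    have e1 : x = p := by
      rw [follows_iff] at hp hs
      have := p.2; have := c.2; have := s.2; have := x.2; have := y.2
      simp only [CounterClockwise, Fin.lt_def, ne_eq, Fin.ext_iff] at *; omega
    have e2 : y = s := by
      rw [follows_iff] at hp hs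
      have := p.2; have := c.2; have := s.2; have := x.2; have := y.2
      simp only [CounterClockwise, Fin.lt_def, ne_eq, Fin.ext_iff] at *; omega
    rw [e1, e2]
    exact ⟨hp, hs⟩

theorem IsTriangulation.meetsDiagonal_iff (hn : 3 ≤ n) (hT : IsTriangulation T) {c : Fin n} :
    MeetsDiagonal T c ↔ 3 ≤ (nbrs T c).card := by
  obtain ⟨p, hp⟩ := exists_follows_left c
  obtain ⟨s, hs⟩ := exists_follows c
  have hps := (counterClockwise_of_follows hn hp hs).ne
  have hpm := hT.follows_left_mem_nbrs hn hp
  have hsm := hT.follows_mem_nbrs hn hs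
  constructor
  · rintro ⟨I, hI, hcI, hside⟩
    obtain ⟨x, hx⟩ : ∃ x, I.erase c = {x} := by
      rw [← Finset.card_eq_one, Finset.card_erase_of_mem hcI, hT.card_eq_two I hI]
    have hI' : I = {c, x} := by rw [← Finset.insert_erase hcI, hx]
    have hxc : x ≠ c := by
      rintro rfl
      have := hT.card_eq_two I hI
      rw [hI'] at this; simp at this
    have hxp : x ≠ p := by
      rintro rfl
      exact hside ⟨x, c, hp, by rw [hI', Finset.pair_comm]⟩
    have hxs : x ≠ s := by
      rintro rfl
      exact hside ⟨c, x, hs, hI'⟩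
    have hsub : ({x, p, s} : Finset (Fin n)) ⊆ nbrs T c := by
      intro z hz
      simp only [Finset.mem_insert, Finset.mem_singleton] at hz
      rcases hz with rfl | rfl | rfl
      · exact mem_nbrs.2 ⟨hxc, hI' ▸ hI⟩
      · exact hpm
      · exact hsm
    have h3 : ({x, p, s} : Finset (Fin n)).card = 3 :=
      Finset.card_eq_three.2 ⟨x, p, s, hxp, hxs, hps.2.1.symm, rfl⟩
    rw [← h3]
    exact Finset.card_le_card hsub
  · intro h3
    obtain ⟨x, hx, hxps⟩ : ∃ x ∈ nbrs T c, x ∉ ({p, s} : Finset (Fin n)) := by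
      by_contra! hcon
      have := Finset.card_le_card (fun x hx => hcon x hx : nbrs T c ⊆ {p, s})
      have := Finset.card_le_two (a := p) (b := s)
      omega
    simp only [Finset.mem_insert, Finset.mem_singleton, not_or] at hxps
    obtain ⟨hxc, hxT⟩ := mem_nbrs.1 hx
    refine ⟨_, hxT, by simp, ?_⟩
    rintro ⟨i, j, hij, heq⟩
    have h1 : c ∈ ({i, j} : Finset (Fin n)) := by rw [← heq]; simp
    have h2 : x ∈ ({i, j} : Finset (Fin n)) := by rw [← heq]; simp
    simp only [Finset.mem_insert, Finset.mem_singleton] at h1 h2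
    rw [follows_iff] at hp hs hij
    have := p.2; have := c.2; have := s.2; have := x.2; have := i.2; have := j.2
    simp only [ne_eq, Fin.ext_iff] at *; omega

end Neighbors

/-! ### Contracting a refinement of `Ψ(T)` to `Ψ(T)` -/

section Refine

variable {n : ℕ} {T : Set (Finset (Fin n))}

theorem pair_eq_pair_cancel {c x y : Fin n} (h : ({c, x} : Finset (Fin n)) = {c, y})
    (hx : x ≠ c) : x = y := by
  have h1 : x ∈ ({c, y} : Finset (Fin n)) := by rw [← h]; simp
  simp only [Finset.mem_insert, Finset.mem_singleton] at h1
  exact h1.resolve_left hx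

/-- Two different chords at `c` determine `c` and their other endpoints. -/
theorem eq_of_two_pairs {c c' x y x' y' : Fin n} (hx : x ≠ c) (hy : y ≠ c) (hxy : x ≠ y)
    (h : ({c, x} : Finset (Fin n)) = {c', x'}) (h' : ({c, y} : Finset (Fin n)) = {c', y'}) :
    c = c' ∧ x = x' ∧ y = y' := by
  have h1 : c ∈ ({c', x'} : Finset (Fin n)) := by rw [← h]; simp
  have h2 : x ∈ ({c', x'} : Finset (Fin n)) := by rw [← h]; simp
  have h3 : c ∈ ({c', y'} : Finset (Fin n)) := by rw [← h']; simp
  have h4 : y ∈ ({c', y'} : Finset (Fin n)) := by rw [← h']; simp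
  simp only [Finset.mem_insert, Finset.mem_singleton] at h1 h2 h3 h4
  grind

theorem NextIn.asymm {S : Finset (Fin n)} (hS : 3 ≤ S.card) {x y : Fin n} (h : NextIn S x y) :
    ¬ NextIn S y x := by
  intro h'
  obtain ⟨z, hz, hzxy⟩ : ∃ z ∈ S, z ∉ ({x, y} : Finset (Fin n)) := by
    by_contra! hcon
    have := Finset.card_le_card (fun z hz => hcon z hz : S ⊆ {x, y})
    have := Finset.card_le_two (a := x) (b := y)
    omega
  simp only [Finset.mem_insert, Finset.mem_singleton, not_or] at hzxy
  exact (h.2.2.2 z hz hzxy.1 hzxy.2).asymm (h'.2.2.2 z hz hzxy.2 hzxy.1)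

/-- A subset all of whose steps are steps of the whole set is the whole set. -/
theorem eq_of_nextIn_imp {S N : Finset (Fin n)} (hS : 2 ≤ S.card) (hSN : S ⊆ N)
    (h : ∀ x y, NextIn S x y → NextIn N x y) : S = N := by
  refine Finset.Subset.antisymm hSN fun z hz => ?_
  by_contra hzS
  have hne : 2 ≤ (insert z S).card := by rw [Finset.card_insert_of_notMem hzS]; omega
  obtain ⟨x, hx⟩ := exists_nextIn_left hne (Finset.mem_insert_self z S)
  have hxS : x ∈ S := (Finset.mem_insert.1 hx.1).resolve_left hx.2.2.1
  obtain ⟨y, hy⟩ := exists_nextIn hS hxS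
  have h1 := (h x y hy).2.2.2 z hz hx.2.2.1.symm (by rintro rfl; exact hzS hy.2.1)
  have h2 := hx.2.2.2 y (Finset.mem_insert_of_mem hy.2.1) hy.2.2.1.symm
    (by rintro rfl; exact hzS hy.2.1)
  unfold CounterClockwise at *; grind

/-- The label of the side of the triangle `τ` that is opposite to `x`. The sides of `τ` at a
vertex `c` are consecutive in this labeling. -/
theorem sidesAt_iff {τ : Finset (Fin n)} (hτ : τ.card = 3) (R L : Finset (Fin n)) :
    (∃ c, SidesAt τ c R L) ↔ ∃ x y, NextIn τ x y ∧ τ.erase x = R ∧ τ.erase y = L := by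
  constructor
  · rintro ⟨c, a, b, rfl, h, rfl, rfl⟩
    have hne := h.ne
    refine ⟨a, b, ⟨by simp, by simp, hne.2.1, ?_⟩, by grind, by grind⟩
    intro z hz h1 h2
    obtain rfl : z = c := by grind
    exact h.rotate
  · rintro ⟨x, y, ⟨hx, hy, hxy, h⟩, rfl, rfl⟩
    obtain ⟨c, hc⟩ : ∃ c, (τ.erase x).erase y = {c} := by
      rw [← Finset.card_eq_one, Finset.card_erase_of_mem (by grind),
        Finset.card_erase_of_mem hx, hτ]
    have hcτ : c ∈ (τ.erase x).erase y := by rw [hc]; simp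
    simp only [Finset.mem_erase] at hcτ
    have hτ' : τ = {c, x, y} := by
      have h1 : τ.erase x = {y, c} := by rw [← Finset.insert_erase (by grind : y ∈ τ.erase x), hc]
      rw [← Finset.insert_erase hx, h1]; grind
    have := h c hcτ.2.2 hcτ.2.1 hcτ.1
    have hne := this.ne
    refine ⟨c, x, y, hτ', this.rotate.rotate, ?_, ?_⟩ <;> subst hτ' <;> grind

theorem not_sidesAt_symm {τ τ' : Finset (Fin n)} {c c' : Fin n} {R L : Finset (Fin n)}
    (h : SidesAt τ c R L) : ¬ SidesAt τ' c' L R := by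
  rintro ⟨a', b', rfl, hab', rfl, rfl⟩
  obtain ⟨a, b, rfl, hab, h1, h2⟩ := h
  have hne := hab.ne
  have hne' := hab'.ne
  rw [Finset.pair_comm b' c'] at h2
  rw [Finset.pair_comm b c] at h1
  obtain ⟨rfl, rfl, rfl⟩ := eq_of_two_pairs hne'.2.2.symm hne'.1.symm hne'.2.1.symm h2 h1
  exact (hab'.rotate.rotate).asymm (by unfold CounterClockwise at *; grind)

/-- At a vertex of a triangle of `T` the two sides are consecutive chords. -/
theorem SidesAt.nextIn (hT : IsTriangulation T) {τ : Finset (Fin n)} (hτ : IsTriangle T τ)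
    {c : Fin n} {R L : Finset (Fin n)} (h : SidesAt τ c R L) :
    ∃ a b, τ = {c, a, b} ∧ CounterClockwise c a b ∧ R = {c, b} ∧ L = {c, a} ∧
      NextIn (nbrs T c) a b := by
  obtain ⟨a, b, rfl, hab, rfl, rfl⟩ := h
  have hne := hab.ne
  exact ⟨a, b, rfl, hab, Finset.pair_comm _ _, rfl, hT.nextIn_nbrs_of_triangle hab
    (hτ.2 _ (by grind) (Finset.card_pair hne.1)) (hτ.2 _ (by grind) (Finset.card_pair hne.2.2))
    (hτ.2 _ (by grind) (Finset.card_pair hne.2.1))⟩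

/-- The graph of `G` is `Ψ(T)` up to uncontracting white vertices: the black vertices are
those of the triangles, and each white vertex collects some of the chords at a vertex of the
polygon. -/
structure Refines (T : Set (Finset (Fin n))) (G : StarSystem n) : Prop where
  valid : G.Valid
  star_of_black : ∀ v, G.black v → IsTriangle T (G.star v) ∧ G.label v = (G.star v).erase
  exists_black : ∀ τ, IsTriangle T τ → ∃ v, G.black v ∧ G.star v = τ
  white : ∀ v, ¬ G.black v → ∃ c, G.label v = (fun x => {c, x}) ∧ G.star v ⊆ nbrs T c

theorem Refines.half_black_iff {G : StarSystem n} (hG : Refines T G) {v : G.Vertex}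
    (hv : G.black v) (R L : Finset (Fin n)) :
    G.Half v R L ↔ ∃ c, SidesAt (G.star v) c R L := by
  obtain ⟨h1, h2⟩ := hG.star_of_black v hv
  rw [sidesAt_iff h1.1]
  unfold StarSystem.Half
  rw [h2]

theorem label_injOn {G : StarSystem n} {v : G.Vertex} {c : Fin n}
    (hl : G.label v = fun x => {c, x}) {S : Finset (Fin n)} (hS : S ⊆ nbrs T c) :
    Set.InjOn (G.label v) S := by
  intro x hx y _ h
  rw [hl] at h
  exact pair_eq_pair_cancel h (mem_nbrs.1 (hS (by exact_mod_cast hx))).1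

/-- A half-edge at a white vertex, in terms of the chords at the vertex of the polygon. -/
theorem half_white_iff {G : StarSystem n} {v : G.Vertex} {c : Fin n}
    (hl : G.label v = fun x => {c, x}) (hs : G.star v ⊆ nbrs T c) {c' x y : Fin n}
    (hx : x ≠ c') (hy : y ≠ c') :
    G.Half v {c', x} {c', y} ↔ c' = c ∧ NextIn (G.star v) x y := by
  constructor
  · rintro ⟨x', y', h, h1, h2⟩
    rw [hl] at h1 h2
    have h3 := (mem_nbrs.1 (hs h.1)).1
    have h4 := (mem_nbrs.1 (hs h.2.1)).1
    obtain ⟨rfl, rfl, rfl⟩ := eq_of_two_pairs h3 h4 h.2.2.1 h1 h2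
    exact ⟨rfl, h⟩
  · rintro ⟨rfl, h⟩
    exact ⟨x, y, h, by rw [hl], by rw [hl]⟩

/-- Contracting an edge between white vertices of a refinement of `Ψ(T)` gives a refinement. -/
theorem Refines.contract {G : StarSystem n} (hG : Refines T G)
    {v w : G.Vertex} {x y : Fin n}
    (h : G.Contractible v w x y) (hv : ¬ G.black v) : Refines T (G.contract v w) := by
  have hw : ¬ G.black w := fun h' => hv (h.color.2 h')
  obtain ⟨c₀, hl, hs⟩ := hG.white v hv
  obtain ⟨c₁, hl', hs'⟩ := hG.white w hw
  have hc01 : c₁ = c₀ := by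
    have hx := h.left.1
    have hx' := h.right.2.1
    have h1 : ({c₀, x} : Finset (Fin n)) = {c₁, x} := by
      have := congrFun h.label_eq x
      rwa [hl, hl'] at this
    have h2 := (mem_nbrs.1 (hs hx)).1
    have h3 := (mem_nbrs.1 (hs' hx')).1
    rw [Finset.pair_comm, Finset.pair_comm c₁] at h1
    exact (pair_eq_pair_cancel h1 h2.symm).symm
  subst hc01
  refine ⟨hG.valid.contract h, ?_, ?_, ?_⟩
  · intro u hu
    have hne : u.1 ≠ v := by rintro h0; exact hv (h0 ▸ hu)
    rw [StarSystem.contract_star, if_neg hne]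
    exact hG.star_of_black u.1 hu
  · intro τ hτ
    obtain ⟨u, hu, hus⟩ := hG.exists_black τ hτ
    have hne : u ≠ v := by rintro rfl; exact hv hu
    have hne' : u ≠ w := by rintro rfl; exact hw hu
    refine ⟨⟨u, hne'⟩, hu, ?_⟩
    exact (StarSystem.contract_star G v w ⟨u, hne'⟩).trans ((if_neg hne).trans hus)
  · intro u hu
    rw [StarSystem.contract_star]
    split_ifs with h0
    · refine ⟨c₁, ?_, Finset.union_subset hs hs'⟩
      rw [← hl, ← h0]; rfl
    · exact hG.white u.1 hu

/-- A step in the star of a white vertex at `c` is either a step between consecutive chords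
at `c`, or there is another white vertex at `c` on the other side. -/
theorem Refines.cover_white (hn : 3 ≤ n) (hT : IsTriangulation T) {G : StarSystem n}
    (hG : Refines T G) {v : G.Vertex} {c x y : Fin n}
    (hl : G.label v = fun x => {c, x}) (hs : G.star v ⊆ nbrs T c) (hxy : NextIn (G.star v) x y) :
    NextIn (nbrs T c) x y ∨ ∃ w, ¬ G.black w ∧ (G.label w = fun x => {c, x}) ∧
      G.star w ⊆ nbrs T c ∧ NextIn (G.star w) y x := by
  have hxc := (mem_nbrs.1 (hs hxy.1)).1
  have hyc := (mem_nbrs.1 (hs hxy.2.1)).1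
  rcases hG.valid.cover v {c, x} {c, y} ((half_white_iff hl hs hxc hyc).2 ⟨rfl, hxy⟩) with
    ⟨c', p, s, hp, hs', h1, h2⟩ | ⟨w, hw⟩
  · rw [Finset.pair_comm p c'] at h1
    obtain ⟨rfl, rfl, rfl⟩ := eq_of_two_pairs hxc hyc hxy.2.2.1 h1 h2
    exact Or.inl (hT.nextIn_nbrs_of_follows hn hp hs')
  · by_cases hwb : G.black w
    · obtain ⟨c', hc'⟩ := (hG.half_black_iff hwb _ _).1 hw
      obtain ⟨a, b, hτ, hab, h1, h2, hnx⟩ := hc'.nextIn hT (hG.star_of_black w hwb).1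
      obtain ⟨rfl, rfl, rfl⟩ := eq_of_two_pairs hyc hxc hxy.2.2.1.symm h1 h2
      exact Or.inl hnx
    · obtain ⟨c', hl', hs'⟩ := hG.white w hwb
      obtain ⟨rfl, hw'⟩ := (half_white_iff hl' hs' hyc hxc).1 hw
      exact Or.inr ⟨w, hwb, hl', hs', hw'⟩

/-- The half-edge across from a triangle, at a vertex of the polygon that meets a diagonal,
belongs to a white vertex. -/
theorem Refines.exists_white_of_triangle (hn : 3 ≤ n) (hT : IsTriangulation T) {G : StarSystem n}
    (hG : Refines T G) {c x y : Fin n} (hc : MeetsDiagonal T c) (hxy : NextIn (nbrs T c) x y)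
    (hccw : CounterClockwise c x y) (hmem : {x, y} ∈ T) :
    ∃ v, ¬ G.black v ∧ (G.label v = fun x => {c, x}) ∧ G.star v ⊆ nbrs T c ∧
      NextIn (G.star v) x y := by
  have hne := hccw.ne
  have hxc := (mem_nbrs.1 hxy.1)
  have hyc := (mem_nbrs.1 hxy.2.1)
  have hτ : IsTriangle T {c, x, y} := by
    refine ⟨Finset.card_eq_three.2 ⟨c, x, y, hne.1, hne.2.2, hne.2.1, rfl⟩, fun I hI hI2 => ?_⟩
    obtain ⟨i, j, hij, rfl⟩ := Finset.card_eq_two.1 hI2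
    have hi := hI (Finset.mem_insert_self i {j})
    have hj := hI (Finset.mem_insert_of_mem (Finset.mem_singleton_self j) : j ∈ {i, j})
    simp only [Finset.mem_insert, Finset.mem_singleton] at hi hj
    have e1 := hxc.2
    have e2 := hyc.2
    rcases hi with rfl | rfl | rfl <;> rcases hj with rfl | rfl | rfl <;>
      first | exact absurd rfl hij | assumption | (rw [Finset.pair_comm]; assumption)
  obtain ⟨v, hv, hvs⟩ := hG.exists_black _ hτ
  have hside : SidesAt (G.star v) c {y, c} {c, x} := ⟨x, y, hvs, hccw, rfl, rfl⟩
  have hhalf := (hG.half_black_iff hv _ _).2 ⟨c, hside⟩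
  have h3 := (hT.meetsDiagonal_iff hn).1 hc
  rcases hG.valid.cover v _ _ hhalf with ⟨c', p, s, hp, hs, h1, h2⟩ | ⟨w, hw⟩
  · rw [Finset.pair_comm y c, Finset.pair_comm p c'] at h1
    obtain ⟨rfl, rfl, rfl⟩ := eq_of_two_pairs hyc.1 hxc.1 hne.2.1.symm h1 h2
    exact absurd (hT.nextIn_nbrs_of_follows hn hp hs) (hxy.asymm h3)
  · by_cases hwb : G.black w
    · obtain ⟨c', hc'⟩ := (hG.half_black_iff hwb _ _).1 hw
      exact absurd hc' (not_sidesAt_symm hside)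
    · obtain ⟨c', hl, hs⟩ := hG.white w hwb
      rw [Finset.pair_comm y c] at hw
      obtain ⟨rfl, hw'⟩ := (half_white_iff hl hs hxc.1 hyc.1).1 hw
      exact ⟨w, hwb, hl, hs, hw'⟩

/-- There is a white vertex at every vertex `c` of the polygon that meets a diagonal. -/
theorem Refines.exists_white (hn : 3 ≤ n) (hT : IsTriangulation T) {G : StarSystem n}
    (hG : Refines T G) {c : Fin n} (hc : MeetsDiagonal T c) :
    ∃ v, ¬ G.black v ∧ (G.label v = fun x => {c, x}) ∧ G.star v ⊆ nbrs T c := by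
  have h3 := (hT.meetsDiagonal_iff hn).1 hc
  obtain ⟨p, hp⟩ := exists_follows_left c
  obtain ⟨s, hs⟩ := exists_follows c
  obtain ⟨y, hy⟩ := exists_nextIn (by omega) (hT.follows_mem_nbrs hn hs)
  rcases hT.nextIn_nbrs_cases hn hy with ⟨h1, h2⟩ | ⟨h1, -⟩
  · obtain ⟨v, hv, hl, hs, -⟩ := hG.exists_white_of_triangle hn hT hc hy h1 h2
    exact ⟨v, hv, hl, hs⟩
  · have := s.2; have := c.2
    rw [follows_iff] at hs h1; omega

/-- A white vertex that does not collect all chords at its vertex of the polygon is joined to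
another white vertex. -/
theorem Refines.exists_contractible (hn : 3 ≤ n) (hT : IsTriangulation T) {G : StarSystem n}
    (hG : Refines T G) {v : G.Vertex} {c : Fin n} (hv : ¬ G.black v)
    (hl : G.label v = fun x => {c, x}) (hs : G.star v ⊆ nbrs T c) (hne : G.star v ≠ nbrs T c) :
    ∃ w x y, G.Contractible v w x y := by
  have h3 := hG.valid.three_le v
  obtain ⟨x, y, hxy, hxy'⟩ : ∃ x y, NextIn (G.star v) x y ∧ ¬ NextIn (nbrs T c) x y := by
    by_contra! hcon
    exact hne (eq_of_nextIn_imp (by omega) hs hcon)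
  rcases hG.cover_white hn hT hl hs hxy with h | ⟨w, hw, hl', hs', hw'⟩
  · exact absurd h hxy'
  · refine ⟨w, x, y, ?_, by simp [hv, hw], by rw [hl, hl'], ?_, hxy, hw'⟩
    · rintro rfl
      exact hxy.asymm h3 hw'
    · exact label_injOn hl (Finset.union_subset hs hs')

/-- The stars of the vertices of `Ψ(T)`. -/
noncomputable def psiSystem (T : Set (Finset (Fin n))) : StarSystem n where
  Vertex := {τ : Finset (Fin n) // IsTriangle T τ} ⊕ {c : Fin n // MeetsDiagonal T c}
  black
    | Sum.inl _ => True
    | Sum.inr _ => False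
  star
    | Sum.inl τ => τ.1
    | Sum.inr c => nbrs T c.1
  label
    | Sum.inl τ => τ.1.erase
    | Sum.inr c => fun x => {c.1, x}

theorem psiSystem_half_inl (τ : {τ : Finset (Fin n) // IsTriangle T τ}) (R L : Finset (Fin n)) :
    (psiSystem T).Half (Sum.inl τ) R L ↔ ∃ c, SidesAt τ.1 c R L :=
  (sidesAt_iff τ.2.1 R L).symm

theorem psiSystem_half_inr (c : {c : Fin n // MeetsDiagonal T c}) (R L : Finset (Fin n)) :
    (psiSystem T).Half (Sum.inr c) R L ↔
      ∃ x y, NextIn (nbrs T c.1) x y ∧ {c.1, x} = R ∧ {c.1, y} = L :=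
  Iff.rfl

theorem psiSystem_iso (hn : 3 ≤ n) (hT : IsTriangulation T) :
    DiskGraph.Iso (psiSystem T).graph (Psi T) := by
  have mixed : ∀ (τ : {τ : Finset (Fin n) // IsTriangle T τ})
      (c : {c : Fin n // MeetsDiagonal T c}) (R L : Finset (Fin n)), SidesAt τ.1 c.1 R L ↔
      (psiSystem T).Half (Sum.inl τ) R L ∧ (psiSystem T).Half (Sum.inr c) L R := by
    intro τ c R L
    rw [psiSystem_half_inl, psiSystem_half_inr]
    constructor
    · intro h
      obtain ⟨a, b, -, -, rfl, rfl, hn⟩ := h.nextIn hT τ.2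
      exact ⟨⟨c.1, h⟩, a, b, hn, rfl, rfl⟩
    · rintro ⟨⟨c', h⟩, x, y, hxy, rfl, rfl⟩
      have h' := h
      obtain ⟨a, b, -, hab, h1, h2, -⟩ := h'.nextIn hT τ.2
      obtain ⟨hc, -, -⟩ := eq_of_two_pairs (mem_nbrs.1 hxy.1).1 (mem_nbrs.1 hxy.2.1).1
        hxy.2.2.1 h2 h1
      rw [← hc] at h
      exact h
  refine ⟨Equiv.refl _, ?_, ?_, ?_⟩
  · rintro (τ | c) <;> exact Iff.rfl
  · rintro (τ | c) (τ' | c') R L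
    · change False ↔ (psiSystem T).Half (Sum.inl τ) R L ∧ (psiSystem T).Half (Sum.inl τ') L R
      rw [psiSystem_half_inl, psiSystem_half_inl, false_iff]
      rintro ⟨⟨c, hc⟩, ⟨c', hc'⟩⟩
      exact not_sidesAt_symm hc hc'
    · exact mixed τ c' R L
    · exact (mixed τ' c L R).trans and_comm
    · change False ↔ (psiSystem T).Half (Sum.inr c) R L ∧ (psiSystem T).Half (Sum.inr c') L R
      rw [psiSystem_half_inr, psiSystem_half_inr, false_iff]
      rintro ⟨⟨x, y, hxy, rfl, rfl⟩, ⟨x', y', hxy', h1, h2⟩⟩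
      obtain ⟨hc, rfl, rfl⟩ := eq_of_two_pairs (mem_nbrs.1 hxy'.1).1 (mem_nbrs.1 hxy'.2.1).1
        hxy'.2.2.1 h1 h2
      rw [hc] at hxy'
      exact hxy.asymm ((hT.meetsDiagonal_iff hn).1 c.2) hxy'
  · rintro (τ | c) R L
    · change (∃ c ∈ τ.1, ¬ MeetsDiagonal T c ∧ OuterSidesAt c R L) ↔
        (psiSystem T).Half (Sum.inl τ) R L ∧ ∃ c, OuterSidesAt c R L
      rw [psiSystem_half_inl]
      constructor
      · rintro ⟨c, hcτ, hc, p, s, hp, hs, rfl, rfl⟩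
        refine ⟨⟨c, s, p, ?_, counterClockwise_of_follows hn hp hs, rfl, rfl⟩,
          c, p, s, hp, hs, rfl, rfl⟩
        have hccw := counterClockwise_of_follows hn hp hs
        have hne := hccw.ne
        have hsub : nbrs T c ⊆ {s, p} := by
          have hN : ({s, p} : Finset (Fin n)) ⊆ nbrs T c := by
            intro z hz
            simp only [Finset.mem_insert, Finset.mem_singleton] at hz
            rcases hz with rfl | rfl
            · exact hT.follows_mem_nbrs hn hs
            · exact hT.follows_left_mem_nbrs hn hp
          rw [hT.meetsDiagonal_iff hn] at hc
          refine (Finset.eq_of_subset_of_card_le hN ?_).symm.subset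
          rw [Finset.card_pair hne.2.1]; omega
        have hτ' : τ.1 ⊆ {c, s, p} := by
          intro z hz
          by_cases hzc : z = c
          · simp [hzc]
          · have : z ∈ nbrs T c := mem_nbrs.2 ⟨hzc, τ.2.2 _ (by
              intro t ht
              simp only [Finset.mem_insert, Finset.mem_singleton] at ht
              rcases ht with rfl | rfl <;> assumption) (Finset.card_pair (Ne.symm hzc))⟩
            exact Finset.mem_insert_of_mem (hsub this)
        refine Finset.eq_of_subset_of_card_le hτ' ?_
        rw [τ.2.1]; exact Finset.card_le_three
      · rintro ⟨⟨c', h⟩, c, p, s, hp, hs, rfl, rfl⟩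
        obtain ⟨a, b, hτ, hab, h1, h2, hnx⟩ := h.nextIn hT τ.2
        have hne := (counterClockwise_of_follows hn hp hs).ne
        rw [Finset.pair_comm p c] at h1
        obtain ⟨rfl, rfl, rfl⟩ := eq_of_two_pairs hne.2.2.symm hne.1.symm hne.2.1.symm h1 h2
        refine ⟨c, by rw [hτ]; simp, ?_, p, s, hp, hs, rfl, rfl⟩
        rw [hT.meetsDiagonal_iff hn]
        intro h3
        exact hnx.asymm h3 (hT.nextIn_nbrs_of_follows hn hp hs)
    · change OuterSidesAt c.1 R L ↔
        (psiSystem T).Half (Sum.inr c) R L ∧ ∃ c, OuterSidesAt c R L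
      rw [psiSystem_half_inr]
      constructor
      · rintro ⟨p, s, hp, hs, rfl, rfl⟩
        exact ⟨⟨p, s, hT.nextIn_nbrs_of_follows hn hp hs, Finset.pair_comm _ _, rfl⟩,
          c.1, p, s, hp, hs, rfl, rfl⟩
      · rintro ⟨⟨x, y, hxy, rfl, rfl⟩, c', p, s, hp, hs, h1, h2⟩
        rw [Finset.pair_comm p c'] at h1
        obtain ⟨hc, rfl, rfl⟩ := eq_of_two_pairs (mem_nbrs.1 hxy.1).1 (mem_nbrs.1 hxy.2.1).1
          hxy.2.2.1 h1 h2
        subst hc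
        exact ⟨x, y, hp, hs, Finset.pair_comm _ _, rfl⟩

theorem StarSystem.graph_iso {G H : StarSystem n} (e : G.Vertex ≃ H.Vertex)
    (hb : ∀ v, H.black (e v) ↔ G.black v)
    (he : ∀ v, H.star (e v) = G.star v ∧ H.label (e v) = G.label v) :
    DiskGraph.Iso G.graph H.graph := by
  have hh : ∀ v I J, H.Half (e v) I J ↔ G.Half v I J := by
    intro v I J
    unfold StarSystem.Half
    rw [(he v).1, (he v).2]
  refine ⟨e, hb, fun v w I J => ?_, fun v I J => ?_⟩
  · exact and_congr (hh v I J) (hh w J I)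
  · exact and_congr (hh v I J) Iff.rfl

/-- A refinement in which every white vertex collects all the chords is `Ψ(T)`. -/
theorem Refines.iso (hn : 3 ≤ n) (hT : IsTriangulation T) {G : StarSystem n} (hG : Refines T G)
    (hfull : ∀ v c, ¬ G.black v → (G.label v = fun x => {c, x}) → G.star v ⊆ nbrs T c →
      G.star v = nbrs T c) :
    DiskGraph.Iso G.graph (Psi T) := by
  have hw : ∀ c : {c : Fin n // MeetsDiagonal T c}, ∃ v, ¬ G.black v ∧
      G.label v = (fun x => {c.1, x}) ∧ G.star v = nbrs T c.1 := by
    intro c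
    obtain ⟨v, hv, hl, hs⟩ := hG.exists_white hn hT c.2
    exact ⟨v, hv, hl, hfull v _ hv hl hs⟩
  choose f hf using fun τ : {τ : Finset (Fin n) // IsTriangle T τ} => hG.exists_black τ.1 τ.2
  choose g hg using hw
  have huniq : ∀ v w, G.star v = G.star w → G.label v = G.label w → v = w := by
    intro v w hs hl
    have h3 := hG.valid.three_le v
    obtain ⟨x, hx⟩ : (G.star v).Nonempty := by rw [← Finset.card_pos]; omega
    obtain ⟨y, hxy⟩ := exists_nextIn (by omega) hx
    exact hG.valid.unique v w _ _ ⟨x, y, hxy, rfl, rfl⟩ ⟨x, y, hs ▸ hxy, by rw [hl], by rw [hl]⟩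
  have hbij : Function.Bijective (Sum.elim f g : (psiSystem T).Vertex → G.Vertex) := by
    constructor
    · rintro (τ | c) (τ' | c') h
      · simp only [Sum.elim_inl] at h
        congr 1
        exact Subtype.ext ((hf τ).2.symm.trans (h ▸ (hf τ').2))
      · simp only [Sum.elim_inl, Sum.elim_inr] at h
        exact absurd (h ▸ (hf τ).1) (hg c').1
      · simp only [Sum.elim_inl, Sum.elim_inr] at h
        exact absurd (h ▸ (hf τ').1) (hg c).1
      · simp only [Sum.elim_inr] at h
        congr 1
        obtain ⟨-, h1, h2⟩ := hg c
        obtain ⟨-, h1', h2'⟩ := hg c'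
        rw [h] at h1 h2
        have h3 := (hT.meetsDiagonal_iff hn).1 c.2
        obtain ⟨x, hx⟩ : (nbrs T c.1).Nonempty := by rw [← Finset.card_pos]; omega
        have hx' : x ∈ nbrs T c'.1 := by rw [← h2', h2]; exact hx
        have : ({c.1, x} : Finset (Fin n)) = {c'.1, x} := congrFun (h1.symm.trans h1') x
        rw [Finset.pair_comm, Finset.pair_comm c'.1] at this
        exact Subtype.ext (pair_eq_pair_cancel this (mem_nbrs.1 hx).1.symm)
    · intro v
      by_cases hv : G.black v
      · obtain ⟨h1, h2⟩ := hG.star_of_black v hv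
        refine ⟨Sum.inl ⟨_, h1⟩, huniq _ _ (hf ⟨_, h1⟩).2 ?_⟩
        have := hG.star_of_black _ (hf ⟨_, h1⟩).1
        rw [h2]
        exact this.2.trans (by rw [(hf ⟨_, h1⟩).2])
      · obtain ⟨c, hl, hs⟩ := hG.white v hv
        have h0 := hfull v c hv hl hs
        have hc : MeetsDiagonal T c := (hT.meetsDiagonal_iff hn).2 (h0 ▸ hG.valid.three_le v)
        refine ⟨Sum.inr ⟨c, hc⟩, huniq _ _ ((hg ⟨c, hc⟩).2.2.trans h0.symm) ?_⟩
        rw [hl]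
        exact (hg ⟨c, hc⟩).2.1
  have hiso : DiskGraph.Iso (psiSystem T).graph G.graph := by
    refine StarSystem.graph_iso (Equiv.ofBijective _ hbij) ?_ ?_
    · rintro (τ | c)
      · exact ⟨fun _ => trivial, fun _ => (hf τ).1⟩
      · exact ⟨fun h => absurd h (hg c).1, fun h => h.elim⟩
    · rintro (τ | c)
      · refine ⟨(hf τ).2, ?_⟩
        exact (hG.star_of_black _ (hf τ).1).2.trans (by rw [(hf τ).2]; rfl)
      · exact ⟨(hg c).2.2, (hg c).2.1⟩
  obtain ⟨e, h1, h2, h3⟩ := hiso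
  obtain ⟨e', h1', h2', h3'⟩ := psiSystem_iso hn hT
  refine ⟨e.symm.trans e', fun v => ?_, fun v w I J => ?_, fun v I J => ?_⟩
  · obtain ⟨v, rfl⟩ := e.surjective v
    simp only [Equiv.trans_apply, Equiv.symm_apply_apply]
    rw [h1, h1']
  · obtain ⟨v, rfl⟩ := e.surjective v
    obtain ⟨w, rfl⟩ := e.surjective w
    simp only [Equiv.trans_apply, Equiv.symm_apply_apply]
    rw [h2, h2']
  · obtain ⟨v, rfl⟩ := e.surjective v
    simp only [Equiv.trans_apply, Equiv.symm_apply_apply]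
    rw [h3, h3']

/-- A finite refinement of `Ψ(T)` contracts to `Ψ(T)`. -/
theorem Refines.m2Equiv (hn : 3 ≤ n) (hT : IsTriangulation T) :
    ∀ (m : ℕ) (G : StarSystem n), Finite G.Vertex → Nat.card G.Vertex = m → Refines T G →
      DiskGraph.M2Equiv G.graph (Psi T) := by
  intro m
  induction m using Nat.strong_induction_on with
  | _ m ih =>
    intro G hfin hm hG
    by_cases hfull : ∀ v c, ¬ G.black v → (G.label v = fun x => {c, x}) → G.star v ⊆ nbrs T c →
      G.star v = nbrs T c
    · exact Relation.EqvGen.rel _ _ (Or.inl (hG.iso hn hT hfull))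
    · push Not at hfull
      obtain ⟨v, c, hv, hl, hs, hne⟩ := hfull
      obtain ⟨w, x, y, h⟩ := hG.exists_contractible hn hT hv hl hs hne
      refine Relation.EqvGen.trans _ _ _
        (Relation.EqvGen.rel _ _ (Or.inr (hG.valid.contracts h))) ?_
      have hfin' : Finite (G.contract v w).Vertex := Subtype.finite
      refine ih _ ?_ _ hfin' rfl (hG.contract h hv)
      rw [← hm]
      exact Finite.card_subtype_lt (x := w) (by simp)

end Refine

/-! ### Maxima of affine functions indexed by chords -/

section Plot

variable {n : ℕ}

/-- The affine function on the plane with constant term `c I` and with gradient the sum of the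
points `(κ_i, κ_i²)`, `i ∈ I`. -/
def affineTerm (κ : Fin n → ℝ) (c : Finset (Fin n) → ℝ) (I : Finset (Fin n)) (p : ℝ × ℝ) : ℝ :=
  c I + (∑ i ∈ I, κ i) * p.1 + (∑ i ∈ I, κ i ^ 2) * p.2

/-- The slope of `affineTerm` in the direction `u`. -/
def slope (κ : Fin n → ℝ) (I : Finset (Fin n)) (u : ℝ × ℝ) : ℝ :=
  (∑ i ∈ I, κ i) * u.1 + (∑ i ∈ I, κ i ^ 2) * u.2

theorem affineTerm_add_smul (κ : Fin n → ℝ) (c : Finset (Fin n) → ℝ) (I : Finset (Fin n))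
    (p u : ℝ × ℝ) (s : ℝ) :
    affineTerm κ c I (p + s • u) = affineTerm κ c I p + s * slope κ I u := by
  simp only [affineTerm, slope, Prod.fst_add, Prod.snd_add, Prod.smul_fst, Prod.smul_snd,
    smul_eq_mul]
  ring

theorem affineTerm_add (κ : Fin n → ℝ) (c : Finset (Fin n) → ℝ) (I : Finset (Fin n))
    (p u : ℝ × ℝ) :
    affineTerm κ c I (p + u) = affineTerm κ c I p + slope κ I u := by
  have := affineTerm_add_smul κ c I p u 1
  rwa [one_smul, one_mul] at this

theorem slope_smul (κ : Fin n → ℝ) (I : Finset (Fin n)) (u : ℝ × ℝ) (s : ℝ) :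
    slope κ I (s • u) = s * slope κ I u := by
  simp only [slope, Prod.smul_fst, Prod.smul_snd, smul_eq_mul]; ring

theorem slope_pair (κ : Fin n → ℝ) {a b : Fin n} (h : a ≠ b) (u : ℝ × ℝ) :
    slope κ {a, b} u = (κ a * u.1 + κ a ^ 2 * u.2) + (κ b * u.1 + κ b ^ 2 * u.2) := by
  rw [slope, Finset.sum_pair h, Finset.sum_pair h]; ring

theorem continuous_affineTerm (κ : Fin n → ℝ) (c : Finset (Fin n) → ℝ) (I : Finset (Fin n)) :
    Continuous (affineTerm κ c I) := by
  unfold affineTerm; fun_prop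

theorem tendsto_add_smul (p u : ℝ × ℝ) :
    Filter.Tendsto (fun s : ℝ => p + s • u) (𝓝[>] 0) (𝓝 p) := by
  have h : Continuous fun s : ℝ => p + s • u := by fun_prop
  have h1 := h.tendsto 0
  simp only [zero_smul, add_zero] at h1
  exact h1.mono_left nhdsWithin_le_nhds

/-- `D p` is the set of labels of the regions that meet at `p`, in a subdivision of the plane
by the maximum of the functions `affineTerm κ c I` over all chords `I`; at most three regions meet
at any point, and labels of adjacent regions share an index. -/
structure IsPlot (κ : Fin n → ℝ) (c : Finset (Fin n) → ℝ)
    (D : ℝ × ℝ → Finset (Finset (Fin n))) : Prop where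
  card_eq_two : ∀ p, ∀ I ∈ D p, I.card = 2
  le : ∀ p, ∀ I ∈ D p, ∀ J : Finset (Fin n), J.card = 2 →
    affineTerm κ c J p ≤ affineTerm κ c I p
  nonempty : ∀ p, (D p).Nonempty
  mem : ∀ p q I, I ∈ D q → (∀ J : Finset (Fin n), J.card = 2 →
    affineTerm κ c J p ≤ affineTerm κ c I p) → I ∈ D p
  inter : ∀ p, ∀ I ∈ D p, ∀ J ∈ D p, I ≠ J → (I ∩ J).card = 1
  card_le_three : ∀ p, (D p).card ≤ 3

variable {κ : Fin n → ℝ} {c : Finset (Fin n) → ℝ} {D : ℝ × ℝ → Finset (Finset (Fin n))}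

/-- It is enough to compare with the labels of regions. -/
theorem IsPlot.mem_of_region_le (h : IsPlot κ c D) {p q : ℝ × ℝ} {I : Finset (Fin n)}
    (hI : I ∈ D q) (hle : ∀ r, ∀ J ∈ D r, affineTerm κ c J p ≤ affineTerm κ c I p) : I ∈ D p := by
  obtain ⟨M, hM⟩ := h.nonempty p
  exact h.mem p q I hI fun J hJ => (h.le p M hM J hJ).trans (hle p M hM)

theorem IsPlot.eq_of_mem (h : IsPlot κ c D) {p : ℝ × ℝ} {I J : Finset (Fin n)}
    (hI : I ∈ D p) (hJ : J ∈ D p) : affineTerm κ c I p = affineTerm κ c J p :=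
  le_antisymm (h.le p J hJ I (h.card_eq_two p I hI)) (h.le p I hI J (h.card_eq_two p J hJ))

theorem IsPlot.mem_of_eq (h : IsPlot κ c D) {p q : ℝ × ℝ} {I J : Finset (Fin n)}
    (hI : I ∈ D p) (hJ : J ∈ D q) (heq : affineTerm κ c J p = affineTerm κ c I p) : J ∈ D p :=
  h.mem p q J hJ fun M hM => (h.le p I hI M hM).trans heq.ge

theorem IsPlot.lt_of_notMem (h : IsPlot κ c D) {p q : ℝ × ℝ} {I J : Finset (Fin n)}
    (hI : I ∈ D p) (hJ : J ∈ D q) (hJp : J ∉ D p) :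
    affineTerm κ c J p < affineTerm κ c I p :=
  lt_of_le_of_ne (h.le p I hI J (h.card_eq_two q J hJ)) fun heq => hJp (h.mem_of_eq hI hJ heq)

theorem IsPlot.isClosed_setOf_mem (h : IsPlot κ c D) (I : Finset (Fin n)) :
    IsClosed {p | I ∈ D p} := by
  by_cases hI : ∃ q, I ∈ D q
  · obtain ⟨q, hq⟩ := hI
    have : {p | I ∈ D p} = ⋂ J : {J : Finset (Fin n) // J.card = 2},
        {p | affineTerm κ c J.1 p ≤ affineTerm κ c I p} := by
      ext p
      simp only [Set.mem_ofPred_eq, Set.mem_iInter, Subtype.forall]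
      exact ⟨fun hp => h.le p I hp, h.mem p q I hq⟩
    rw [this]
    exact isClosed_iInter fun J => isClosed_le (continuous_affineTerm _ _ _)
      (continuous_affineTerm _ _ _)
  · have : {p | I ∈ D p} = ∅ := Set.eq_empty_of_forall_notMem fun p hp => hI ⟨p, hp⟩
    rw [this]
    exact isClosed_empty

/-- Twice the signed area of the triangle spanned by the gradients of three labels. -/
def orient (κ : Fin n → ℝ) (I J K : Finset (Fin n)) : ℝ :=
  ((∑ i ∈ J, κ i) - ∑ i ∈ I, κ i) * ((∑ i ∈ K, κ i ^ 2) - ∑ i ∈ I, κ i ^ 2) -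
    ((∑ i ∈ J, κ i ^ 2) - ∑ i ∈ I, κ i ^ 2) * ((∑ i ∈ K, κ i) - ∑ i ∈ I, κ i)

/-- Twice the signed area of the triangle spanned by the points `(κ, κ²)` of three indices. -/
def vander (κ : Fin n → ℝ) (x y z : Fin n) : ℝ :=
  (κ y - κ x) * (κ z - κ x) * (κ z - κ y)

theorem vander_pos_iff (hκ : StrictMono κ) {x y z : Fin n} :
    0 < vander κ x y z ↔ CounterClockwise x y z := by
  have pos : ∀ x y z : Fin n, CounterClockwise x y z → 0 < vander κ x y z := by
    intro x y z h
    unfold vander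
    rcases h with ⟨h1, h2⟩ | ⟨h1, h2⟩ | ⟨h1, h2⟩
    · have := hκ h1; have := hκ h2
      exact mul_pos (mul_pos (by linarith) (by linarith)) (by linarith)
    · have := hκ h1; have := hκ h2
      nlinarith [mul_pos (mul_pos (sub_pos.2 (hκ h1)) (sub_pos.2 (hκ h2)))
        (sub_pos.2 ((hκ h1).trans (hκ h2)))]
    · have := hκ h1; have := hκ h2
      nlinarith [mul_pos (mul_pos (sub_pos.2 (hκ h1)) (sub_pos.2 (hκ h2)))
        (sub_pos.2 ((hκ h1).trans (hκ h2)))]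
  refine ⟨fun h => ?_, pos x y z⟩
  have hxy : x ≠ y := by rintro rfl; simp [vander] at h
  have hxz : x ≠ z := by rintro rfl; simp [vander] at h
  have hyz : y ≠ z := by rintro rfl; simp [vander] at h
  refine (counterClockwise_total hxy hxz hyz).resolve_right fun h' => ?_
  have := pos x z y h'
  unfold vander at h this
  nlinarith

theorem orient_white (κ : Fin n → ℝ) {c x y z : Fin n} (hx : x ≠ c) (hy : y ≠ c) (hz : z ≠ c) :
    orient κ {c, x} {c, y} {c, z} = vander κ x y z := by
  simp only [orient, vander, Finset.sum_pair hx.symm, Finset.sum_pair hy.symm,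
    Finset.sum_pair hz.symm]
  ring

theorem orient_black (κ : Fin n → ℝ) {S : Finset (Fin n)} {x y z : Fin n}
    (hx : x ∈ S) (hy : y ∈ S) (hz : z ∈ S) :
    orient κ (S.erase x) (S.erase y) (S.erase z) = vander κ x y z := by
  have h : ∀ (f : Fin n → ℝ) w, w ∈ S → ∑ i ∈ S.erase w, f i = (∑ i ∈ S, f i) - f w :=
    fun f w hw => by rw [← Finset.add_sum_erase S f hw]; ring
  simp only [orient, vander, h _ x hx, h _ y hy, h _ z hz]
  ring

theorem erase_triple {a x y : Fin n} (hax : a ≠ x) (hay : a ≠ y) (hxy : x ≠ y) :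
    ({a, x, y} : Finset (Fin n)).erase a = {x, y} ∧
      ({a, x, y} : Finset (Fin n)).erase x = {a, y} ∧
      ({a, x, y} : Finset (Fin n)).erase y = {a, x} := by
  refine ⟨?_, ?_, ?_⟩ <;> grind

/-- Three pairwise intersecting chords either have an endpoint in common or are the sides of a
triangle. The labels `g x`, `x ∈ S`, of the regions at a vertex are in both cases in the cyclic
order of the `x`. -/
theorem IsPlot.exists_star (h : IsPlot κ c D) {p : ℝ × ℝ} (hp : 3 ≤ (D p).card) :
    ∃ (S : Finset (Fin n)) (g : Fin n → Finset (Fin n)), S.card = 3 ∧ Set.InjOn g S ∧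
      D p = S.image g ∧ ((∃ c, c ∉ S ∧ g = fun x => {c, x}) ∨ g = S.erase) := by
  obtain ⟨I, J, K, hIJ, hIK, hJK, hD⟩ :=
    Finset.card_eq_three.1 (le_antisymm (h.card_le_three p) hp)
  have hI : I ∈ D p := by rw [hD]; simp
  have hJ : J ∈ D p := by rw [hD]; simp
  have hK : K ∈ D p := by rw [hD]; simp
  obtain ⟨a, ha⟩ := Finset.card_eq_one.1 (h.inter p I hI J hJ hIJ)
  have haIJ : a ∈ I ∩ J := by rw [ha]; simp
  obtain ⟨x, hxa, rfl⟩ := exists_eq_pair_of_mem (h.card_eq_two p I hI) (Finset.mem_inter.1 haIJ).1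
  obtain ⟨y, hya, rfl⟩ := exists_eq_pair_of_mem (h.card_eq_two p J hJ) (Finset.mem_inter.1 haIJ).2
  have hxy : x ≠ y := by rintro rfl; exact hIJ rfl
  by_cases haK : a ∈ K
  · obtain ⟨z, hza, rfl⟩ := exists_eq_pair_of_mem (h.card_eq_two p K hK) haK
    have hxz : x ≠ z := by rintro rfl; exact hIK rfl
    have hyz : y ≠ z := by rintro rfl; exact hJK rfl
    refine ⟨{x, y, z}, fun t => {a, t}, Finset.card_eq_three.2 ⟨x, y, z, hxy, hxz, hyz, rfl⟩,
      ?_, ?_, Or.inl ⟨a, by simp [hxa.symm, hya.symm, hza.symm], rfl⟩⟩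
    · intro s hs t _ hst
      refine pair_eq_pair_cancel hst ?_
      simp only [Finset.coe_insert, Finset.coe_singleton, Set.mem_insert_iff,
        Set.mem_singleton_iff] at hs
      rcases hs with rfl | rfl | rfl <;> assumption
    · rw [hD]; simp
  · obtain ⟨b, hb⟩ := Finset.card_eq_one.1 (h.inter p _ hI K hK hIK)
    obtain ⟨d, hd⟩ := Finset.card_eq_one.1 (h.inter p _ hJ K hK hJK)
    have hb' : b ∈ {a, x} ∩ K := by rw [hb]; simp
    have hd' : d ∈ {a, y} ∩ K := by rw [hd]; simp
    simp only [Finset.mem_inter, Finset.mem_insert, Finset.mem_singleton] at hb' hd'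
    have hxK : x ∈ K := by
      rcases hb'.1 with rfl | rfl
      · exact absurd hb'.2 haK
      · exact hb'.2
    have hyK : y ∈ K := by
      rcases hd'.1 with rfl | rfl
      · exact absurd hd'.2 haK
      · exact hd'.2
    obtain ⟨z, hzx, rfl⟩ := exists_eq_pair_of_mem (h.card_eq_two p K hK) hxK
    obtain rfl : y = z := by
      simp only [Finset.mem_insert, Finset.mem_singleton] at hyK
      exact hyK.resolve_left hxy.symm
    refine ⟨{a, x, y}, ({a, x, y} : Finset (Fin n)).erase,
      Finset.card_eq_three.2 ⟨a, x, y, hxa.symm, hya.symm, hxy, rfl⟩, ?_, ?_, Or.inr rfl⟩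
    · exact fun s hs t _ hst => (Finset.erase_inj _ (by exact_mod_cast hs)).1 hst
    · rw [hD]
      obtain ⟨e1, e2, e3⟩ := erase_triple hxa.symm hya.symm hxy
      simp only [Finset.image_insert, Finset.image_singleton, e1, e2, e3]
      ext M
      simp only [Finset.mem_insert, Finset.mem_singleton]
      tauto

/-- The half-edge with `I` on its right and `J` on its left starts at `p`: the third
region at `p` comes after `I` and `J` in counterclockwise order. -/
def HalfAt (κ : Fin n → ℝ) (D : ℝ × ℝ → Finset (Finset (Fin n))) (p : ℝ × ℝ)
    (I J : Finset (Fin n)) : Prop :=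
  ∃ K, D p = {I, J, K} ∧ 0 < orient κ I J K

theorem orient_ne {I J K : Finset (Fin n)} (h : 0 < orient κ I J K) :
    I ≠ J ∧ J ≠ K ∧ I ≠ K := by
  refine ⟨?_, ?_, ?_⟩ <;> rintro rfl <;> unfold orient at h <;> ring_nf at h <;> simp at h

theorem halfAt_iff (hκ : StrictMono κ) {p : ℝ × ℝ} {S : Finset (Fin n)}
    {g : Fin n → Finset (Fin n)} (hS : S.card = 3) (hg : Set.InjOn g S) (hD : D p = S.image g)
    (ho : ∀ x ∈ S, ∀ y ∈ S, ∀ z ∈ S, orient κ (g x) (g y) (g z) = vander κ x y z)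
    (I J : Finset (Fin n)) :
    HalfAt κ D p I J ↔ ∃ x y, NextIn S x y ∧ g x = I ∧ g y = J := by
  constructor
  · rintro ⟨K, hK, hpos⟩
    have hm : ∀ M ∈ ({I, J, K} : Finset (Finset (Fin n))), ∃ x ∈ S, g x = M := by
      intro M hM
      rw [← hK, hD, Finset.mem_image] at hM
      exact hM
    obtain ⟨x, hx, rfl⟩ := hm I (by simp)
    obtain ⟨y, hy, rfl⟩ := hm J (by simp)
    obtain ⟨z, hz, rfl⟩ := hm K (by simp)
    rw [ho x hx y hy z hz, vander_pos_iff hκ] at hpos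
    refine ⟨x, y, ⟨hx, hy, hpos.ne.1, fun w hw hwx hwy => ?_⟩, rfl, rfl⟩
    have : g w ∈ ({g x, g y, g z} : Finset (Finset (Fin n))) := by
      rw [← hK, hD]; exact Finset.mem_image_of_mem g hw
    simp only [Finset.mem_insert, Finset.mem_singleton] at this
    rcases this with h1 | h1 | h1
    · exact absurd (hg (by exact_mod_cast hw) (by exact_mod_cast hx) h1) hwx
    · exact absurd (hg (by exact_mod_cast hw) (by exact_mod_cast hy) h1) hwy
    · rwa [hg (by exact_mod_cast hw) (by exact_mod_cast hz) h1]
  · rintro ⟨x, y, ⟨hx, hy, hxy, hn⟩, rfl, rfl⟩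
    obtain ⟨z, hz⟩ : ∃ z, (S.erase x).erase y = {z} := by
      rw [← Finset.card_eq_one, Finset.card_erase_of_mem (by grind), Finset.card_erase_of_mem hx,
        hS]
    have hzS : z ∈ (S.erase x).erase y := by rw [hz]; simp
    simp only [Finset.mem_erase] at hzS
    have hS' : S = {x, y, z} := by
      rw [← Finset.insert_erase hx, ← Finset.insert_erase (by grind : y ∈ S.erase x), hz]
    refine ⟨g z, ?_, ?_⟩
    · rw [hD, hS']; simp
    · rw [ho x hx y hy z hzS.2.2, vander_pos_iff hκ]
      exact hn z hzS.2.2 hzS.2.1 hzS.1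

theorem orient_star {S : Finset (Fin n)}
    {g : Fin n → Finset (Fin n)}
    (h : (∃ c, c ∉ S ∧ g = fun x => {c, x}) ∨ g = S.erase) :
    ∀ x ∈ S, ∀ y ∈ S, ∀ z ∈ S, orient κ (g x) (g y) (g z) = vander κ x y z := by
  intro x hx y hy z hz
  rcases h with ⟨c, hc, rfl⟩ | rfl
  · exact orient_white κ (by grind) (by grind) (by grind)
  · exact orient_black κ hx hy hz

end Plot

/-! ### Edges between regions -/

section Edges

variable {n : ℕ}

/-- The direction of the line along which `I` and `J` are in balance that has `J` on its left. -/
def edgeDir (κ : Fin n → ℝ) (I J : Finset (Fin n)) : ℝ × ℝ :=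
  ((∑ i ∈ J, κ i ^ 2) - ∑ i ∈ I, κ i ^ 2, (∑ i ∈ I, κ i) - ∑ i ∈ J, κ i)

variable {κ : Fin n → ℝ} {c : Finset (Fin n) → ℝ} {D : ℝ × ℝ → Finset (Finset (Fin n))}

theorem slope_edgeDir_sub (I J M : Finset (Fin n)) :
    slope κ M (edgeDir κ I J) - slope κ I (edgeDir κ I J) = - orient κ I J M := by
  unfold slope edgeDir orient; ring

theorem slope_edgeDir_eq (I J : Finset (Fin n)) :
    slope κ J (edgeDir κ I J) = slope κ I (edgeDir κ I J) := by
  unfold slope edgeDir; ring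

theorem slope_rotateLeft_edgeDir (I J : Finset (Fin n)) :
    slope κ J (rotateLeft (edgeDir κ I J)) - slope κ I (rotateLeft (edgeDir κ I J)) =
      (edgeDir κ I J).1 ^ 2 + (edgeDir κ I J).2 ^ 2 := by
  unfold slope edgeDir rotateLeft; ring

theorem rotateLeft_smul (s : ℝ) (u : ℝ × ℝ) : rotateLeft (s • u) = s • rotateLeft u := by
  ext <;> simp [rotateLeft]

theorem eq_zero_of_sq_add_sq {x y : ℝ} (h : ¬ 0 < x ^ 2 + y ^ 2) : x = 0 ∧ y = 0 := by
  have hx := sq_nonneg x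
  have hy := sq_nonneg y
  exact ⟨pow_eq_zero_iff two_ne_zero |>.1 (by linarith),
    pow_eq_zero_iff two_ne_zero |>.1 (by linarith)⟩

theorem edgeDir_ne_zero {I J K : Finset (Fin n)} (h : 0 < orient κ I J K) :
    0 < (edgeDir κ I J).1 ^ 2 + (edgeDir κ I J).2 ^ 2 := by
  by_contra hcon
  obtain ⟨h1, h2⟩ := eq_zero_of_sq_add_sq hcon
  unfold edgeDir at h1 h2
  simp only at h1 h2
  unfold orient at h
  rw [h1, show (∑ i ∈ J, κ i) - ∑ i ∈ I, κ i = 0 by linarith] at h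
  simp at h

theorem exists_eq_smul_edgeDir {I J : Finset (Fin n)} {u : ℝ × ℝ}
    (h : 0 < (edgeDir κ I J).1 ^ 2 + (edgeDir κ I J).2 ^ 2) (hu : slope κ J u = slope κ I u) :
    ∃ s : ℝ, u = s • edgeDir κ I J := by
  refine ⟨(u.1 * (edgeDir κ I J).1 + u.2 * (edgeDir κ I J).2) /
    ((edgeDir κ I J).1 ^ 2 + (edgeDir κ I J).2 ^ 2), ?_⟩
  have hu' : u.2 * (edgeDir κ I J).1 = u.1 * (edgeDir κ I J).2 := by
    unfold slope at hu
    simp only [edgeDir]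
    linarith
  ext
  · simp only [Prod.smul_fst, smul_eq_mul]
    field_simp
    linear_combination (-(edgeDir κ I J).2) * hu'
  · simp only [Prod.smul_snd, smul_eq_mul]
    field_simp
    linear_combination (edgeDir κ I J).1 * hu'

theorem IsPlot.slope_eq (h : IsPlot κ c D) {p q : ℝ × ℝ} {I J : Finset (Fin n)}
    (hI : I ∈ D p) (hJ : J ∈ D p) (hI' : I ∈ D q) (hJ' : J ∈ D q) :
    slope κ J (q - p) = slope κ I (q - p) := by
  have h1 := h.eq_of_mem hI hJ
  have h2 := h.eq_of_mem hI' hJ'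
  rw [← add_sub_cancel p q, affineTerm_add, affineTerm_add] at h2
  linarith

/-- Every other point on the boundary between `I` and `J` lies ahead of the half-edge at `p`. -/
theorem HalfAt.exists_nonneg (h : IsPlot κ c D) {p q : ℝ × ℝ} {I J : Finset (Fin n)}
    (hp : HalfAt κ D p I J) (hI : I ∈ D q) (hJ : J ∈ D q) :
    ∃ s : ℝ, 0 ≤ s ∧ q - p = s • edgeDir κ I J := by
  obtain ⟨K, hK, hpos⟩ := hp
  have hIp : I ∈ D p := by rw [hK]; simp
  have hJp : J ∈ D p := by rw [hK]; simp
  have hKp : K ∈ D p := by rw [hK]; simp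
  obtain ⟨s, hs⟩ := exists_eq_smul_edgeDir (edgeDir_ne_zero hpos) (h.slope_eq hIp hJp hI hJ)
  refine ⟨s, ?_, hs⟩
  have h1 := h.eq_of_mem hIp hKp
  have h2 := h.le q I hI K (h.card_eq_two p K hKp)
  rw [← add_sub_cancel p q, affineTerm_add, affineTerm_add, hs, slope_smul, slope_smul] at h2
  have h3 := slope_edgeDir_sub (κ := κ) I J K
  by_contra hneg
  nlinarith

theorem HalfAt.mem (hp : HalfAt κ D p I J) : I ∈ D p ∧ J ∈ D p := by
  obtain ⟨K, hK, -⟩ := hp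
  rw [hK]; simp

theorem HalfAt.unique (h : IsPlot κ c D) {p q : ℝ × ℝ} {I J : Finset (Fin n)}
    (hp : HalfAt κ D p I J) (hq : HalfAt κ D q I J) : p = q := by
  obtain ⟨s, hs, hs'⟩ := hp.exists_nonneg h hq.mem.1 hq.mem.2
  obtain ⟨r, hr, hr'⟩ := hq.exists_nonneg h hp.mem.1 hp.mem.2
  obtain ⟨K, -, hpos⟩ := hp
  have hne := edgeDir_ne_zero hpos
  have h0 : (s + r) • edgeDir κ I J = 0 := by
    rw [add_smul, ← hs', ← hr']; abel
  have h1 : (s + r) * (edgeDir κ I J).1 = 0 := by simpa using congrArg Prod.fst h0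
  have h2 : (s + r) * (edgeDir κ I J).2 = 0 := by simpa using congrArg Prod.snd h0
  have h3 : (s + r) * ((edgeDir κ I J).1 ^ 2 + (edgeDir κ I J).2 ^ 2) = 0 := by
    linear_combination (edgeDir κ I J).1 * h1 + (edgeDir κ I J).2 * h2
  have h4 : s + r = 0 := (mul_eq_zero.1 h3).resolve_right hne.ne'
  have h5 : s = 0 := by linarith
  rw [h5, zero_smul, sub_eq_zero] at hs'
  exact hs'.symm

theorem IsPlot.mem_of_germ (h : IsPlot κ c D) {p u : ℝ × ℝ} {I J : Finset (Fin n)}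
    {ε : ℝ} (hε : 0 < ε) (hu : ∀ s : ℝ, 0 < s → s < ε → D (p + s • u) = {I, J}) :
    I ∈ D p ∧ J ∈ D p := by
  have hmem : ∀ M ∈ ({I, J} : Finset (Finset (Fin n))), M ∈ D p := by
    intro M hM
    refine (h.isClosed_setOf_mem M).mem_of_tendsto (tendsto_add_smul p u) ?_
    filter_upwards [Ioo_mem_nhdsGT hε] with s hs
    rw [hu s hs.1 hs.2]; exact hM
  exact ⟨hmem I (by simp), hmem J (by simp)⟩

/-- If `I` and `J` are the regions on the two sides just after `p` in the direction `u`, and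
`J` is on the left, they form a half-edge at `p`. -/
theorem IsPlot.halfAt_of_germ (h : IsPlot κ c D) {p u : ℝ × ℝ} {I J : Finset (Fin n)}
    (hp : 3 ≤ (D p).card) {ε : ℝ} (hε : 0 < ε)
    (hu : ∀ s : ℝ, 0 < s → s < ε → D (p + s • u) = {I, J})
    (hleft : slope κ I (rotateLeft u) < slope κ J (rotateLeft u)) :
    HalfAt κ D p I J ∧ ∃ r : ℝ, 0 < r ∧ u = r • edgeDir κ I J := by
  obtain ⟨hIp, hJp⟩ := h.mem_of_germ hε hu
  have hIJ : I ≠ J := by rintro rfl; exact lt_irrefl _ hleft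
  obtain ⟨K, hK⟩ : ∃ K, K ∈ D p \ {I, J} := by
    rw [← Finset.Nonempty, ← Finset.card_pos]
    have := Finset.le_card_sdiff {I, J} (D p)
    have := Finset.card_le_two (a := I) (b := J)
    omega
  simp only [Finset.mem_sdiff, Finset.mem_insert, Finset.mem_singleton, not_or] at hK
  obtain ⟨hKp, hKI, hKJ⟩ := hK
  have hD : D p = {I, J, K} := by
    symm
    refine Finset.eq_of_subset_of_card_le ?_ ?_
    · intro M hM
      simp only [Finset.mem_insert, Finset.mem_singleton] at hM
      rcases hM with rfl | rfl | rfl <;> assumption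
    · rw [Finset.card_eq_three.2 ⟨I, J, K, hIJ, Ne.symm hKI, Ne.symm hKJ, rfl⟩]
      exact h.card_le_three p
  have hq := hu (ε / 2) (by linarith) (by linarith)
  have hIq : I ∈ D (p + (ε / 2) • u) := by rw [hq]; simp
  have hJq : J ∈ D (p + (ε / 2) • u) := by rw [hq]; simp
  have hKq : K ∉ D (p + (ε / 2) • u) := by rw [hq]; simp [hKI, hKJ]
  have hslope : slope κ J u = slope κ I u := by
    have h1 := h.eq_of_mem hIp hJp
    have h2 := h.eq_of_mem hIq hJq
    rw [affineTerm_add_smul, affineTerm_add_smul] at h2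
    have : ε / 2 * (slope κ J u - slope κ I u) = 0 := by linarith
    rcases mul_eq_zero.1 this with h3 | h3 <;> linarith
  have hne : 0 < (edgeDir κ I J).1 ^ 2 + (edgeDir κ I J).2 ^ 2 := by
    by_contra hcon
    obtain ⟨h1, h2⟩ := eq_zero_of_sq_add_sq hcon
    unfold edgeDir at h1 h2
    unfold slope at hleft
    simp only at h1 h2
    rw [sub_eq_zero] at h1 h2
    rw [h1, h2] at hleft
    exact lt_irrefl _ hleft
  obtain ⟨r, hr⟩ := exists_eq_smul_edgeDir hne hslope
  have hr0 : 0 < r := by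
    rw [hr, rotateLeft_smul, slope_smul, slope_smul] at hleft
    have := slope_rotateLeft_edgeDir (κ := κ) I J
    by_contra hcon
    nlinarith
  refine ⟨⟨K, hD, ?_⟩, r, hr0, hr⟩
  have h1 := h.lt_of_notMem hIq hKp hKq
  have h2 := h.eq_of_mem hIp hKp
  rw [affineTerm_add_smul, affineTerm_add_smul, hr, slope_smul, slope_smul] at h1
  have h3 := slope_edgeDir_sub (κ := κ) I J K
  have h4 : 0 < ε / 2 * r := by positivity
  by_contra hcon
  nlinarith

/-- The points of the segment between the endpoints of an edge. -/
theorem HalfAt.segment (h : IsPlot κ c D) {p q : ℝ × ℝ} {I J : Finset (Fin n)}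
    (hp : HalfAt κ D p I J) (hq : HalfAt κ D q J I) :
    (∃ s : ℝ, 0 < s ∧ q - p = s • edgeDir κ I J) ∧
      ∀ t : ℝ, 0 < t → t < 1 → D (p + t • (q - p)) = {I, J} := by
  obtain ⟨s, hs, hs'⟩ := hp.exists_nonneg h hq.mem.2 hq.mem.1
  obtain ⟨K, hK, hpos⟩ := hp
  obtain ⟨K', hK', hpos'⟩ := hq
  have hne := orient_ne hpos
  have hIp : I ∈ D p := by rw [hK]; simp
  have hJp : J ∈ D p := by rw [hK]; simp
  have hKp : K ∈ D p := by rw [hK]; simp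
  have hIq : I ∈ D q := by rw [hK']; simp
  have hJq : J ∈ D q := by rw [hK']; simp
  have hs0 : s ≠ 0 := by
    rintro rfl
    rw [zero_smul, sub_eq_zero] at hs'
    subst hs'
    have hKK : K = K' := by
      have : K ∈ ({J, I, K'} : Finset (Finset (Fin n))) := by rw [← hK', hK]; simp
      simp only [Finset.mem_insert, Finset.mem_singleton] at this
      rcases this with h1 | h1 | h1
      · exact absurd h1.symm hne.2.1
      · exact absurd h1.symm hne.2.2
      · exact h1
    rw [hKK] at hpos
    unfold orient at hpos hpos'
    linarith
  have hspos : 0 < s := lt_of_le_of_ne hs hs0.symm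
  refine ⟨⟨s, hspos, hs'⟩, fun t ht0 ht1 => ?_⟩
  have hKq : slope κ K (q - p) < slope κ I (q - p) := by
    rw [hs', slope_smul, slope_smul]
    have := slope_edgeDir_sub (κ := κ) I J K
    nlinarith
  have hIt : ∀ M ∈ ({I, J} : Finset (Finset (Fin n))), M ∈ D (p + t • (q - p)) := by
    intro M hM
    simp only [Finset.mem_insert, Finset.mem_singleton] at hM
    have hMp : M ∈ D p := by rcases hM with rfl | rfl <;> assumption
    have hMq : M ∈ D q := by rcases hM with rfl | rfl <;> assumption
    refine h.mem _ p M hMp fun N hN => ?_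
    have h1 := h.le p M hMp N hN
    have h2 := h.le q M hMq N hN
    rw [← add_sub_cancel p q, affineTerm_add, affineTerm_add] at h2
    rw [affineTerm_add_smul, affineTerm_add_smul]
    nlinarith
  refine Finset.Subset.antisymm (fun M hM => ?_) hIt
  by_contra hMIJ
  simp only [Finset.mem_insert, Finset.mem_singleton, not_or] at hMIJ
  have hM2 := h.card_eq_two _ M hM
  have h1 := h.le p I hIp M hM2
  have h2 := h.le q I hIq M hM2
  have h3 := h.eq_of_mem hM (hIt I (by simp))
  rw [← add_sub_cancel p q, affineTerm_add, affineTerm_add] at h2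
  rw [affineTerm_add_smul, affineTerm_add_smul] at h3
  have h4 : affineTerm κ c M p = affineTerm κ c I p := by
    by_contra hne'
    have := lt_of_le_of_ne h1 hne'
    nlinarith
  have hMp : M ∈ D p := h.mem_of_eq hIp hM h4
  rw [hK] at hMp
  simp only [Finset.mem_insert, Finset.mem_singleton] at hMp
  have hMK : M = K := by
    rcases hMp with h5 | h5 | h5
    · exact absurd h5 hMIJ.1
    · exact absurd h5 hMIJ.2
    · exact h5
  subst hMK
  nlinarith

/-- Following an edge from one of its endpoints, one either goes on forever or comes to
another endpoint. -/
theorem HalfAt.end (h : IsPlot κ c D) {p : ℝ × ℝ} {I J : Finset (Fin n)}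
    (hp : HalfAt κ D p I J) :
    (∀ s : ℝ, 0 < s → D (p + s • edgeDir κ I J) = {I, J}) ∨ ∃ q, HalfAt κ D q J I := by
  classical
  obtain ⟨K, hK, hpos⟩ := hp
  have hne := orient_ne hpos
  have hIp : I ∈ D p := by rw [hK]; simp
  have hJp : J ∈ D p := by rw [hK]; simp
  have hKp : K ∈ D p := by rw [hK]; simp
  set u := edgeDir κ I J with hu
  have hJu : slope κ J u = slope κ I u := slope_edgeDir_eq I J
  have hKu : slope κ K u < slope κ I u := by
    have := slope_edgeDir_sub (κ := κ) I J K
    rw [← hu] at this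
    linarith
  let cand : Finset (Finset (Fin n)) :=
    Finset.univ.filter fun M => (∃ q, M ∈ D q) ∧ slope κ I u < slope κ M u
  have hcandp : ∀ M ∈ cand, affineTerm κ c M p < affineTerm κ c I p := by
    intro M hM
    simp only [cand, Finset.mem_filter, Finset.mem_univ, true_and] at hM
    obtain ⟨⟨q, hq⟩, hlt⟩ := hM
    refine h.lt_of_notMem hIp hq fun hMp => ?_
    rw [hK] at hMp
    simp only [Finset.mem_insert, Finset.mem_singleton] at hMp
    rcases hMp with rfl | rfl | rfl <;> linarith
  rcases cand.eq_empty_or_nonempty with hemp | hnon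
  · left
    have hle : ∀ q, ∀ M ∈ D q, slope κ M u ≤ slope κ I u := by
      intro q M hM
      by_contra hcon
      have : M ∈ cand := by
        simp only [cand, Finset.mem_filter, Finset.mem_univ, true_and]
        exact ⟨⟨q, hM⟩, not_le.1 hcon⟩
      rw [hemp] at this
      simp at this
    intro s hs
    have hmem : ∀ M ∈ ({I, J} : Finset (Finset (Fin n))), M ∈ D (p + s • u) := by
      intro M hM
      simp only [Finset.mem_insert, Finset.mem_singleton] at hM
      have hMp : M ∈ D p := by rcases hM with rfl | rfl <;> assumption
      have hMu : slope κ M u = slope κ I u := by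
        rcases hM with rfl | rfl
        · rfl
        · exact hJu
      refine h.mem_of_region_le hMp fun r N hN => ?_
      rw [affineTerm_add_smul, affineTerm_add_smul]
      have h1 := h.le p M hMp N (h.card_eq_two r N hN)
      have h2 := hle r N hN
      nlinarith
    refine Finset.Subset.antisymm (fun M hM => ?_) hmem
    have h1 := h.le p I hIp M (h.card_eq_two _ M hM)
    have h2 := hle _ M hM
    have h3 := h.eq_of_mem hM (hmem I (by simp))
    rw [affineTerm_add_smul, affineTerm_add_smul] at h3
    have h4 : affineTerm κ c M p = affineTerm κ c I p := by nlinarith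
    have hMp : M ∈ D p := h.mem_of_eq hIp hM h4
    rw [hK] at hMp
    simp only [Finset.mem_insert, Finset.mem_singleton] at hMp ⊢
    rcases hMp with rfl | rfl | rfl
    · exact Or.inl rfl
    · exact Or.inr rfl
    · nlinarith
  · right
    -- the first label that catches up with `I` and `J`
    obtain ⟨M, hM, hmin⟩ := Finset.exists_min_image cand
      (fun M => (affineTerm κ c I p - affineTerm κ c M p) / (slope κ M u - slope κ I u)) hnon
    have hMlt := hcandp M hM
    have hM' := hM
    simp only [cand, Finset.mem_filter, Finset.mem_univ, true_and] at hM'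
    obtain ⟨⟨q₀, hMq₀⟩, hMu⟩ := hM'
    set s := (affineTerm κ c I p - affineTerm κ c M p) / (slope κ M u - slope κ I u) with hs
    have hs0 : 0 < s := div_pos (by linarith) (by linarith)
    have hsM : s * (slope κ M u - slope κ I u) = affineTerm κ c I p - affineTerm κ c M p :=
      div_mul_cancel₀ _ (by linarith)
    have hIs : I ∈ D (p + s • u) := by
      refine h.mem_of_region_le hIp fun r N hN => ?_
      rw [affineTerm_add_smul, affineTerm_add_smul]
      have h1 := h.le p I hIp N (h.card_eq_two r N hN)
      by_cases hNu : slope κ I u < slope κ N u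
      · have h2 := hmin N (by
          simp only [cand, Finset.mem_filter, Finset.mem_univ, true_and]
          exact ⟨⟨r, hN⟩, hNu⟩)
        rw [le_div_iff₀ (by linarith)] at h2
        linarith
      · nlinarith
    have hJs : J ∈ D (p + s • u) := by
      refine h.mem_of_eq hIs hJp ?_
      rw [affineTerm_add_smul, affineTerm_add_smul, hJu, h.eq_of_mem hIp hJp]
    have hMs : M ∈ D (p + s • u) := by
      refine h.mem_of_eq hIs hMq₀ ?_
      rw [affineTerm_add_smul, affineTerm_add_smul]
      linarith
    have hMI : M ≠ I := by rintro rfl; exact lt_irrefl _ hMu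
    have hMJ : M ≠ J := by rintro rfl; exact hMu.ne hJu.symm
    refine ⟨p + s • u, M, ?_, ?_⟩
    · symm
      refine Finset.eq_of_subset_of_card_le ?_ ?_
      · intro N hN
        simp only [Finset.mem_insert, Finset.mem_singleton] at hN
        rcases hN with rfl | rfl | rfl <;> assumption
      · rw [Finset.card_eq_three.2 ⟨J, I, M, hne.1.symm, hMJ.symm, hMI.symm, rfl⟩]
        exact h.card_le_three _
    · have h1 := slope_edgeDir_sub (κ := κ) I J M
      rw [← hu] at h1
      have h2 : orient κ J I M = - orient κ I J M := by unfold orient; ring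
      rw [h2]
      linarith

/-- The edges of the soliton graph are the pairs of opposite half-edges. -/
theorem IsPlot.edge_iff (h : IsPlot κ c D) {p q : ℝ × ℝ} (hp : 3 ≤ (D p).card)
    (hq : 3 ≤ (D q).card) (I J : Finset (Fin n)) :
    (p ≠ q ∧ (∀ s : ℝ, 0 < s → s < 1 → D (p + s • (q - p)) = {I, J}) ∧
      affineTerm κ c I (p + rotateLeft (q - p)) < affineTerm κ c J (p + rotateLeft (q - p))) ↔
    HalfAt κ D p I J ∧ HalfAt κ D q J I := by
  constructor
  · rintro ⟨-, hseg, hleft⟩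
    obtain ⟨hIp, hJp⟩ := h.mem_of_germ one_pos hseg
    have heq := h.eq_of_mem hIp hJp
    have hleft' : slope κ I (rotateLeft (q - p)) < slope κ J (rotateLeft (q - p)) := by
      rw [affineTerm_add, affineTerm_add] at hleft
      linarith
    refine ⟨(h.halfAt_of_germ hp one_pos hseg hleft').1, ?_⟩
    refine (h.halfAt_of_germ (u := p - q) hq one_pos (fun s hs0 hs1 => ?_) ?_).1
    · rw [Finset.pair_comm, ← hseg (1 - s) (by linarith) (by linarith)]
      congr 1
      ext <;> simp <;> ring
    · have : rotateLeft (p - q) = (-1 : ℝ) • rotateLeft (q - p) := by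
        rw [← rotateLeft_smul]; congr 1; ext <;> simp
      rw [this, slope_smul, slope_smul]
      linarith
  · rintro ⟨h1, h2⟩
    obtain ⟨⟨s, hs, hs'⟩, hseg⟩ := h1.segment h h2
    obtain ⟨K, hK, hpos⟩ := h1
    have hne := edgeDir_ne_zero hpos
    have hrot := slope_rotateLeft_edgeDir (κ := κ) I J
    refine ⟨?_, hseg, ?_⟩
    · rintro rfl
      rw [sub_self] at hs'
      have e1 : s * (edgeDir κ I J).1 = 0 := by simpa using (congrArg Prod.fst hs').symm
      have e2 : s * (edgeDir κ I J).2 = 0 := by simpa using (congrArg Prod.snd hs').symm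
      rcases mul_eq_zero.1 e1 with e1 | e1 <;> rcases mul_eq_zero.1 e2 with e2 | e2
      · linarith
      · linarith
      · linarith
      · rw [e1, e2] at hne; simp at hne
    · rw [affineTerm_add, affineTerm_add, hs', rotateLeft_smul, slope_smul, slope_smul,
        h.eq_of_mem (by rw [hK]; simp : I ∈ D p) (by rw [hK]; simp : J ∈ D p)]
      nlinarith

/-- The rays of the soliton graph are the half-edges that do not end. -/
theorem IsPlot.ray_iff (h : IsPlot κ c D) {p : ℝ × ℝ} (hp : 3 ≤ (D p).card)
    (I J : Finset (Fin n)) :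
    (∃ u : ℝ × ℝ, u ≠ 0 ∧ (∀ s : ℝ, 0 < s → D (p + s • u) = {I, J}) ∧
      affineTerm κ c I (p + rotateLeft u) < affineTerm κ c J (p + rotateLeft u)) ↔
    HalfAt κ D p I J ∧ ∀ s : ℝ, 0 < s → D (p + s • edgeDir κ I J) = {I, J} := by
  constructor
  · rintro ⟨u, -, hseg, hleft⟩
    obtain ⟨hIp, hJp⟩ := h.mem_of_germ one_pos fun s hs _ => hseg s hs
    have heq := h.eq_of_mem hIp hJp
    have hleft' : slope κ I (rotateLeft u) < slope κ J (rotateLeft u) := by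
      rw [affineTerm_add, affineTerm_add] at hleft
      linarith
    obtain ⟨hh, r, hr, hur⟩ := h.halfAt_of_germ hp one_pos (fun s hs _ => hseg s hs) hleft'
    refine ⟨hh, fun s hs => ?_⟩
    rw [← hseg (s / r) (by positivity), hur, smul_smul, div_mul_cancel₀ _ hr.ne']
  · rintro ⟨hh, hseg⟩
    obtain ⟨K, hK, hpos⟩ := hh
    have hne := edgeDir_ne_zero hpos
    have hrot := slope_rotateLeft_edgeDir (κ := κ) I J
    refine ⟨_, ?_, hseg, ?_⟩
    · intro h0
      rw [h0] at hne; simp at hne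
    · rw [affineTerm_add, affineTerm_add,
        h.eq_of_mem (by rw [hK]; simp : I ∈ D p) (by rw [hK]; simp : J ∈ D p)]
      linarith

end Edges

/-! ### Unbounded regions and rays -/

section Unbounded

variable {n : ℕ} {κ : Fin n → ℝ} {c : Finset (Fin n) → ℝ}
  {D : ℝ × ℝ → Finset (Finset (Fin n))}

/-- The points `(κ_k, κ_k²)` are in convex position: the product `(κ_k - κ_i) (κ_k - κ_j)` has the
same sign for all other `k` if `i` and `j` are consecutive. -/
theorem exists_support (hκ : StrictMono κ) {i j : Fin n} (hij : Follows i j) :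
    ∃ u : ℝ × ℝ, ∀ k, k ≠ i → k ≠ j →
      κ k * u.1 + κ k ^ 2 * u.2 < κ i * u.1 + κ i ^ 2 * u.2 ∧
      κ k * u.1 + κ k ^ 2 * u.2 < κ j * u.1 + κ j ^ 2 * u.2 := by
  rw [follows_iff] at hij
  rcases hij with hij | ⟨hi, hj⟩
  · refine ⟨(κ i + κ j, -1), fun k hki hkj => ?_⟩
    have hpos : 0 < (κ k - κ i) * (κ k - κ j) := by
      have hki' : (k : ℕ) ≠ i := fun h => hki (Fin.ext h)
      have hkj' : (k : ℕ) ≠ j := fun h => hkj (Fin.ext h)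
      rcases lt_or_ge (k : ℕ) i with h | h
      · have h1 := hκ (show k < i from h)
        have h2 := hκ (show k < j from by rw [Fin.lt_def]; omega)
        exact mul_pos_of_neg_of_neg (by linarith) (by linarith)
      · have h1 := hκ (show i < k from by rw [Fin.lt_def]; omega)
        have h2 := hκ (show j < k from by rw [Fin.lt_def]; omega)
        exact mul_pos (by linarith) (by linarith)
    constructor <;> simp only <;> nlinarith
  · refine ⟨(-(κ i + κ j), 1), fun k hki hkj => ?_⟩
    have hneg : (κ k - κ i) * (κ k - κ j) < 0 := by
      have hki' : (k : ℕ) ≠ i := fun h => hki (Fin.ext h)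
      have hkj' : (k : ℕ) ≠ j := fun h => hkj (Fin.ext h)
      have hk := k.2
      have h1 := hκ (show k < i from by rw [Fin.lt_def]; omega)
      have h2 := hκ (show j < k from by rw [Fin.lt_def]; omega)
      exact mul_neg_of_neg_of_pos (by linarith) (by linarith)
    constructor <;> simp only <;> nlinarith

/-- If the slope of `I` in the direction `u` is larger than all others, then every ray in the
direction `u` ends up in the region labeled `I`. -/
theorem IsPlot.exists_mem_of_slope_lt (h : IsPlot κ c D) (p : ℝ × ℝ) {u : ℝ × ℝ}
    {I : Finset (Fin n)} (hI : I.card = 2)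
    (hslope : ∀ M : Finset (Fin n), M.card = 2 → M ≠ I → slope κ M u < slope κ I u) :
    ∃ s : ℝ, 0 < s ∧ I ∈ D (p + s • u) := by
  have hev : ∀ᶠ s : ℝ in Filter.atTop, ∀ M : Finset (Fin n), M.card = 2 → M ≠ I →
      affineTerm κ c M (p + s • u) < affineTerm κ c I (p + s • u) := by
    rw [Filter.eventually_all]
    intro M
    filter_upwards [Filter.eventually_gt_atTop ((affineTerm κ c M p - affineTerm κ c I p) /
      (slope κ I u - slope κ M u))] with s hs hM hMne
    have hlt := hslope M hM hMne
    rw [div_lt_iff₀ (by linarith)] at hs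
    rw [affineTerm_add_smul, affineTerm_add_smul]
    linarith
  obtain ⟨s, hs, hs0⟩ := (hev.and (Filter.eventually_gt_atTop 0)).exists
  obtain ⟨M, hM⟩ := h.nonempty (p + s • u)
  have hMI : M = I := by
    by_contra hMne
    have h1 := hs M (h.card_eq_two _ M hM) hMne
    have h2 := h.le _ M hM I hI
    linarith
  exact ⟨s, hs0, hMI ▸ hM⟩

/-- The sides of the polygon are labels of regions. -/
theorem IsPlot.exists_mem_side (h : IsPlot κ c D) (hn : 3 ≤ n) (hκ : StrictMono κ) {i j : Fin n}
    (hij : Follows i j) : ∃ p, {i, j} ∈ D p := by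
  obtain ⟨u, hu⟩ := exists_support hκ hij
  have hne := hij.ne hn
  have hslope : ∀ M : Finset (Fin n), M.card = 2 → M ≠ {i, j} →
      slope κ M u < slope κ {i, j} u := by
    intro M hM hMne
    obtain ⟨a, b, hab, rfl⟩ := Finset.card_eq_two.1 hM
    rw [slope_pair κ hab, slope_pair κ hne]
    by_cases ha : a = i ∨ a = j
    · have hbi : b ≠ i := by
        rintro rfl
        rcases ha with rfl | rfl
        · exact hab rfl
        · exact hMne (Finset.pair_comm _ _)
      have hbj : b ≠ j := by
        rintro rfl
        rcases ha with rfl | rfl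
        · exact hMne rfl
        · exact hab rfl
      have := hu b hbi hbj
      rcases ha with rfl | rfl <;> linarith
    · push Not at ha
      have h1 := hu a ha.1 ha.2
      by_cases hb : b = i ∨ b = j
      · rcases hb with rfl | rfl <;> linarith
      · push Not at hb
        have h2 := hu b hb.1 hb.2
        linarith
  obtain ⟨s, -, hs⟩ := h.exists_mem_of_slope_lt 0 (Finset.card_pair hne) hslope
  exact ⟨_, hs⟩

theorem orient_pair {a x y i j : Fin n} (hx : x ≠ a) (hy : y ≠ a) (hij : i ≠ j) :
    orient κ {a, x} {a, y} {i, j} = vander κ x y i + vander κ x y j - vander κ x y a := by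
  simp only [orient, vander, Finset.sum_pair hx.symm, Finset.sum_pair hy.symm,
    Finset.sum_pair hij]
  ring

/-- If a half-edge between `I` and `J` goes on forever, then the gradient of no side of the polygon
lies to the right of the line from the gradient of `I` to that of `J`. This is only possible
if `I` and `J` are the two sides of the polygon at one of its vertices. -/
theorem IsPlot.outerSidesAt_of_ray (h : IsPlot κ c D) (hn : 3 ≤ n) (hκ : StrictMono κ)
    {p : ℝ × ℝ} {I J : Finset (Fin n)} (hp : HalfAt κ D p I J)
    (hray : ∀ s : ℝ, 0 < s → D (p + s • edgeDir κ I J) = {I, J}) :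
    ∃ a, OuterSidesAt a I J := by
  obtain ⟨hI, hJ⟩ := hp.mem
  obtain ⟨K, hK, hpos⟩ := hp
  have hIJ := (orient_ne hpos).1
  have hside : ∀ i j, Follows i j → 0 ≤ orient κ I J {i, j} := by
    intro i j hij
    by_contra hcon
    have h1 := slope_edgeDir_sub (κ := κ) I J {i, j}
    set u := edgeDir κ I J
    have h2 : 0 < slope κ {i, j} u - slope κ I u := by linarith
    set s := (affineTerm κ c I p - affineTerm κ c {i, j} p + 1) /
      (slope κ {i, j} u - slope κ I u) with hs
    have hle := h.le p I hI {i, j} (Finset.card_pair (hij.ne hn))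
    have hs0 : 0 < s := div_pos (by linarith) h2
    have hIs : I ∈ D (p + s • u) := by rw [hray s hs0]; simp
    have h3 := h.le _ I hIs {i, j} (Finset.card_pair (hij.ne hn))
    rw [affineTerm_add_smul, affineTerm_add_smul] at h3
    have h4 : s * (slope κ {i, j} u - slope κ I u) =
      affineTerm κ c I p - affineTerm κ c {i, j} p + 1 := div_mul_cancel₀ _ h2.ne'
    linarith
  obtain ⟨a, ha⟩ := Finset.card_eq_one.1 (h.inter p I hI J hJ hIJ)
  have haIJ : a ∈ I ∩ J := by rw [ha]; simp
  obtain ⟨x, hxa, rfl⟩ := exists_eq_pair_of_mem (h.card_eq_two p I hI) (Finset.mem_inter.1 haIJ).1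
  obtain ⟨y, hya, rfl⟩ := exists_eq_pair_of_mem (h.card_eq_two p J hJ) (Finset.mem_inter.1 haIJ).2
  have hxy : x ≠ y := by rintro rfl; exact hIJ rfl
  have hside' : ∀ i j, Follows i j →
      0 ≤ vander κ x y i + vander κ x y j - vander κ x y a := by
    intro i j hij
    rw [← orient_pair hxa hya (hij.ne hn)]
    exact hside i j hij
  have hx0 : vander κ x y x = 0 := by simp [vander]
  rcases counterClockwise_total hxy hxa hya with h1 | h1
  · exfalso
    obtain ⟨s, hs⟩ := exists_follows x
    have h2 := hside' x s hs
    have h3 := (vander_pos_iff hκ).2 h1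
    have h4 : ¬ 0 < vander κ x y s := by
      rw [vander_pos_iff hκ]; exact hs.not_between
    linarith
  · have hneg : ∀ k, CounterClockwise x k y → vander κ x y k < 0 := by
      intro k hk
      have := (vander_pos_iff hκ).2 hk
      unfold vander at this ⊢
      linarith
    have ha := hneg a h1
    obtain ⟨q, hq⟩ := exists_follows_left a
    obtain ⟨s, hs⟩ := exists_follows a
    have hs1 : ¬ CounterClockwise x s y := by
      intro h2
      have := hneg s h2
      have := hside' a s hs
      linarith
    have hq1 : ¬ CounterClockwise x q y := by
      intro h2
      have := hneg q h2
      have := hside' q a hq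
      linarith
    refine ⟨a, x, y, ?_, ?_, Finset.pair_comm _ _, rfl⟩
    · have : q = x := by
        rw [follows_iff] at hq
        have := q.2; have := a.2; have := x.2; have := y.2
        simp only [CounterClockwise, Fin.lt_def, Fin.ext_iff] at *; omega
      exact this ▸ hq
    · have : s = y := by
        rw [follows_iff] at hs
        have := s.2; have := a.2; have := x.2; have := y.2
        simp only [CounterClockwise, Fin.lt_def, Fin.ext_iff] at *; omega
      exact this ▸ hs

end Unbounded

/-! ### The vertex of type `[a, x]`, `[b, x]`, `[a, b]` in a given arc -/

section Arc

variable {n : ℕ} {κ : Fin n → ℝ} {c : Finset (Fin n) → ℝ}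
  {D : ℝ × ℝ → Finset (Finset (Fin n))}

theorem exists_pair_of_inter {a b : Fin n} {M : Finset (Fin n)} (hM : M.card = 2)
    (h1 : ({a, b} ∩ M : Finset (Fin n)).card = 1) (hne : M ≠ {a, b}) :
    ∃ x, x ≠ a ∧ x ≠ b ∧ (M = {a, x} ∨ M = {b, x}) := by
  rw [Finset.inter_comm] at h1
  obtain ⟨x, y, hxy, rfl⟩ := Finset.card_eq_two.1 hM
  by_cases hx : x = a ∨ x = b
  · have hy : y ≠ a ∧ y ≠ b := by
      constructor
      · rintro rfl
        rcases hx with rfl | rfl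
        · exact hxy rfl
        · exact hne (Finset.pair_comm _ _)
      · rintro rfl
        rcases hx with rfl | rfl
        · exact hne rfl
        · exact hxy rfl
    exact ⟨y, hy.1, hy.2, by rcases hx with rfl | rfl <;> simp⟩
  · push Not at hx
    refine ⟨x, hx.1, hx.2, ?_⟩
    obtain ⟨z, hz⟩ := Finset.card_eq_one.1 h1
    have hz' : z ∈ ({x, y} : Finset (Fin n)) ∩ {a, b} := by rw [hz]; simp
    simp only [Finset.mem_inter, Finset.mem_insert, Finset.mem_singleton] at hz'
    rcases hz' with ⟨rfl | rfl, h2⟩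
    · rcases h2 with h2 | h2
      · exact absurd h2 hx.1
      · exact absurd h2 hx.2
    · rcases h2 with rfl | rfl
      · exact Or.inl (Finset.pair_comm _ _)
      · exact Or.inr (Finset.pair_comm _ _)

theorem IsPlot.eq_pair_of_mem (h : IsPlot κ c D) {p : ℝ × ℝ} {a b : Fin n}
    {M : Finset (Fin n)} (hI : {a, b} ∈ D p) (hM : M ∈ D p) (hne : M ≠ {a, b}) :
    ∃ x, x ≠ a ∧ x ≠ b ∧ (M = {a, x} ∨ M = {b, x}) :=
  exists_pair_of_inter (h.card_eq_two p M hM) (h.inter p _ hI _ hM hne.symm) hne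

theorem inter_eq_empty_of_ne {a b x y : Fin n} (hab : a ≠ b) (hxb : x ≠ b) (hya : y ≠ a)
    (hxy : x ≠ y) : ({a, x} : Finset (Fin n)) ∩ {b, y} = ∅ ∧
      ({a, x} : Finset (Fin n)) ≠ {b, y} := by
  have he : ({a, x} : Finset (Fin n)) ∩ {b, y} = ∅ := by
    ext i
    simp only [Finset.mem_inter, Finset.mem_insert, Finset.mem_singleton, Finset.notMem_empty,
      iff_false]
    rintro ⟨rfl | rfl, rfl | rfl⟩
    · exact hab rfl
    · exact hya rfl
    · exact hxb rfl
    · exact hxy rfl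
  refine ⟨he, fun heq => ?_⟩
  rw [← heq, Finset.inter_self] at he
  exact Finset.insert_ne_empty _ _ he

theorem IsPlot.ne_of_pair_mem (h : IsPlot κ c D) {p : ℝ × ℝ} {a b : Fin n}
    (hI : {a, b} ∈ D p) : a ≠ b := fun hab => by
  have := h.card_eq_two p _ hI
  simp [hab] at this

theorem IsPlot.not_mem_of_disjoint (h : IsPlot κ c D) {p : ℝ × ℝ} {a b x y : Fin n}
    (hab : a ≠ b) (hxb : x ≠ b) (hya : y ≠ a) (hxy : x ≠ y) (hx : {a, x} ∈ D p)
    (hy : {b, y} ∈ D p) : False := by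
  obtain ⟨he, hne⟩ := inter_eq_empty_of_ne hab hxb hya hxy
  have := h.inter _ _ hx _ hy hne
  simp [he] at this

/-- The region labeled `I` is convex. -/
theorem IsPlot.mem_segment (h : IsPlot κ c D) {p q : ℝ × ℝ} {I : Finset (Fin n)}
    (hp : I ∈ D p) (hq : I ∈ D q) {t : ℝ} (ht0 : 0 ≤ t) (ht1 : t ≤ 1) :
    I ∈ D (p + t • (q - p)) := by
  refine h.mem _ p I hp fun J hJ => ?_
  have h1 := h.le p I hp J hJ
  have h2 := h.le q I hq J hJ
  have e : ∀ M, affineTerm κ c M (p + t • (q - p)) =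
      (1 - t) * affineTerm κ c M p + t * affineTerm κ c M q := by
    intro M
    simp only [affineTerm, Prod.fst_add, Prod.snd_add, Prod.smul_fst, Prod.smul_snd, smul_eq_mul,
      Prod.fst_sub, Prod.snd_sub]
    ring
  rw [e, e]
  nlinarith [mul_le_mul_of_nonneg_left h1 (sub_nonneg.2 ht1), mul_le_mul_of_nonneg_left h2 ht0]

theorem IsPlot.eventually_subset (h : IsPlot κ c D) (q : ℝ × ℝ) :
    ∀ᶠ p in 𝓝 q, D p ⊆ D q := by
  have : ∀ᶠ p in 𝓝 q, ∀ M, M ∈ D p → M ∈ D q := by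
    rw [Filter.eventually_all]
    intro M
    by_cases hM : M ∈ D q
    · exact Filter.Eventually.of_forall fun _ _ => hM
    · filter_upwards [(h.isClosed_setOf_mem M).isOpen_compl.mem_nhds hM] with p hp hMp
      exact absurd hMp hp
  exact this

/-- The region labeled `I` extends from `q` in every direction in which `I` has the largest slope
among the labels at `q`. -/
theorem IsPlot.exists_mem_of_slope_le (h : IsPlot κ c D) {q u : ℝ × ℝ} {I : Finset (Fin n)}
    (hI : I ∈ D q) (hle : ∀ N ∈ D q, slope κ N u ≤ slope κ I u) :
    ∃ s : ℝ, 0 < s ∧ I ∈ D (q + s • u) := by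
  obtain ⟨s, hs, hs0⟩ := (((tendsto_add_smul q u).eventually (h.eventually_subset q)).and
    (eventually_mem_nhdsWithin)).exists
  refine ⟨s, hs0, ?_⟩
  obtain ⟨N, hN⟩ := h.nonempty (q + s • u)
  refine h.mem _ q I hI fun J hJ => (h.le _ N hN J hJ).trans ?_
  rw [affineTerm_add_smul, affineTerm_add_smul, h.eq_of_mem (hs hN) hI]
  have := mul_le_mul_of_nonneg_left (hle N (hs hN)) (le_of_lt hs0)
  linarith

/-- From any point of the region labeled `I`, walk in the direction `w` until the region ends. -/
theorem IsPlot.exists_push (h : IsPlot κ c D) {I : Finset (Fin n)} {w : ℝ × ℝ}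
    (hM : ∃ q, ∃ M ∈ D q, slope κ I w < slope κ M w) :
    ∃ τ : ℝ × ℝ → ℝ, Continuous τ ∧ ∀ p, I ∈ D p → 0 ≤ τ p ∧ I ∈ D (p + τ p • w) ∧
      ∃ M ∈ D (p + τ p • w), slope κ I w < slope κ M w := by
  classical
  let P : Finset (Finset (Fin n)) :=
    Finset.univ.filter fun M => (∃ q, M ∈ D q) ∧ slope κ I w < slope κ M w
  have hP : P.Nonempty := by
    obtain ⟨q, M, hMq, hlt⟩ := hM
    exact ⟨M, Finset.mem_filter.2 ⟨Finset.mem_univ _, ⟨q, hMq⟩, hlt⟩⟩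
  let f : Finset (Fin n) → ℝ × ℝ → ℝ := fun M p =>
    (affineTerm κ c I p - affineTerm κ c M p) / (slope κ M w - slope κ I w)
  refine ⟨fun p => P.inf' hP fun M => f M p, ?_, fun p hp => ?_⟩
  · refine Continuous.finset_inf'_apply hP fun M _ => ?_
    exact ((continuous_affineTerm _ _ _).sub (continuous_affineTerm _ _ _)).div_const _
  have hP' : ∀ M ∈ P, (∃ q, M ∈ D q) ∧ slope κ I w < slope κ M w := fun M hM =>
    (Finset.mem_filter.1 hM).2
  have h0 : 0 ≤ P.inf' hP fun M => f M p := by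
    rw [Finset.le_inf'_iff]
    intro M hM
    obtain ⟨⟨q, hq⟩, hlt⟩ := hP' M hM
    exact div_nonneg (sub_nonneg.2 (h.le p I hp M (h.card_eq_two q M hq))) (by linarith)
  have hI : I ∈ D (p + (P.inf' hP fun M => f M p) • w) := by
    refine h.mem_of_region_le hp fun r J hJ => ?_
    rw [affineTerm_add_smul, affineTerm_add_smul]
    have hle := h.le p I hp J (h.card_eq_two r J hJ)
    rcases le_or_gt (slope κ J w) (slope κ I w) with hlt | hlt
    · nlinarith [mul_le_mul_of_nonneg_left hlt h0]
    · have := Finset.inf'_le (fun M => f M p)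
        (show J ∈ P from Finset.mem_filter.2 ⟨Finset.mem_univ _, ⟨r, hJ⟩, hlt⟩)
      rw [le_div_iff₀ (by linarith)] at this
      linarith
  refine ⟨h0, hI, ?_⟩
  obtain ⟨M, hM, hMe⟩ := Finset.exists_mem_eq_inf' hP fun M => f M p
  obtain ⟨⟨q, hq⟩, hlt⟩ := hP' M hM
  refine ⟨M, h.mem_of_eq hI hq ?_, hlt⟩
  dsimp only
  rw [hMe, affineTerm_add_smul, affineTerm_add_smul]
  have : f M p * (slope κ M w - slope κ I w) = affineTerm κ c I p - affineTerm κ c M p :=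
    div_mul_cancel₀ _ (by linarith)
  linarith

theorem IsPlot.le_zero_of_slope_lt (h : IsPlot κ c D) {p w : ℝ × ℝ} {I M : Finset (Fin n)}
    (hI : I ∈ D p) (hM : M ∈ D p) (hlt : slope κ I w < slope κ M w) {s : ℝ}
    (hs : I ∈ D (p + s • w)) : s ≤ 0 := by
  have h1 := h.le _ I hs M (h.card_eq_two p M hM)
  rw [affineTerm_add_smul, affineTerm_add_smul, h.eq_of_mem hI hM] at h1
  by_contra hs0
  nlinarith

/-- A direction, scaled by `ε`, in which the terms of `{a, x}` and `{b, x}` have the same slope. -/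
def upDir (κ : Fin n → ℝ) (ε : ℝ) (a b : Fin n) : ℝ × ℝ := (-(ε * (κ a + κ b)), ε)

/-- The slope of `{a, k}` and of `{b, k}` relative to `{a, b}` in the direction `upDir κ ε a b`. -/
def rise (κ : Fin n → ℝ) (ε : ℝ) (a b k : Fin n) : ℝ := ε * (κ k - κ a) * (κ k - κ b)

theorem slope_upDir {ε : ℝ} {a b i j : Fin n} (hab : a ≠ b) (hij : i ≠ j) :
    slope κ {i, j} (upDir κ ε a b) =
      slope κ {a, b} (upDir κ ε a b) + rise κ ε a b i + rise κ ε a b j := by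
  rw [slope_pair κ hij, slope_pair κ hab]
  simp only [upDir, rise]
  ring

theorem rise_left {ε : ℝ} {a b : Fin n} : rise κ ε a b a = 0 := by simp [rise]

theorem rise_right {ε : ℝ} {a b : Fin n} : rise κ ε a b b = 0 := by simp [rise]

theorem rise_comm {ε : ℝ} {a b k : Fin n} : rise κ ε a b k = rise κ ε b a k := by
  unfold rise; ring

theorem upDir_comm {ε : ℝ} {a b : Fin n} : upDir κ ε a b = upDir κ ε b a := by
  unfold upDir; rw [add_comm (κ a)]

theorem ne_of_rise_pos {ε : ℝ} {a b k : Fin n} (hk : 0 < rise κ ε a b k) : k ≠ a ∧ k ≠ b := by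
  constructor <;> rintro rfl <;> simp [rise] at hk

theorem slope_lt_of_rise_pos {ε : ℝ} {a b k : Fin n} (hab : a ≠ b) (hk : 0 < rise κ ε a b k) :
    slope κ {a, b} (upDir κ ε a b) < slope κ {a, k} (upDir κ ε a b) := by
  rw [slope_upDir hab (ne_of_rise_pos hk).1.symm, rise_left]
  linarith

/-- A point of the region of `{a, b}` is of the `a`-kind if it also belongs to a region labeled
`{a, x}` that lies ahead in the direction `upDir`. -/
def AKind (κ : Fin n → ℝ) (D : ℝ × ℝ → Finset (Finset (Fin n))) (ε : ℝ) (a b : Fin n)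
    (p : ℝ × ℝ) : Prop :=
  ∃ x, 0 < rise κ ε a b x ∧ {a, x} ∈ D p

theorem IsPlot.kind_of_slope_lt (h : IsPlot κ c D) {p : ℝ × ℝ} {a b : Fin n} {ε : ℝ}
    {M : Finset (Fin n)} (hI : {a, b} ∈ D p) (hM : M ∈ D p)
    (hlt : slope κ {a, b} (upDir κ ε a b) < slope κ M (upDir κ ε a b)) :
    AKind κ D ε a b p ∨ AKind κ D ε b a p := by
  have hab := h.ne_of_pair_mem hI
  obtain ⟨x, hxa, hxb, rfl | rfl⟩ := h.eq_pair_of_mem hI hM (by rintro rfl; exact hlt.false)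
  · rw [slope_upDir hab hxa.symm, rise_left] at hlt
    exact Or.inl ⟨x, by linarith, hM⟩
  · rw [slope_upDir hab hxb.symm, rise_right] at hlt
    exact Or.inr ⟨x, by rw [rise_comm]; linarith, hM⟩

/-- The difference of the slopes of `{b, x}` and `{a, x}`. -/
def tilt (κ : Fin n → ℝ) (a b : Fin n) (p : ℝ × ℝ) : ℝ :=
  (κ b - κ a) * p.1 + (κ b ^ 2 - κ a ^ 2) * p.2

theorem affineTerm_sub_eq_tilt {a b x : Fin n} (hxa : x ≠ a) (hxb : x ≠ b) (p : ℝ × ℝ) :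
    affineTerm κ c {b, x} p - affineTerm κ c {a, x} p = c {b, x} - c {a, x} + tilt κ a b p := by
  simp only [affineTerm, tilt, Finset.sum_pair hxa.symm, Finset.sum_pair hxb.symm]
  ring

theorem tilt_add_smul_upDir {ε : ℝ} {a b : Fin n} (p : ℝ × ℝ) (s : ℝ) :
    tilt κ a b (p + s • upDir κ ε a b) = tilt κ a b p := by
  simp only [tilt, upDir, Prod.fst_add, Prod.snd_add, Prod.smul_fst, Prod.smul_snd, smul_eq_mul]
  ring

theorem continuous_tilt {a b : Fin n} : Continuous (tilt κ a b) := by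
  unfold tilt; fun_prop

theorem rise_ne_zero (hκ : StrictMono κ) {ε : ℝ} (hε : ε ≠ 0) {a b k : Fin n} (hka : k ≠ a)
    (hkb : k ≠ b) : rise κ ε a b k ≠ 0 :=
  mul_ne_zero (mul_ne_zero hε (sub_ne_zero.2 (hκ.injective.ne hka)))
    (sub_ne_zero.2 (hκ.injective.ne hkb))

/-- If there are indices on both sides of the chord `{a, b}`, then a strip of the region of
`{a, b}` between two level lines of `tilt` is compact. -/
theorem IsPlot.isCompact_strip (h : IsPlot κ c D) {a b x z : Fin n} {ε : ℝ}
    (hab : κ a ≠ κ b) (hx : 0 < rise κ ε a b x) (hz : rise κ ε a b z < 0) (m M : ℝ) :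
    IsCompact {p | {a, b} ∈ D p ∧ m ≤ tilt κ a b p ∧ tilt κ a b p ≤ M} := by
  have hab' : a ≠ b := fun h => hab (congrArg κ h)
  have hza : z ≠ a := by rintro rfl; rw [rise_left] at hz; exact hz.false
  obtain ⟨hxa, -⟩ := ne_of_rise_pos hx
  have hd : κ b - κ a ≠ 0 := sub_ne_zero.2 (Ne.symm hab)
  -- coordinates in which `tilt` is the first one
  let e : ℝ × ℝ → ℝ := fun p => p.1 + (κ a + κ b) * p.2
  have he : ∀ p, tilt κ a b p = (κ b - κ a) * e p := fun p => by simp only [tilt, e]; ring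
  obtain ⟨E, hE⟩ : ∃ E : ℝ, ∀ p, m ≤ tilt κ a b p → tilt κ a b p ≤ M → |e p| ≤ E := by
    refine ⟨max |m| |M| / |κ b - κ a|, fun p h1 h2 => ?_⟩
    rw [le_div_iff₀ (abs_pos.2 hd), mul_comm, ← abs_mul, ← he]
    exact abs_le_max_abs_abs h1 h2
  have key : ∀ p y, y ≠ a → {a, b} ∈ D p → |e p| ≤ E →
      c {a, y} - c {a, b} - |κ b - κ y| * E ≤ (κ b - κ y) * (κ y - κ a) * p.2 := by
    intro p y hy hp hep
    have h1 := h.le p _ hp {a, y} (Finset.card_pair hy.symm)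
    simp only [affineTerm, Finset.sum_pair hy.symm, Finset.sum_pair hab'] at h1
    have h2 : (κ b - κ y) * e p ≤ |κ b - κ y| * E :=
      (le_abs_self _).trans (by rw [abs_mul]; exact mul_le_mul_of_nonneg_left hep (abs_nonneg _))
    simp only [e] at h2
    nlinarith
  obtain ⟨F, hF⟩ : ∃ F : ℝ, ∀ p, {a, b} ∈ D p → |e p| ≤ E → |p.2| ≤ F := by
    set kx := c {a, x} - c {a, b} - |κ b - κ x| * E with hkx
    set kz := c {a, z} - c {a, b} - |κ b - κ z| * E with hkz
    set αx := (κ b - κ x) * (κ x - κ a) with hαx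
    set αz := (κ b - κ z) * (κ z - κ a) with hαz
    have hsx : 0 < -(ε * αx) := by unfold rise at hx; rw [hαx]; linarith
    have hsz : 0 < ε * αz := by unfold rise at hz; rw [hαz]; linarith
    refine ⟨|kx / αx| + |kz / αz|, fun p hp hep => ?_⟩
    have h1 := key p x hxa hp hep
    have h2 := key p z hza hp hep
    have b1 := neg_abs_le (kx / αx)
    have b2 := neg_abs_le (kz / αz)
    have b3 := le_abs_self (kx / αx)
    have b4 := le_abs_self (kz / αz)
    have b5 := abs_nonneg (kx / αx)
    have b6 := abs_nonneg (kz / αz)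
    rw [abs_le]
    rcases lt_trichotomy ε 0 with hε | rfl | hε
    · have p1 : 0 < αx := by nlinarith
      have p2 : αz < 0 := by nlinarith
      have q1 : kx / αx ≤ p.2 := by rw [div_le_iff₀ p1]; linarith
      have q2 : p.2 ≤ kz / αz := by rw [le_div_iff_of_neg p2]; linarith
      constructor <;> linarith
    · simp at hsx
    · have p1 : αx < 0 := by nlinarith
      have p2 : 0 < αz := by nlinarith
      have q1 : p.2 ≤ kx / αx := by rw [le_div_iff_of_neg p1]; linarith
      have q2 : kz / αz ≤ p.2 := by rw [div_le_iff₀ p2]; linarith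
      constructor <;> linarith
  set G := E + |κ a + κ b| * F
  refine IsCompact.of_isClosed_subset (isCompact_Icc (a := ((-G, -F) : ℝ × ℝ)) (b := (G, F)))
    ?_ ?_
  · exact (h.isClosed_setOf_mem _).inter ((isClosed_le continuous_const continuous_tilt).inter
      (isClosed_le continuous_tilt continuous_const))
  · rintro p ⟨hp, h1, h2⟩
    have hep := hE p h1 h2
    have hp2 := hF p hp hep
    have hp1 : |p.1| ≤ G := by
      have : p.1 = e p - (κ a + κ b) * p.2 := by simp only [e]; ring
      rw [this]
      refine (abs_sub _ _).trans (add_le_add hep ?_)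
      rw [abs_mul]
      exact mul_le_mul_of_nonneg_left hp2 (abs_nonneg _)
    rw [abs_le] at hp1 hp2
    exact ⟨⟨hp1.1, hp2.1⟩, ⟨hp1.2, hp2.2⟩⟩

/-- Points of the region of `{a, b}` where `tilt` is very negative are of the `a`-kind after a
push; if there are none, a point with minimal `tilt` is of the `a`-kind after a push. -/
theorem IsPlot.exists_aKind (h : IsPlot κ c D) (hκ : StrictMono κ) {a b : Fin n} {ε : ℝ}
    (hε : ε ≠ 0) {p₀ : ℝ × ℝ} (hp₀ : {a, b} ∈ D p₀)
    (hM : ∃ q, ∃ M ∈ D q, slope κ {a, b} (upDir κ ε a b) < slope κ M (upDir κ ε a b)) :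
    ∃ p, {a, b} ∈ D p ∧ AKind κ D ε a b p := by
  have hab := h.ne_of_pair_mem hp₀
  obtain ⟨τ, -, hτ⟩ := h.exists_push hM
  set m : ℝ := ∑ x, |c {b, x} - c {a, x}| with hm
  by_cases h1 : ∃ p, {a, b} ∈ D p ∧ tilt κ a b p < -m
  · obtain ⟨p, hp, hpm⟩ := h1
    obtain ⟨-, hI, M, hMq, hlt⟩ := hτ p hp
    rcases h.kind_of_slope_lt hI hMq hlt with hk | ⟨x, hx, hxD⟩
    · exact ⟨_, hI, hk⟩
    · exfalso
      rw [rise_comm] at hx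
      obtain ⟨hxa, hxb⟩ := ne_of_rise_pos hx
      have h2 := h.le _ _ hxD {a, x} (Finset.card_pair hxa.symm)
      have h3 := affineTerm_sub_eq_tilt (κ := κ) (c := c) hxa hxb (p + τ p • upDir κ ε a b)
      rw [tilt_add_smul_upDir] at h3
      have h4 : |c {b, x} - c {a, x}| ≤ m :=
        Finset.single_le_sum (f := fun x => |c {b, x} - c {a, x}|)
          (fun _ _ => abs_nonneg _) (Finset.mem_univ x)
      have h5 := le_abs_self (c {b, x} - c {a, x})
      linarith
  push Not at h1
  obtain ⟨x, hx⟩ : ∃ x, 0 < rise κ ε a b x := by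
    obtain ⟨-, hI, M, hMq, hlt⟩ := hτ p₀ hp₀
    rcases h.kind_of_slope_lt hI hMq hlt with ⟨x, hx, -⟩ | ⟨x, hx, -⟩
    · exact ⟨x, hx⟩
    · exact ⟨x, rise_comm ▸ hx⟩
  by_cases h2 : ∃ z, rise κ ε a b z < 0
  swap
  · exfalso
    push Not at h2
    have hslope : ∀ M : Finset (Fin n), M.card = 2 → M ≠ {a, b} →
        slope κ M (-upDir κ ε a b) < slope κ {a, b} (-upDir κ ε a b) := by
      intro M hM hMne
      obtain ⟨i, j, hij, rfl⟩ := Finset.card_eq_two.1 hM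
      have h3 : ∀ I, slope κ I (-upDir κ ε a b) = -slope κ I (upDir κ ε a b) := fun I => by
        rw [← neg_one_smul ℝ, slope_smul]; ring
      rw [h3, h3, slope_upDir hab hij]
      have hi := h2 i
      have hj := h2 j
      have hne : (i ≠ a ∧ i ≠ b) ∨ (j ≠ a ∧ j ≠ b) := by
        by_contra hcon
        apply hMne
        grind
      rcases hne with ⟨n1, n2⟩ | ⟨n1, n2⟩
      · have := lt_of_le_of_ne hi (rise_ne_zero hκ hε n1 n2).symm; linarith
      · have := lt_of_le_of_ne hj (rise_ne_zero hκ hε n1 n2).symm; linarith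
    have hd : κ b - κ a ≠ 0 := sub_ne_zero.2 (hκ.injective.ne hab.symm)
    obtain ⟨s, -, hs⟩ := h.exists_mem_of_slope_lt ((-m - 1) / (κ b - κ a), 0)
      (Finset.card_pair hab) hslope
    have h3 := h1 _ hs
    rw [smul_neg, ← neg_smul, tilt_add_smul_upDir, tilt] at h3
    simp only [mul_zero, add_zero, mul_div_cancel₀ _ hd] at h3
    linarith
  obtain ⟨z, hz⟩ := h2
  obtain ⟨p, ⟨hp, -, -⟩, hmin⟩ := (h.isCompact_strip (hκ.injective.ne hab) hx hz (-m)
    (tilt κ a b p₀)).exists_isMinOn ⟨p₀, hp₀, h1 p₀ hp₀, le_rfl⟩ continuous_tilt.continuousOn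
  have hmin' : ∀ q, {a, b} ∈ D q → tilt κ a b p ≤ tilt κ a b q := by
    intro q hq
    rcases le_total (tilt κ a b q) (tilt κ a b p₀) with h3 | h3
    · exact hmin ⟨hq, h1 q hq, h3⟩
    · exact le_trans (hmin ⟨hp₀, h1 p₀ hp₀, le_rfl⟩) h3
  obtain ⟨-, hI, M, hMq, hlt⟩ := hτ p hp
  rcases h.kind_of_slope_lt hI hMq hlt with hk | ⟨x, hx, hxD⟩
  · exact ⟨_, hI, hk⟩
  by_contra hcon
  have hna : ¬ AKind κ D ε a b (p + τ p • upDir κ ε a b) := fun hk => hcon ⟨_, hI, hk⟩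
  have hd := sub_ne_zero.2 (hκ.injective.ne hab.symm)
  -- in the direction `(2 κ_a, -1)` all labels `{b, y}` are falling with respect to `{a, b}`
  have hle : ∀ N ∈ D (p + τ p • upDir κ ε a b),
      slope κ N (2 * κ a, -1) ≤ slope κ {a, b} (2 * κ a, -1) := by
    intro N hN
    rcases eq_or_ne N {a, b} with rfl | hNe
    · exact le_rfl
    obtain ⟨y, hya, hyb, rfl | rfl⟩ := h.eq_pair_of_mem hI hN hNe
    · exfalso
      rw [rise_comm] at hx
      obtain ⟨hxa, hxb⟩ := ne_of_rise_pos hx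
      obtain rfl : x = y := by
        by_contra hxy
        exact h.not_mem_of_disjoint hab hyb hxa (Ne.symm hxy) hN hxD
      exact hna ⟨x, hx, hN⟩
    · rw [slope_pair κ hyb.symm, slope_pair κ hab]
      nlinarith [sq_nonneg (κ y - κ a)]
  obtain ⟨s, hs, hsD⟩ := h.exists_mem_of_slope_le hI hle
  have h3 := hmin' _ hsD
  have h4 : tilt κ a b (p + τ p • upDir κ ε a b + s • (2 * κ a, -1)) =
      tilt κ a b (p + τ p • upDir κ ε a b) - s * (κ b - κ a) ^ 2 := by
    simp only [tilt, Prod.fst_add, Prod.snd_add, Prod.smul_fst, Prod.smul_snd, smul_eq_mul]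
    ring
  rw [h4, tilt_add_smul_upDir] at h3
  have := mul_pos hs (sq_pos_of_ne_zero hd)
  linarith

theorem IsPlot.eq_of_aKind (h : IsPlot κ c D) {a b x y : Fin n} {ε : ℝ} {p : ℝ × ℝ}
    (hx : 0 < rise κ ε a b x) (hxD : {a, x} ∈ D p) (hy : 0 < rise κ ε b a y)
    (hyD : {b, y} ∈ D p) (hab : a ≠ b) : x = y := by
  obtain ⟨hxa, hxb⟩ := ne_of_rise_pos hx
  obtain ⟨hyb, hya⟩ := ne_of_rise_pos hy
  by_contra hxy
  exact h.not_mem_of_disjoint hab hxb hya hxy hxD hyD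

theorem IsPlot.isClosed_aKind (h : IsPlot κ c D) (a b : Fin n) (ε : ℝ) :
    IsClosed {p | AKind κ D ε a b p} := by
  have : {p | AKind κ D ε a b p} =
      ⋃ x : {x // 0 < rise κ ε a b x}, {p | {a, x.1} ∈ D p} := by
    ext p
    simp [AKind]
  rw [this]
  exact isClosed_iUnion_of_finite fun x => h.isClosed_setOf_mem _

/-- The boundary of the region of `{a, b}` in the direction `upDir` is connected; it contains
points of both kinds, hence a point where the kind changes. -/
theorem IsPlot.exists_triple (h : IsPlot κ c D) (hκ : StrictMono κ) {a b : Fin n} {ε : ℝ}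
    (hε : ε ≠ 0) {p₀ : ℝ × ℝ} (hp₀ : {a, b} ∈ D p₀)
    (hM : ∃ q, ∃ M ∈ D q, slope κ {a, b} (upDir κ ε a b) < slope κ M (upDir κ ε a b)) :
    ∃ x p, 0 < rise κ ε a b x ∧ {a, b} ∈ D p ∧ {a, x} ∈ D p ∧ {b, x} ∈ D p := by
  have hab := h.ne_of_pair_mem hp₀
  obtain ⟨p₁, hp₁, hk₁⟩ := h.exists_aKind hκ hε hp₀ hM
  obtain ⟨p₂, hp₂, hk₂⟩ := h.exists_aKind hκ hε (a := b) (b := a)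
    (by rwa [Finset.pair_comm b a]) (by rwa [Finset.pair_comm b a, upDir_comm])
  rw [Finset.pair_comm b a] at hp₂
  obtain ⟨τ, hτc, hτ⟩ := h.exists_push hM
  set w := upDir κ ε a b with hw
  let e : ℝ → ℝ × ℝ := fun t => (p₁ + t • (p₂ - p₁)) + τ (p₁ + t • (p₂ - p₁)) • w
  have hec : Continuous e := by fun_prop
  have hseg : ∀ t ∈ Set.Icc (0 : ℝ) 1, {a, b} ∈ D (p₁ + t • (p₂ - p₁)) := fun t ht =>
    h.mem_segment hp₁ hp₂ ht.1 ht.2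
  have hzero : ∀ p, {a, b} ∈ D p → (AKind κ D ε a b p ∨ AKind κ D ε b a p) → τ p = 0 := by
    intro p hp hk
    obtain ⟨h0, hI, -⟩ := hτ p hp
    refine le_antisymm ?_ h0
    rcases hk with ⟨x, hx, hxD⟩ | ⟨x, hx, hxD⟩
    · exact h.le_zero_of_slope_lt hp hxD (slope_lt_of_rise_pos hab hx) hI
    · refine h.le_zero_of_slope_lt hp hxD ?_ hI
      have := slope_lt_of_rise_pos hab.symm hx
      rwa [upDir_comm, Finset.pair_comm b a] at this
  obtain ⟨t, ht, ⟨x, hx, hxD⟩, ⟨y, hy, hyD⟩⟩ := isPreconnected_closed_iff.1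
    (isPreconnected_Icc (a := (0 : ℝ)) (b := 1)) (e ⁻¹' {p | AKind κ D ε a b p})
    (e ⁻¹' {p | AKind κ D ε b a p}) ((h.isClosed_aKind a b ε).preimage hec)
    ((h.isClosed_aKind b a ε).preimage hec)
    (fun t ht => by
      obtain ⟨-, hI, M, hMD, hlt⟩ := hτ _ (hseg t ht)
      exact h.kind_of_slope_lt hI hMD hlt)
    ⟨0, by simp, by
      have : e 0 = p₁ := by simp [e, hzero p₁ hp₁ (Or.inl hk₁)]
      simpa only [Set.mem_preimage, Set.mem_ofPred_eq, this] using hk₁⟩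
    ⟨1, by simp, by
      have : e 1 = p₂ := by simp [e, hzero p₂ hp₂ (Or.inr hk₂)]
      simpa only [Set.mem_preimage, Set.mem_ofPred_eq, this] using hk₂⟩
  obtain rfl := h.eq_of_aKind hx hxD hy hyD hab
  exact ⟨x, e t, hx, (hτ _ (hseg t ht)).2.1, hxD, hyD⟩

/-- Where the kind changes, it changes from `a` to `b` in the direction in which `tilt` increases.
-/
theorem IsPlot.tilt_change (h : IsPlot κ c D) {a b : Fin n} {ε : ℝ} {q : ℝ × ℝ}
    (hI : {a, b} ∈ D q) (ha : AKind κ D ε a b q) (hb : AKind κ D ε b a q) :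
    ∀ᶠ p in 𝓝 q, (AKind κ D ε a b p → tilt κ a b p ≤ tilt κ a b q) ∧
      (AKind κ D ε b a p → tilt κ a b q ≤ tilt κ a b p) := by
  have hab := h.ne_of_pair_mem hI
  obtain ⟨x, hx, hxD⟩ := ha
  obtain ⟨y, hy, hyD⟩ := hb
  obtain rfl := h.eq_of_aKind hx hxD hy hyD hab
  obtain ⟨hxa, hxb⟩ := ne_of_rise_pos hx
  have hq := affineTerm_sub_eq_tilt (κ := κ) (c := c) hxa hxb q
  rw [h.eq_of_mem hxD hyD, sub_self] at hq
  filter_upwards [h.eventually_subset q] with p hp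
  have hp' := affineTerm_sub_eq_tilt (κ := κ) (c := c) hxa hxb p
  constructor
  · rintro ⟨z, hz, hzD⟩
    obtain rfl : z = x := h.eq_of_aKind hz (hp hzD) hy hyD hab
    have := h.le p _ hzD {b, z} (Finset.card_pair hxb.symm)
    linarith
  · rintro ⟨z, hz, hzD⟩
    obtain rfl : x = z := h.eq_of_aKind hx hxD hz (hp hzD) hab
    have := h.le p _ hzD {a, x} (Finset.card_pair hxa.symm)
    linarith

/-- Two closed sets that cover the interval and both contain `0` and `1` cannot change places
always in the same sense. -/
theorem not_alternating {A B : Set ℝ} (hA : IsClosed A)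
    (hAB : Set.Icc (0 : ℝ) 1 ⊆ A ∪ B) (hB : IsClosed B) (h0A : (0 : ℝ) ∈ A) (h0B : (0 : ℝ) ∈ B)
    (h1 : (1 : ℝ) ∈ A)
    (hloc : ∀ t ∈ Set.Icc (0 : ℝ) 1, t ∈ A → t ∈ B →
      ∀ᶠ s in 𝓝 t, (s ∈ A → s ≤ t) ∧ (s ∈ B → t ≤ s)) : False := by
  obtain ⟨δ, hδ, hδA⟩ := Metric.eventually_nhds_iff.1 (hloc 0 (by simp) h0A h0B)
  have hsmall : ∀ s, 0 < s → s < δ → s ∉ A := fun s hs hsδ hsA => by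
    have := (hδA (y := s) (by rw [Real.dist_eq, sub_zero, abs_of_pos hs]; exact hsδ)).1 hsA
    linarith
  have hδ1 : δ ≤ 1 := by
    by_contra hcon
    exact hsmall 1 one_pos (by linarith) h1
  -- the first point of `A` after `0`
  obtain ⟨s, ⟨hsA, hsI⟩, hmin⟩ := (isCompact_Icc.inter_left hA).exists_isLeast
    (⟨1, h1, hδ1, le_rfl⟩ : (A ∩ Set.Icc δ 1).Nonempty)
  have hbefore : ∀ t, 0 < t → t < s → t ∈ B := by
    intro t ht hts
    refine (hAB ⟨ht.le, hts.le.trans hsI.2⟩).resolve_left fun htA => ?_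
    rcases lt_or_ge t δ with h2 | h2
    · exact hsmall t ht h2 htA
    · have := hmin ⟨htA, h2, hts.le.trans hsI.2⟩
      linarith
  have hs0 : 0 < s := hδ.trans_le hsI.1
  have hmem : ∀ᶠ t in 𝓝[<] s, t ∈ B := by
    filter_upwards [Ioo_mem_nhdsLT hs0] with t ht
    exact hbefore t ht.1 ht.2
  have hsB : s ∈ B :=
    hB.mem_of_tendsto (f := id) (Filter.tendsto_id.mono_left nhdsWithin_le_nhds) hmem
  have hl := (hloc s ⟨hs0.le, hsI.2⟩ hsA hsB).filter_mono (nhdsWithin_le_nhds (s := Set.Iio s))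
  obtain ⟨t, ht1, ht2, ht3⟩ := (hl.and (hmem.and eventually_mem_nhdsWithin)).exists
  have := ht1.2 ht2
  exact absurd ht3 (not_lt.2 this)

theorem IsPlot.tilt_le_of_triple (h : IsPlot κ c D) {a b : Fin n} {ε : ℝ} {p₁ p₂ : ℝ × ℝ}
    (hp₁ : {a, b} ∈ D p₁) (ha₁ : AKind κ D ε a b p₁) (hb₁ : AKind κ D ε b a p₁)
    (hp₂ : {a, b} ∈ D p₂) (ha₂ : AKind κ D ε a b p₂) : tilt κ a b p₂ ≤ tilt κ a b p₁ := by
  have hab := h.ne_of_pair_mem hp₁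
  by_contra! hlt
  obtain ⟨τ, hτc, hτ⟩ := h.exists_push (I := {a, b}) (w := upDir κ ε a b) (by
    obtain ⟨x, hx, hxD⟩ := ha₁
    exact ⟨p₁, _, hxD, slope_lt_of_rise_pos hab hx⟩)
  set w := upDir κ ε a b with hw
  let e : ℝ → ℝ × ℝ := fun t => (p₁ + t • (p₂ - p₁)) + τ (p₁ + t • (p₂ - p₁)) • w
  have hec : Continuous e := by fun_prop
  have hseg : ∀ t ∈ Set.Icc (0 : ℝ) 1, {a, b} ∈ D (p₁ + t • (p₂ - p₁)) := fun t ht =>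
    h.mem_segment hp₁ hp₂ ht.1 ht.2
  have hzero : ∀ p, {a, b} ∈ D p → AKind κ D ε a b p → τ p = 0 := by
    rintro p hp ⟨x, hx, hxD⟩
    obtain ⟨h0, hI, -⟩ := hτ p hp
    exact le_antisymm (h.le_zero_of_slope_lt hp hxD (slope_lt_of_rise_pos hab hx) hI) h0
  have e0 : e 0 = p₁ := by simp [e, hzero p₁ hp₁ ha₁]
  have e1 : e 1 = p₂ := by simp [e, hzero p₂ hp₂ ha₂]
  have htilt : ∀ t, tilt κ a b (e t) = tilt κ a b p₁ + t * (tilt κ a b p₂ - tilt κ a b p₁) := by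
    intro t
    simp only [e, hw, tilt_add_smul_upDir]
    simp only [tilt, Prod.fst_add, Prod.snd_add, Prod.smul_fst, Prod.smul_snd, smul_eq_mul,
      Prod.fst_sub, Prod.snd_sub]
    ring
  refine not_alternating ((h.isClosed_aKind a b ε).preimage hec) (fun t ht => ?_)
    ((h.isClosed_aKind b a ε).preimage hec)
    (by simpa only [Set.mem_preimage, Set.mem_ofPred_eq, e0] using ha₁)
    (by simpa only [Set.mem_preimage, Set.mem_ofPred_eq, e0] using hb₁)
    (by simpa only [Set.mem_preimage, Set.mem_ofPred_eq, e1] using ha₂)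
    fun t ht hA hB => ?_
  · obtain ⟨-, hI, M, hMD, hlt⟩ := hτ _ (hseg t ht)
    exact h.kind_of_slope_lt hI hMD hlt
  · filter_upwards [hec.continuousAt.eventually
      (h.tilt_change (hτ _ (hseg t ht)).2.1 hA hB)] with s hs
    rw [htilt, htilt] at hs
    constructor
    · intro hsA
      have := hs.1 hsA
      nlinarith
    · intro hsB
      have := hs.2 hsB
      nlinarith

theorem IsPlot.eq_of_triple (h : IsPlot κ c D) (hκ : StrictMono κ) {a b x y : Fin n} {ε : ℝ}
    (hε : ε ≠ 0) {p₁ p₂ : ℝ × ℝ} (hx : 0 < rise κ ε a b x) (hy : 0 < rise κ ε a b y)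
    (hp₁ : {a, b} ∈ D p₁) (ha₁ : {a, x} ∈ D p₁) (hb₁ : {b, x} ∈ D p₁)
    (hp₂ : {a, b} ∈ D p₂) (ha₂ : {a, y} ∈ D p₂) (hb₂ : {b, y} ∈ D p₂) : x = y := by
  have hab := h.ne_of_pair_mem hp₁
  have hka₁ : AKind κ D ε a b p₁ := ⟨x, hx, ha₁⟩
  have hkb₁ : AKind κ D ε b a p₁ := ⟨x, rise_comm ▸ hx, hb₁⟩
  have hka₂ : AKind κ D ε a b p₂ := ⟨y, hy, ha₂⟩
  have hkb₂ : AKind κ D ε b a p₂ := ⟨y, rise_comm ▸ hy, hb₂⟩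
  have ht := le_antisymm (h.tilt_le_of_triple hp₂ hka₂ hkb₂ hp₁ hka₁)
    (h.tilt_le_of_triple hp₁ hka₁ hkb₁ hp₂ hka₂)
  have hd := sub_ne_zero.2 (hκ.injective.ne hab.symm)
  have hp : p₂ = p₁ + ((p₂.2 - p₁.2) / ε) • upDir κ ε a b := by
    have h1 : p₁.1 + (κ a + κ b) * p₁.2 = p₂.1 + (κ a + κ b) * p₂.2 := by
      apply mul_left_cancel₀ hd
      unfold tilt at ht
      linarith
    ext
    · simp only [upDir, Prod.fst_add, Prod.smul_fst, smul_eq_mul]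
      field_simp
      linarith
    · simp only [upDir, Prod.snd_add, Prod.smul_snd, smul_eq_mul]
      field_simp
      ring
  set s := (p₂.2 - p₁.2) / ε
  have hs1 : s ≤ 0 :=
    h.le_zero_of_slope_lt hp₁ ha₁ (slope_lt_of_rise_pos hab hx) (hp ▸ hp₂)
  have hs2 : -s ≤ 0 := by
    refine h.le_zero_of_slope_lt hp₂ ha₂ (slope_lt_of_rise_pos hab hy) ?_
    rw [hp]
    simpa using hp₁
  have hs : s = 0 := by linarith
  rw [hs, zero_smul, add_zero] at hp
  subst hp
  exact h.eq_of_aKind hx ha₁ (rise_comm ▸ hy) hb₂ hab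

theorem rise_eq_vander (κ : Fin n → ℝ) (a b k : Fin n) :
    rise κ (-(κ b - κ a)) a b k = vander κ a k b := by
  unfold rise vander; ring

/-- If some index lies between `a` and `b`, then the region of `{a, b}` has a vertex of type
`{a, b}`, `{a, x}`, `{b, x}` with `x` between `a` and `b`. -/
theorem IsPlot.exists_triangle (h : IsPlot κ c D) (hn : 3 ≤ n) (hκ : StrictMono κ) {a b : Fin n}
    {p₀ : ℝ × ℝ} (hp₀ : {a, b} ∈ D p₀) (hx : ∃ x, CounterClockwise a x b) :
    ∃ x p, CounterClockwise a x b ∧ {a, b} ∈ D p ∧ {a, x} ∈ D p ∧ {b, x} ∈ D p := by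
  have hab := h.ne_of_pair_mem hp₀
  have hε : -(κ b - κ a) ≠ 0 := neg_ne_zero.2 (sub_ne_zero.2 (hκ.injective.ne hab.symm))
  obtain ⟨s, hs⟩ := exists_follows a
  -- the side of the polygon after `a` is ahead of `{a, b}`
  have hasb : CounterClockwise a s b := by
    obtain ⟨x, hx⟩ := hx
    rw [follows_iff] at hs
    have := s.2; have := a.2; have := x.2; have := b.2
    simp only [CounterClockwise, Fin.lt_def] at *; omega
  obtain ⟨q, hq⟩ := h.exists_mem_side hn hκ hs
  have hr : 0 < rise κ (-(κ b - κ a)) a b s := by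
    rw [rise_eq_vander]; exact (vander_pos_iff hκ).2 hasb
  obtain ⟨x, p, hx, hp⟩ := h.exists_triple hκ hε hp₀ ⟨q, _, hq, slope_lt_of_rise_pos hab hr⟩
  rw [rise_eq_vander] at hx
  exact ⟨x, p, (vander_pos_iff hκ).1 hx, hp⟩

theorem IsPlot.triangle_unique (h : IsPlot κ c D) (hκ : StrictMono κ) {a b x y : Fin n}
    {p q : ℝ × ℝ} (hx : CounterClockwise a x b) (hy : CounterClockwise a y b)
    (hp : {a, b} ∈ D p) (hpa : {a, x} ∈ D p) (hpb : {b, x} ∈ D p)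
    (hq : {a, b} ∈ D q) (hqa : {a, y} ∈ D q) (hqb : {b, y} ∈ D q) : x = y := by
  have hab := h.ne_of_pair_mem hp
  have hε : -(κ b - κ a) ≠ 0 := neg_ne_zero.2 (sub_ne_zero.2 (hκ.injective.ne hab.symm))
  refine h.eq_of_triple hκ hε ?_ ?_ hp hpa hpb hq hqa hqb
  · rw [rise_eq_vander]; exact (vander_pos_iff hκ).2 hx
  · rw [rise_eq_vander]; exact (vander_pos_iff hκ).2 hy

end Arc

/-! ### The triangulation and the graph of a plot -/

section PlotGraph

variable {n : ℕ} {κ : Fin n → ℝ} {c : Finset (Fin n) → ℝ}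
  {D : ℝ × ℝ → Finset (Finset (Fin n))}

theorem exists_eq_erase_of_card {τ I : Finset (Fin n)} (hτ : τ.card = 3) (hI : I ⊆ τ)
    (hI2 : I.card = 2) : ∃ z ∈ τ, I = τ.erase z := by
  obtain ⟨z, hz⟩ : ∃ z, τ \ I = {z} := by
    rw [← Finset.card_eq_one, Finset.card_sdiff_of_subset hI, hτ, hI2]
  have hzm : z ∈ τ \ I := by rw [hz]; simp
  rw [Finset.mem_sdiff] at hzm
  refine ⟨z, hzm.1, Finset.eq_of_subset_of_card_le ?_ ?_⟩
  · intro w hw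
    exact Finset.mem_erase.2 ⟨by rintro rfl; exact hzm.2 hw, hI hw⟩
  · rw [Finset.card_erase_of_mem hzm.1, hτ, hI2]

/-- The labels of the regions of a plot form a triangulation of the polygon; its triangles are
given by the black vertices. -/
theorem IsPlot.isTriangulation (h : IsPlot κ c D) (hn : 3 ≤ n) (hκ : StrictMono κ) :
    IsTriangulation {I | ∃ p, I ∈ D p} ∧ ∀ τ, IsTriangle {I | ∃ p, I ∈ D p} τ ↔
      τ.card = 3 ∧ ∃ p, ∀ I ⊆ τ, I.card = 2 → I ∈ D p := by
  refine isTriangulation_of_unique_triangle hn (fun I ⟨p, hp⟩ => h.card_eq_two p I hp) ?_ ?_ ?_ ?_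
  · rintro _ ⟨i, j, hij, rfl⟩
    exact h.exists_mem_side hn hκ hij
  · rintro τ ⟨hτ, p, hp⟩
    exact ⟨hτ, fun I hI hI2 => ⟨p, hp I hI hI2⟩⟩
  · rintro a b ⟨p, hp⟩ hx
    obtain ⟨x, q, hx, hab, hax, hbx⟩ := h.exists_triangle hn hκ hp hx
    obtain ⟨n1, n2, n3⟩ := hx.ne
    have h3 : ({a, x, b} : Finset (Fin n)).card = 3 :=
      Finset.card_eq_three.2 ⟨a, x, b, by tauto, by tauto, by tauto, rfl⟩
    refine ⟨x, hx, h3, q, fun I hI hI2 => ?_⟩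
    obtain ⟨z, hz, rfl⟩ := exists_eq_erase_of_card h3 hI hI2
    obtain ⟨e1, e2, e3⟩ := erase_triple (a := a) (x := x) (y := b) (by tauto) (by tauto) (by tauto)
    simp only [Finset.mem_insert, Finset.mem_singleton] at hz
    rcases hz with rfl | rfl | rfl
    · rwa [e1, Finset.pair_comm]
    · rwa [e2]
    · rwa [e3]
  · rintro a b x y hx hy ⟨-, p, hp⟩ ⟨-, q, hq⟩
    obtain ⟨n1, n2, n3⟩ := hx.ne
    obtain ⟨m1, m2, m3⟩ := hy.ne
    refine h.triangle_unique hκ hx hy (p := p) (q := q) ?_ ?_ ?_ ?_ ?_ ?_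
    · exact hp _ (by grind) (Finset.card_pair (by tauto))
    · exact hp _ (by grind) (Finset.card_pair (by tauto))
    · exact hp _ (by grind) (Finset.card_pair (by tauto))
    · exact hq _ (by grind) (Finset.card_pair (by tauto))
    · exact hq _ (by grind) (Finset.card_pair (by tauto))
    · exact hq _ (by grind) (Finset.card_pair (by tauto))

open Classical in
/-- The description by stars of the graph of a plot. -/
noncomputable def IsPlot.system (h : IsPlot κ c D) : StarSystem n where
  Vertex := {p : ℝ × ℝ // 3 ≤ (D p).card}
  star p := (h.exists_star p.2).choose
  label p := (h.exists_star p.2).choose_spec.choose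
  black p := (h.exists_star p.2).choose_spec.choose = (h.exists_star p.2).choose.erase

theorem IsPlot.system_spec (h : IsPlot κ c D) (p : h.system.Vertex) :
    (h.system.star p).card = 3 ∧ Set.InjOn (h.system.label p) (h.system.star p) ∧
      D p.1 = (h.system.star p).image (h.system.label p) ∧
      ((∃ c, c ∉ h.system.star p ∧ h.system.label p = fun x => {c, x}) ∨
        h.system.label p = (h.system.star p).erase) :=
  (h.exists_star p.2).choose_spec.choose_spec

theorem IsPlot.system_black (h : IsPlot κ c D) (p : h.system.Vertex) :
    h.system.black p ↔ h.system.label p = (h.system.star p).erase := Iff.rfl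

theorem IsPlot.system_half (h : IsPlot κ c D) (hκ : StrictMono κ) (p : h.system.Vertex)
    (I J : Finset (Fin n)) : h.system.Half p I J ↔ HalfAt κ D p.1 I J := by
  obtain ⟨h1, h2, h3, h4⟩ := h.system_spec p
  rw [halfAt_iff hκ h1 h2 h3 (orient_star h4)]
  exact Iff.rfl

theorem HalfAt.three_le {p : ℝ × ℝ} {I J : Finset (Fin n)} (hp : HalfAt κ D p I J) :
    3 ≤ (D p).card := by
  obtain ⟨K, hK, hpos⟩ := hp
  obtain ⟨h1, h2, h3⟩ := orient_ne hpos
  rw [hK, Finset.card_eq_three.2 ⟨I, J, K, h1, h3, h2, rfl⟩]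

/-- The region between the two sides of the polygon at `c` is unbounded. -/
theorem IsPlot.not_halfAt_of_outer (h : IsPlot κ c D) (hn : 3 ≤ n) (hκ : StrictMono κ) {p : ℝ × ℝ}
    {d : Fin n} {I J : Finset (Fin n)} (hd : OuterSidesAt d I J) : ¬ HalfAt κ D p J I := by
  rintro ⟨K, hK, hpos⟩
  obtain ⟨a, b, had, hdb, rfl, rfl⟩ := hd
  have hccw := counterClockwise_of_follows hn had hdb
  obtain ⟨n1, n2, n3⟩ := hccw.ne
  obtain ⟨i, j, hij, rfl⟩ := Finset.card_eq_two.1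
    (h.card_eq_two p K (by rw [hK]; simp))
  rw [Finset.pair_comm a d, orient_pair (by tauto) (by tauto) hij] at hpos
  have key : ∀ k, k ≠ d → vander κ b a k ≤ 0 := by
    intro k hk
    by_contra hcon
    rw [not_le, vander_pos_iff hκ] at hcon
    rw [follows_iff] at had hdb
    have := k.2; have := a.2; have := b.2; have := d.2
    simp only [CounterClockwise, Fin.lt_def, ne_eq, Fin.ext_iff] at *; omega
  have hd : 0 < vander κ b a d := by
    rw [vander_pos_iff hκ]; exact hccw.rotate
  rcases eq_or_ne i d with rfl | hi
  · have := key j hij.symm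
    linarith
  · have h1 := key i hi
    rcases eq_or_ne j d with rfl | hj
    · linarith
    · have := key j hj
      linarith

theorem IsPlot.system_valid (h : IsPlot κ c D) (hn : 3 ≤ n) (hκ : StrictMono κ) :
    h.system.Valid where
  three_le v := (h.system_spec v).1.ge
  injOn v := (h.system_spec v).2.1
  unique v w I J hv hw := by
    rw [h.system_half hκ] at hv hw
    exact Subtype.ext (hv.unique h hw)
  cover v I J hv := by
    rw [h.system_half hκ] at hv
    rcases hv.end h with hr | ⟨q, hq⟩
    · exact Or.inl (h.outerSidesAt_of_ray hn hκ hv hr)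
    · exact Or.inr ⟨⟨q, hq.three_le⟩, (h.system_half hκ ⟨q, hq.three_le⟩ _ _).2 hq⟩
  outer d v I J hd hv := by
    rw [h.system_half hκ] at hv
    exact h.not_halfAt_of_outer hn hκ hd hv

theorem IsPlot.system_refines (h : IsPlot κ c D) (hn : 3 ≤ n) (hκ : StrictMono κ) :
    Refines {I | ∃ p, I ∈ D p} h.system where
  valid := h.system_valid hn hκ
  star_of_black v hv := by
    rw [h.system_black] at hv
    obtain ⟨h1, h2, h3, -⟩ := h.system_spec v
    refine ⟨⟨h1, fun I hI hI2 => ⟨v.1, ?_⟩⟩, hv⟩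
    obtain ⟨z, hz, rfl⟩ := exists_eq_erase_of_card h1 hI hI2
    rw [h3, hv]
    exact Finset.mem_image_of_mem _ hz
  exists_black τ hτ := by
    obtain ⟨hτ3, p, hp⟩ := ((h.isTriangulation hn hκ).2 τ).1 hτ
    have hsub : τ.image τ.erase ⊆ D p := by
      intro I hI
      obtain ⟨z, hz, rfl⟩ := Finset.mem_image.1 hI
      exact hp _ (Finset.erase_subset _ _) (by rw [Finset.card_erase_of_mem hz, hτ3])
    have hinj : Set.InjOn τ.erase τ := fun s hs t _ hst =>
      (Finset.erase_inj _ (by exact_mod_cast hs)).1 hst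
    have hcard : (τ.image τ.erase).card = 3 := by rw [Finset.card_image_of_injOn hinj, hτ3]
    have hDp : 3 ≤ (D p).card := hcard ▸ Finset.card_le_card hsub
    have hD : D p = τ.image τ.erase :=
      (Finset.eq_of_subset_of_card_le hsub (hcard ▸ h.card_le_three p)).symm
    let v : h.system.Vertex := ⟨p, hDp⟩
    obtain ⟨h1, h2, h3, h4⟩ := h.system_spec v
    have hbi : (D p).biUnion id = τ := by
      rw [hD]
      ext z
      simp only [Finset.mem_biUnion, Finset.mem_image, id]
      constructor
      · rintro ⟨_, ⟨y, hy, rfl⟩, hz⟩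
        exact Finset.mem_of_mem_erase hz
      · intro hz
        obtain ⟨y, hy, hyz⟩ := Finset.exists_mem_ne (by omega : 1 < τ.card) z
        exact ⟨_, ⟨y, hy, rfl⟩, Finset.mem_erase.2 ⟨hyz.symm, hz⟩⟩
    -- three chords at a common endpoint have more than three endpoints
    have hb : h.system.label v = (h.system.star v).erase := by
      refine h4.resolve_left ?_
      rintro ⟨d, hd, hl⟩
      have : insert d (h.system.star v) ⊆ τ := by
        rw [← hbi, show D p = _ from h3, hl]
        intro z hz
        simp only [Finset.mem_biUnion, Finset.mem_image, id]
        rcases Finset.mem_insert.1 hz with rfl | hz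
        · obtain ⟨y, hy⟩ := Finset.card_pos.1 (by omega : 0 < (h.system.star v).card)
          exact ⟨_, ⟨y, hy, rfl⟩, by simp⟩
        · exact ⟨_, ⟨z, hz, rfl⟩, by simp⟩
      have := Finset.card_le_card this
      rw [Finset.card_insert_of_notMem hd] at this
      omega
    refine ⟨v, hb, ?_⟩
    rw [← hbi, show D p = _ from h3, hb]
    ext z
    simp only [Finset.mem_biUnion, Finset.mem_image, id]
    constructor
    · intro hz
      obtain ⟨y, hy, hyz⟩ := Finset.exists_mem_ne (by omega : 1 < (h.system.star v).card) z
      exact ⟨_, ⟨y, hy, rfl⟩, Finset.mem_erase.2 ⟨hyz.symm, hz⟩⟩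
    · rintro ⟨_, ⟨y, hy, rfl⟩, hz⟩
      exact Finset.mem_of_mem_erase hz
  white v hv := by
    rw [h.system_black] at hv
    obtain ⟨h1, h2, h3, h4⟩ := h.system_spec v
    obtain ⟨d, hd, hl⟩ := h4.resolve_right hv
    refine ⟨d, hl, fun x hx => mem_nbrs.2 ⟨by rintro rfl; exact hd hx, v.1, ?_⟩⟩
    rw [h3, hl]
    exact Finset.mem_image_of_mem _ hx

theorem IsPlot.finite_vertex (h : IsPlot κ c D) (hκ : StrictMono κ) : Finite h.system.Vertex := by
  refine Finite.of_injective (fun v : h.system.Vertex => D v.1) fun v w hvw => ?_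
  obtain ⟨h1, h2, h3, h4⟩ := h.system_spec v
  obtain ⟨x, hx⟩ := Finset.card_pos.1 (by omega : 0 < (h.system.star v).card)
  obtain ⟨y, hy⟩ := exists_nextIn (by omega : 2 ≤ (h.system.star v).card) hx
  obtain ⟨K, hK, hpos⟩ := (h.system_half hκ v _ _).1 ⟨x, y, hy, rfl, rfl⟩
  exact Subtype.ext (HalfAt.unique h ⟨K, hK, hpos⟩ ⟨K, by rw [← hK]; exact hvw.symm, hpos⟩)

/-- A chord is determined by the sums of the parameters and of their squares. -/
theorem eq_of_sum_eq (hκ : StrictMono κ) {I J : Finset (Fin n)} (hI : I.card = 2) (hJ : J.card = 2)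
    (h1 : ∑ i ∈ I, κ i = ∑ i ∈ J, κ i) (h2 : ∑ i ∈ I, κ i ^ 2 = ∑ i ∈ J, κ i ^ 2) : I = J := by
  obtain ⟨a, b, hab, rfl⟩ := Finset.card_eq_two.1 hI
  obtain ⟨x, y, hxy, rfl⟩ := Finset.card_eq_two.1 hJ
  rw [Finset.sum_pair hab, Finset.sum_pair hxy] at h1 h2
  have key : ∀ s t, s + t = κ x + κ y → s ^ 2 + t ^ 2 = κ x ^ 2 + κ y ^ 2 → s = κ x ∨ s = κ y := by
    intro s t h1 h2
    have : (s - κ x) * (s - κ y) = 0 := by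
      obtain rfl : t = κ x + κ y - s := by linarith
      linear_combination h2 / 2
    rcases mul_eq_zero.1 this with h | h
    · left; linarith
    · right; linarith
  refine Finset.eq_of_subset_of_card_le ?_ (by rw [hI, hJ])
  intro i hi
  simp only [Finset.mem_insert, Finset.mem_singleton] at hi ⊢
  rcases hi with rfl | rfl
  · exact (key _ _ h1 h2).imp (fun h => hκ.injective h) fun h => hκ.injective h
  · exact (key _ (κ a) (by linarith) (by linarith)).imp (fun h => hκ.injective h)
      fun h => hκ.injective h

/-- The line-solitons going down from a vertex are the half-edges across which the sum of the
parameters in the label increases. -/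
theorem IsPlot.down_iff (h : IsPlot κ c D) (hκ : StrictMono κ) {p : ℝ × ℝ} (hp : 3 ≤ (D p).card)
    (e : Finset (Finset (Fin n))) :
    (e.card = 2 ∧ ∃ u : ℝ × ℝ, u.2 < 0 ∧ ∃ ε > 0, ∀ s : ℝ, 0 < s → s < ε →
      D (p + s • u) = e) ↔
    ∃ I J, e = {I, J} ∧ HalfAt κ D p I J ∧ ∑ i ∈ I, κ i < ∑ i ∈ J, κ i := by
  constructor
  · rintro ⟨he, u, hu, ε, hε, hseg⟩
    obtain ⟨I, J, hIJ, rfl⟩ := Finset.card_eq_two.1 he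
    have step : ∀ I J : Finset (Fin n),
        (∀ s : ℝ, 0 < s → s < ε → D (p + s • u) = {I, J}) →
        slope κ I (rotateLeft u) < slope κ J (rotateLeft u) →
        HalfAt κ D p I J ∧ ∑ i ∈ I, κ i < ∑ i ∈ J, κ i := by
      intro I J hseg hlt
      obtain ⟨hh, r, hr, hur⟩ := h.halfAt_of_germ hp hε hseg hlt
      refine ⟨hh, ?_⟩
      rw [hur] at hu
      simp only [edgeDir, Prod.smul_snd, smul_eq_mul] at hu
      by_contra hcon
      nlinarith
    have hne : slope κ I (rotateLeft u) ≠ slope κ J (rotateLeft u) := by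
      intro heq
      obtain ⟨hI, hJ⟩ := h.mem_of_germ hε hseg
      have h1 := h.eq_of_mem hI hJ
      have hq := hseg (ε / 2) (by linarith) (by linarith)
      have h2 := h.eq_of_mem (p := p + (ε / 2) • u) (I := I) (J := J)
        (by rw [hq]; simp) (by rw [hq]; simp)
      rw [affineTerm_add_smul, affineTerm_add_smul, h1, add_right_inj] at h2
      have h3 := mul_left_cancel₀ (by linarith : ε / 2 ≠ 0) h2
      -- a label is determined by its gradient
      refine hIJ (eq_of_sum_eq hκ (h.card_eq_two p I hI) (h.card_eq_two p J hJ) ?_ ?_)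
      all_goals
        simp only [slope, rotateLeft] at heq h3
        have hpos : 0 < u.1 ^ 2 + u.2 ^ 2 := by nlinarith [sq_nonneg u.1]
      · refine sub_eq_zero.1 ((mul_eq_zero.1 ?_).resolve_right hpos.ne')
        linear_combination u.1 * h3 - u.2 * heq
      · refine sub_eq_zero.1 ((mul_eq_zero.1 ?_).resolve_right hpos.ne')
        linear_combination u.2 * h3 + u.1 * heq
    rcases lt_or_gt_of_ne hne with hlt | hlt
    · exact ⟨I, J, rfl, step I J hseg hlt⟩
    · exact ⟨J, I, Finset.pair_comm _ _,
        step J I (fun s h0 h1 => by rw [hseg s h0 h1, Finset.pair_comm]) hlt⟩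
  · rintro ⟨I, J, rfl, hh, hlt⟩
    have hIJ : I ≠ J := by rintro rfl; exact hlt.false
    refine ⟨Finset.card_pair hIJ, edgeDir κ I J, by simp only [edgeDir]; linarith, ?_⟩
    rcases hh.end h with hr | ⟨q, hq⟩
    · exact ⟨1, one_pos, fun s hs _ => hr s hs⟩
    · obtain ⟨⟨s, hs, hs'⟩, hseg⟩ := hh.segment h hq
      refine ⟨s, hs, fun t ht hts => ?_⟩
      have := hseg (t / s) (div_pos ht hs) ((div_lt_one hs).2 hts)
      rwa [hs', smul_smul, div_mul_cancel₀ _ hs.ne'] at this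

theorem nextIn_triple {x y z u v : Fin n} (hxy : x < y) (hyz : y < z) :
    NextIn {x, y, z} u v ↔ (u = x ∧ v = y) ∨ (u = y ∧ v = z) ∨ (u = z ∧ v = x) := by
  unfold NextIn CounterClockwise
  constructor
  · rintro ⟨hu, hv, huv, h⟩
    have h1 := h x (by simp)
    have h2 := h y (by simp)
    have h3 := h z (by simp)
    simp only [Finset.mem_insert, Finset.mem_singleton] at hu hv
    grind
  · rintro (⟨rfl, rfl⟩ | ⟨rfl, rfl⟩ | ⟨rfl, rfl⟩) <;> grind

/-- A vertex is black if and only if exactly one line-soliton goes down from it. -/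
theorem IsPlot.system_black_iff (h : IsPlot κ c D) (hκ : StrictMono κ) (p : h.system.Vertex) :
    h.system.black p ↔ ∃! e : Finset (Finset (Fin n)), e.card = 2 ∧
      ∃ u : ℝ × ℝ, u.2 < 0 ∧ ∃ ε > 0, ∀ s : ℝ, 0 < s → s < ε → D (p.1 + s • u) = e := by
  simp only [h.down_iff hκ p.2, ← h.system_half hκ p]
  obtain ⟨h1, h2, -, h4⟩ := h.system_spec p
  rw [h.system_black]
  unfold StarSystem.Half
  generalize h.system.label p = g at *
  generalize h.system.star p = S at *
  obtain ⟨x, y, z, hxy, hyz, rfl⟩ := exists_eq_triple_of_card_eq_three h1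
  simp only [nextIn_triple hxy hyz]
  have hκxy := hκ hxy
  have hκyz := hκ hyz
  have hxz := hxy.trans hyz
  constructor
  · rintro rfl
    obtain ⟨e1, e2, e3⟩ := erase_triple hxy.ne hxz.ne hyz.ne
    refine ⟨{{x, y}, {y, z}}, ⟨{x, y}, {y, z}, rfl, ⟨z, x, by simp, e3, e1⟩, ?_⟩, ?_⟩
    · rw [Finset.sum_pair hxy.ne, Finset.sum_pair hyz.ne]; linarith
    · rintro _ ⟨_, _, rfl, ⟨u, v, huv, rfl, rfl⟩, hlt⟩
      rcases huv with ⟨rfl, rfl⟩ | ⟨rfl, rfl⟩ | ⟨rfl, rfl⟩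
      · rw [e1, e2, Finset.sum_pair hxz.ne, Finset.sum_pair hyz.ne] at hlt; linarith
      · rw [e2, e3, Finset.sum_pair hxz.ne, Finset.sum_pair hxy.ne] at hlt; linarith
      · rw [e1, e3]
  · rintro ⟨e, -, huniq⟩
    refine h4.resolve_left ?_
    rintro ⟨d, hd, rfl⟩
    simp only [Finset.mem_insert, Finset.mem_singleton, not_or] at hd
    obtain ⟨hdx, hdy, hdz⟩ := hd
    have u1 := huniq {{d, x}, {d, y}} ⟨_, _, rfl, ⟨x, y, by simp, rfl, rfl⟩, by
      rw [Finset.sum_pair hdx, Finset.sum_pair hdy]; linarith⟩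
    have u2 := huniq {{d, y}, {d, z}} ⟨_, _, rfl, ⟨y, z, by simp, rfl, rfl⟩, by
      rw [Finset.sum_pair hdy, Finset.sum_pair hdz]; linarith⟩
    have hmem : ({d, x} : Finset (Fin n)) ∈ ({{d, y}, {d, z}} : Finset (Finset (Fin n))) := by
      rw [u2, ← u1]; simp
    simp only [Finset.mem_insert, Finset.mem_singleton] at hmem
    rcases hmem with hm | hm
    · exact hxy.ne (pair_eq_pair_cancel hm (Ne.symm hdx))
    · exact hxz.ne (pair_eq_pair_cancel hm (Ne.symm hdx))

end PlotGraph

/-! ### Generic contour plots -/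

section Contour

variable {n : ℕ} {κ : Fin n → ℝ} {A : Matrix (Fin 2) (Fin n) ℝ} {t : ℕ → ℝ}

/-- The constant term of `logTerm κ A t I`. -/
noncomputable def constTerm (κ : Fin n → ℝ) (A : Matrix (Fin 2) (Fin n) ℝ) (t : ℕ → ℝ)
    (I : Finset (Fin n)) : ℝ :=
  Real.log (minor A I * vandermondeFactor κ I) +
    ∑ i ∈ I, ∑ m ∈ Finset.Icc 3 n, κ i ^ m * t m

theorem logTerm_eq (κ : Fin n → ℝ) (A : Matrix (Fin 2) (Fin n) ℝ) (t : ℕ → ℝ) :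
    logTerm κ A t = affineTerm κ (constTerm κ A t) := by
  funext I p
  simp only [logTerm, theta, affineTerm, constTerm, Finset.sum_add_distrib, Finset.sum_mul]
  ring

theorem mem_bases (hA : TotallyPositive A) {I : Finset (Fin n)} : I ∈ bases A ↔ I.card = 2 := by
  simp only [bases, Finset.mem_filter, Finset.mem_powersetCard, Finset.subset_univ, true_and]
  exact ⟨fun h => h.1, fun h => ⟨h, (hA I h).ne'⟩⟩

theorem affineTerm_le_tropicalTau (hA : TotallyPositive A) {I : Finset (Fin n)} (hI : I.card = 2)
    (p : ℝ × ℝ) : affineTerm κ (constTerm κ A t) I p ≤ tropicalTau κ A t p := by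
  rw [← logTerm_eq]
  exact le_ciSup (f := fun I : {I // I ∈ bases A} => logTerm κ A t I.1 p)
    (Set.finite_range _).bddAbove ⟨I, (mem_bases hA).2 hI⟩

theorem exists_eq_tropicalTau (hn : 3 ≤ n) (hA : TotallyPositive A) (p : ℝ × ℝ) :
    ∃ I : Finset (Fin n), I.card = 2 ∧
      affineTerm κ (constTerm κ A t) I p = tropicalTau κ A t p := by
  have : Nonempty {I : Finset (Fin n) // I ∈ bases A} :=
    ⟨{⟨0, by omega⟩, ⟨1, by omega⟩}, (mem_bases hA).2 (Finset.card_pair (by simp [Fin.ext_iff]))⟩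
  obtain ⟨I, hI⟩ := exists_eq_ciSup_of_finite
    (f := fun I : {I : Finset (Fin n) // I ∈ bases A} => logTerm κ A t I.1 p)
  exact ⟨I.1, (mem_bases hA).1 I.2, by rw [← logTerm_eq]; exact hI⟩

theorem mem_dominant (hn : 3 ≤ n) (hA : TotallyPositive A) {p : ℝ × ℝ} {I : Finset (Fin n)} :
    I ∈ dominant κ A t p ↔ I.card = 2 ∧ ∀ J : Finset (Fin n), J.card = 2 →
      affineTerm κ (constTerm κ A t) J p ≤ affineTerm κ (constTerm κ A t) I p := by
  simp only [dominant, Finset.mem_filter, mem_bases hA, logTerm_eq]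
  refine and_congr_right fun hI =>
    ⟨fun h J hJ => h ▸ affineTerm_le_tropicalTau hA hJ p, fun h => ?_⟩
  obtain ⟨J, hJ, hJe⟩ := exists_eq_tropicalTau (κ := κ) (t := t) hn hA p
  exact le_antisymm (affineTerm_le_tropicalTau hA hI p) (hJe ▸ h J hJ)

theorem mem_regionsAt {p : ℝ × ℝ} {I : Finset (Fin n)} :
    I ∈ regionsAt κ A t p ↔ I ∈ dominant κ A t p ∧ ∃ q, dominant κ A t q = {I} := by
  simp only [regionsAt, Finset.mem_filter]
  exact Iff.rfl

theorem affineTerm_eq_tropicalTau {p : ℝ × ℝ} {I : Finset (Fin n)} (hI : I ∈ dominant κ A t p) :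
    affineTerm κ (constTerm κ A t) I p = tropicalTau κ A t p := by
  rw [← logTerm_eq]
  exact (Finset.mem_filter.1 hI).2

/-- Near `p`, only the terms that are dominant at `p` can be dominant. -/
theorem eventually_dominant_subset (hn : 3 ≤ n) (hA : TotallyPositive A) (p : ℝ × ℝ) :
    ∀ᶠ q in 𝓝 p, dominant κ A t q ⊆ dominant κ A t p := by
  have : ∀ᶠ q in 𝓝 p, ∀ M, M ∈ dominant κ A t q → M ∈ dominant κ A t p := by
    rw [Filter.eventually_all]
    intro M
    by_cases hM : M ∈ dominant κ A t p
    · exact Filter.Eventually.of_forall fun _ _ => hM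
    by_cases hM2 : M.card = 2
    swap
    · exact Filter.Eventually.of_forall fun q hq => absurd ((mem_dominant hn hA).1 hq).1 hM2
    rw [mem_dominant hn hA] at hM
    push Not at hM
    obtain ⟨J, hJ, hlt⟩ := hM hM2
    filter_upwards [(continuous_affineTerm _ _ _).continuousAt.eventually_lt
      (continuous_affineTerm _ _ _).continuousAt hlt] with q hq hMq
    exact absurd (((mem_dominant hn hA).1 hMq).2 J hJ) (not_le.2 hq)
  exact this

/-- There is a direction in which all terms have different slopes. -/
theorem exists_slope_injective (hκ : StrictMono κ) :
    ∃ u : ℝ × ℝ, ∀ I J : Finset (Fin n), I.card = 2 → J.card = 2 →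
      slope κ I u = slope κ J u → I = J := by
  classical
  let bad : Finset ℝ := (Finset.univ : Finset (Finset (Fin n) × Finset (Fin n))).image fun x =>
    -((∑ i ∈ x.1, κ i) - ∑ i ∈ x.2, κ i) / ((∑ i ∈ x.1, κ i ^ 2) - ∑ i ∈ x.2, κ i ^ 2)
  obtain ⟨δ, hδ⟩ := Infinite.exists_notMem_finset bad
  refine ⟨(1, δ), fun I J hI hJ heq => ?_⟩
  simp only [slope, mul_one] at heq
  by_cases hB : ∑ i ∈ I, κ i ^ 2 = ∑ i ∈ J, κ i ^ 2
  · rw [hB, add_left_inj] at heq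
    exact eq_of_sum_eq hκ hI hJ heq hB
  · refine absurd (Finset.mem_image.2 ⟨(I, J), Finset.mem_univ _, ?_⟩) hδ
    rw [div_eq_iff (sub_ne_zero.2 hB)]
    linarith

/-- Every point is in the closure of a region. -/
theorem regionsAt_nonempty (hn : 3 ≤ n) (hκ : StrictMono κ) (hA : TotallyPositive A) (p : ℝ × ℝ) :
    (regionsAt κ A t p).Nonempty := by
  obtain ⟨u, hu⟩ := exists_slope_injective hκ
  obtain ⟨J, hJ, hJe⟩ := exists_eq_tropicalTau (κ := κ) (t := t) hn hA p
  have hne : (dominant κ A t p).Nonempty := by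
    refine ⟨J, (mem_dominant hn hA).2 ⟨hJ, fun M hM => ?_⟩⟩
    rw [hJe]
    exact affineTerm_le_tropicalTau hA hM p
  obtain ⟨I, hI, hmax⟩ := (dominant κ A t p).exists_max_image (fun M => slope κ M u) hne
  obtain ⟨s, hs, hs0⟩ := (((tendsto_add_smul p u).eventually
    (eventually_dominant_subset (κ := κ) (t := t) hn hA p)).and eventually_mem_nhdsWithin).exists
  have hs0' : 0 < s := hs0
  obtain ⟨hI2, hIle⟩ := (mem_dominant hn hA).1 hI
  refine ⟨I, mem_regionsAt.2 ⟨hI, p + s • u, ?_⟩⟩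
  obtain ⟨M, hM, hMe⟩ := exists_eq_tropicalTau (κ := κ) (t := t) hn hA (p + s • u)
  have hMd : M ∈ dominant κ A t (p + s • u) := by
    refine (mem_dominant hn hA).2 ⟨hM, fun N hN => ?_⟩
    rw [hMe]
    exact affineTerm_le_tropicalTau hA hN _
  have key : ∀ N ∈ dominant κ A t (p + s • u), N = I := by
    intro N hN
    have h1 := hs hN
    obtain ⟨h2, h3⟩ := (mem_dominant hn hA).1 hN
    obtain ⟨-, h4⟩ := (mem_dominant hn hA).1 h1
    have h5 := h3 I hI2
    rw [affineTerm_add_smul, affineTerm_add_smul, le_antisymm (h4 I hI2) (hIle N h2)] at h5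
    have h6 : slope κ I u ≤ slope κ N u := by
      by_contra hcon
      nlinarith
    exact hu N I h2 hI2 (le_antisymm (hmax N h1) h6)
  exact Finset.eq_singleton_iff_unique_mem.2 ⟨key M hMd ▸ hMd, key⟩

/-- Outside the contour plot, all dominant terms have the gradient of `f_A`. -/
theorem eq_of_notMem_contourPlot (hn : 3 ≤ n) (hκ : StrictMono κ) (hA : TotallyPositive A)
    {p : ℝ × ℝ} (hp : p ∉ contourPlot κ A t) {I J : Finset (Fin n)} (hI : I ∈ dominant κ A t p)
    (hJ : J ∈ dominant κ A t p) : I = J := by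
  obtain ⟨a, b, d, hev⟩ := not_not.1 hp
  have grad : ∀ I ∈ dominant κ A t p, ∑ i ∈ I, κ i = a ∧ ∑ i ∈ I, κ i ^ 2 = b := by
    intro I hI
    obtain ⟨hI2, -⟩ := (mem_dominant hn hA).1 hI
    have hIp := affineTerm_eq_tropicalTau hI
    have hpp := hev.self_of_nhds
    have dir : ∀ u : ℝ × ℝ, slope κ I u ≤ a * u.1 + b * u.2 := by
      intro u
      obtain ⟨s, hs, hs0⟩ := (((tendsto_add_smul p u).eventually hev).and
        eventually_mem_nhdsWithin).exists
      have hs0' : 0 < s := hs0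
      have h1 := affineTerm_le_tropicalTau (κ := κ) (t := t) hA hI2 (p + s • u)
      rw [hs, affineTerm_add_smul, hIp, hpp] at h1
      simp only [Prod.fst_add, Prod.snd_add, Prod.smul_fst, Prod.smul_snd, smul_eq_mul] at h1
      by_contra hcon
      nlinarith
    have h1 := dir (1, 0)
    have h2 := dir (-1, 0)
    have h3 := dir (0, 1)
    have h4 := dir (0, -1)
    simp only [slope] at h1 h2 h3 h4
    constructor <;> linarith
  obtain ⟨h1, h2⟩ := grad I hI
  obtain ⟨h3, h4⟩ := grad J hJ
  exact eq_of_sum_eq hκ ((mem_dominant hn hA).1 hI).1 ((mem_dominant hn hA).1 hJ).1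
    (h1.trans h3.symm) (h2.trans h4.symm)

/-- A generic trivalent contour plot, seen as a subdivision of the plane. -/
theorem IsGenericTrivalent.isPlot (hn : 3 ≤ n) (hκ : StrictMono κ) (hA : TotallyPositive A)
    (hG : IsGenericTrivalent κ A t) : IsPlot κ (constTerm κ A t) (regionsAt κ A t) where
  card_eq_two p I hI := ((mem_dominant hn hA).1 (mem_regionsAt.1 hI).1).1
  le p I hI := ((mem_dominant hn hA).1 (mem_regionsAt.1 hI).1).2
  nonempty := regionsAt_nonempty hn hκ hA
  mem p q I hI hle := by
    obtain ⟨h1, h2⟩ := mem_regionsAt.1 hI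
    exact mem_regionsAt.2 ⟨(mem_dominant hn hA).2 ⟨((mem_dominant hn hA).1 h1).1, hle⟩, h2⟩
  inter p I hI J hJ hne := by
    by_cases hp : p ∈ contourPlot κ A t
    · have := (hG p hp).2 I hI J hJ hne
      omega
    · exact absurd (eq_of_notMem_contourPlot hn hκ hA hp (mem_regionsAt.1 hI).1
        (mem_regionsAt.1 hJ).1) hne
  card_le_three p := by
    by_cases hp : p ∈ contourPlot κ A t
    · rcases (hG p hp).1 with h | h <;> omega
    · have : (regionsAt κ A t p).card ≤ 1 := Finset.card_le_one.2 fun I hI J hJ =>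
        eq_of_notMem_contourPlot hn hκ hA hp (mem_regionsAt.1 hI).1 (mem_regionsAt.1 hJ).1
      omega

/-- Conversely, a contour plot is generic and trivalent as soon as at most three terms whose
labels pairwise intersect are dominant at every point. -/
theorem isGenericTrivalent_of_dominant (hn : 3 ≤ n) (hκ : StrictMono κ) (hA : TotallyPositive A)
    (h3 : ∀ p, (dominant κ A t p).card ≤ 3)
    (hinter : ∀ p, ∀ I ∈ dominant κ A t p, ∀ J ∈ dominant κ A t p, I ≠ J → (I ∩ J).card = 1) :
    IsGenericTrivalent κ A t := by
  intro p hp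
  refine ⟨?_, fun I hI J hJ hne => ?_⟩
  · have hle : (regionsAt κ A t p).card ≤ 3 :=
      (Finset.card_le_card fun I hI => (mem_regionsAt.1 hI).1).trans (h3 p)
    have h2 : ¬ (regionsAt κ A t p).card ≤ 1 := by
      intro h1
      obtain ⟨I, hI⟩ := regionsAt_nonempty (κ := κ) (t := t) hn hκ hA p
      refine hp ⟨∑ i ∈ I, κ i, ∑ i ∈ I, κ i ^ 2, constTerm κ A t I, ?_⟩
      filter_upwards [eventually_dominant_subset (κ := κ) (t := t) hn hA p] with q hq
      obtain ⟨N, hN⟩ := regionsAt_nonempty (κ := κ) (t := t) hn hκ hA q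
      obtain ⟨hNd, hNr⟩ := mem_regionsAt.1 hN
      obtain rfl := Finset.card_le_one.1 h1 N (mem_regionsAt.2 ⟨hq hNd, hNr⟩) I hI
      rw [← affineTerm_eq_tropicalTau hNd, affineTerm]
      ring
    omega
  · rw [hinter p I (mem_regionsAt.1 hI).1 J (mem_regionsAt.1 hJ).1 hne]

/-- The soliton graph is the graph of the plot. -/
theorem solitonGraph_iso (hn : 3 ≤ n) (hκ : StrictMono κ)
    (h : IsPlot κ (constTerm κ A t) (regionsAt κ A t)) :
    DiskGraph.Iso (solitonGraph κ A t) h.system.graph := by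
  refine ⟨Equiv.refl _, fun v => h.system_black_iff hκ v, fun v w I J => ?_, fun v I J => ?_⟩
  · have := h.edge_iff v.2 w.2 I J
    rw [← h.system_half hκ v, ← h.system_half hκ w, ← logTerm_eq] at this
    refine Iff.trans this.symm ?_
    refine and_congr_left fun _ => ?_
    exact not_congr Subtype.ext_iff.symm
  · have h1 := h.ray_iff v.2 I J
    rw [← logTerm_eq] at h1
    refine Iff.trans ?_ h1.symm
    refine Iff.trans (and_congr (h.system_half hκ v I J) Iff.rfl) ?_
    refine and_congr_right fun hv => ⟨?_, h.outerSidesAt_of_ray hn hκ hv⟩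
    rintro ⟨d, hd⟩
    refine (hv.end h).resolve_right ?_
    rintro ⟨q, hq⟩
    exact h.not_halfAt_of_outer hn hκ hd hq

/-- The soliton graph of a generic trivalent plot belongs to the triangulation given by the labels
of its regions. -/
theorem IsGenericTrivalent.exists_triangulation (hn : 3 ≤ n) (hκ : StrictMono κ)
    (hA : TotallyPositive A) (hG : IsGenericTrivalent κ A t) :
    IsTriangulation {I | ∃ p, I ∈ regionsAt κ A t p} ∧
      DiskGraph.M2Equiv (solitonGraph κ A t) (Psi {I | ∃ p, I ∈ regionsAt κ A t p}) := by
  have h := hG.isPlot hn hκ hA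
  have hT := (h.isTriangulation hn hκ).1
  refine ⟨hT, ?_⟩
  exact Relation.EqvGen.trans _ _ _ (Relation.EqvGen.rel _ _ (Or.inl (solitonGraph_iso hn hκ h)))
    (Refines.m2Equiv hn hT _ h.system (h.finite_vertex hκ) rfl (h.system_refines hn hκ))

end Contour

/-! ### Third differences that detect crossings -/

section ThirdDifference

variable {n : ℕ} {κ : Fin n → ℝ}

/-- A multiple, with positive weights at `a`, `c` and negative weights at `b`, `d`, of the third
divided difference of `g` at the nodes `κ_a < κ_b < κ_c < κ_d`. -/
def quadDiff (κ g : Fin n → ℝ) (a b c d : Fin n) : ℝ :=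
  vander κ b c d * g a - vander κ a c d * g b + vander κ a b d * g c - vander κ a b c * g d

/-- The sum of the positive weights in `quadDiff`; it is also the sum of the negative ones. -/
def quadWeight (κ : Fin n → ℝ) (a b c d : Fin n) : ℝ := vander κ b c d + vander κ a b d

theorem quadDiff_add_quadratic (g : Fin n → ℝ) (α β γ : ℝ) (a b c d : Fin n) :
    quadDiff κ (fun i => g i + (α + β * κ i + γ * κ i ^ 2)) a b c d = quadDiff κ g a b c d := by
  unfold quadDiff vander; ring

theorem quadDiff_smul (g : Fin n → ℝ) (s : ℝ) (a b c d : Fin n) :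
    quadDiff κ (fun i => s * g i) a b c d = s * quadDiff κ g a b c d := by
  unfold quadDiff; ring

theorem vander_pos (hκ : StrictMono κ) {a b c : Fin n} (hab : a < b) (hbc : b < c) :
    0 < vander κ a b c := (vander_pos_iff hκ).2 (Or.inl ⟨hab, hbc⟩)

/-- If the values at `a` and `c` are nearly the largest ones, the third difference is nearly
nonnegative. -/
theorem neg_le_quadDiff (hκ : StrictMono κ) {a b c d : Fin n} (hab : a < b) (hbc : b < c)
    (hcd : c < d) {x : Fin n → ℝ} {K : ℝ} (h1 : x b ≤ x a + K) (h2 : x d ≤ x a + K)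
    (h3 : x b ≤ x c + K) (h4 : x d ≤ x c + K) :
    -(K * quadWeight κ a b c d) ≤ quadDiff κ x a b c d := by
  have wa := vander_pos hκ hbc hcd
  have wb := vander_pos hκ (hab.trans hbc) hcd
  have wc := vander_pos hκ hab (hbc.trans hcd)
  have wd := vander_pos hκ hab hbc
  have hsum : vander κ b c d + vander κ a b d = vander κ a c d + vander κ a b c := by
    unfold vander; ring
  have e1 : max (x b) (x d) - K ≤ x a := by
    have := max_le h1 h2; linarith
  have e2 : max (x b) (x d) - K ≤ x c := by
    have := max_le h3 h4; linarith
  have hb := mul_le_mul_of_nonneg_left (le_max_left (x b) (x d)) wb.le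
  have hd := mul_le_mul_of_nonneg_left (le_max_right (x b) (x d)) wd.le
  have ha := mul_le_mul_of_nonneg_left e1 wa.le
  have hc := mul_le_mul_of_nonneg_left e2 wc.le
  have hm := congrArg (fun s => s * max (x b) (x d)) hsum
  unfold quadDiff quadWeight
  linarith

theorem quadDiff_le (hκ : StrictMono κ) {a b c d : Fin n} (hab : a < b) (hbc : b < c)
    (hcd : c < d) {x : Fin n → ℝ} {K : ℝ} (h1 : x a ≤ x b + K) (h2 : x c ≤ x b + K)
    (h3 : x a ≤ x d + K) (h4 : x c ≤ x d + K) :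
    quadDiff κ x a b c d ≤ K * quadWeight κ a b c d := by
  have h := neg_le_quadDiff hκ hab hbc hcd (x := fun i => (-1) * x i) (K := K)
    (by linarith) (by linarith) (by linarith) (by linarith)
  rw [quadDiff_smul] at h
  linarith

/-- The negative part of the polynomial with zeros at the ends of the chord `e`, at the node `κ_i`.
-/
noncomputable def fold (κ : Fin n → ℝ) (e : Finset (Fin n)) (i : Fin n) : ℝ :=
  min 0 (∏ a ∈ e, (κ i - κ a))

theorem fold_nonpos (e : Finset (Fin n)) (i : Fin n) : fold κ e i ≤ 0 := min_le_left _ _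

theorem fold_le {p q : Fin n} (hpq : p < q) (i : Fin n) :
    fold κ {p, q} i ≤ (κ i - κ p) * (κ i - κ q) := by
  unfold fold
  rw [Finset.prod_pair hpq.ne]
  exact min_le_right _ _

theorem fold_of_mem (hκ : StrictMono κ) {p q i : Fin n} (hpq : p < q) (hp : p ≤ i) (hq : i ≤ q) :
    fold κ {p, q} i = (κ i - κ p) * (κ i - κ q) := by
  unfold fold
  rw [Finset.prod_pair hpq.ne]
  exact min_eq_right (mul_nonpos_of_nonneg_of_nonpos (sub_nonneg.2 (hκ.monotone hp))
    (sub_nonpos.2 (hκ.monotone hq)))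

theorem fold_of_le (hκ : StrictMono κ) {p q i : Fin n} (hpq : p < q) (hp : i ≤ p) :
    fold κ {p, q} i = 0 := by
  unfold fold
  rw [Finset.prod_pair hpq.ne]
  exact min_eq_left (mul_nonneg_of_nonpos_of_nonpos (sub_nonpos.2 (hκ.monotone hp))
    (sub_nonpos.2 (hκ.monotone (hp.trans hpq.le))))

theorem fold_of_ge (hκ : StrictMono κ) {p q i : Fin n} (hpq : p < q) (hq : q ≤ i) :
    fold κ {p, q} i = 0 := by
  unfold fold
  rw [Finset.prod_pair hpq.ne]
  exact min_eq_left (mul_nonneg (sub_nonneg.2 (hκ.monotone (hpq.le.trans hq)))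
    (sub_nonneg.2 (hκ.monotone hq)))

theorem not_crossing_cases {p q a c : Fin n} (hpq : p < q)
    (h : ¬ Crossing {p, q} {a, c}) :
    (a ≤ p ∧ q ≤ c) ∨ q ≤ a ∨ c ≤ p ∨ (p ≤ a ∧ c ≤ q) := by
  by_contra! hcon
  obtain ⟨h1, h2, h3, h4⟩ := hcon
  apply h
  rcases lt_or_ge p a with h5 | h5
  · exact ⟨p, a, q, c, h5, h2, h4 h5.le, Or.inl ⟨rfl, rfl⟩⟩
  · rcases eq_or_lt_of_le h5 with rfl | h6
    · exact absurd (h4 le_rfl) (not_lt.2 (h1 le_rfl).le)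
    · exact ⟨a, p, c, q, h6, h3, h1 h5, Or.inr ⟨rfl, rfl⟩⟩

/-- The third difference of `fold κ {p, q}` across a chord `{a, c}` that does not cross
`{p, q}`. -/
theorem quadDiff_fold_nonneg (hκ : StrictMono κ) {p q a b c d : Fin n} (hpq : p < q) (hab : a < b)
    (hbc : b < c) (hcd : c < d) (h : ¬ Crossing {p, q} {a, c}) :
    0 ≤ quadDiff κ (fold κ {p, q}) a b c d := by
  have hac := hab.trans hbc
  have wb := vander_pos hκ hac hcd
  have wd := vander_pos hκ hab hbc
  have fb := mul_nonneg wb.le (neg_nonneg.2 (fold_nonpos (κ := κ) {p, q} b))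
  have fd := mul_nonneg wd.le (neg_nonneg.2 (fold_nonpos (κ := κ) {p, q} d))
  rcases not_crossing_cases hpq h with ⟨h1, h2⟩ | h1 | h1 | ⟨h1, h2⟩
  · rw [quadDiff, fold_of_le hκ hpq h1, fold_of_ge hκ hpq h2]
    linarith
  · rw [quadDiff, fold_of_ge hκ hpq h1, fold_of_ge hκ hpq (h1.trans hac.le)]
    linarith
  · rw [quadDiff, fold_of_le hκ hpq h1, fold_of_le hκ hpq (hac.le.trans h1)]
    linarith
  · have e := mul_le_mul_of_nonneg_left (fold_le (κ := κ) hpq d) wd.le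
    rw [quadDiff, fold_of_mem hκ hpq h1 (hac.le.trans h2),
      fold_of_mem hκ hpq (h1.trans hab.le) (hbc.le.trans h2),
      fold_of_mem hκ hpq (h1.trans hac.le) h2]
    -- third differences vanish on quadratic polynomials
    have z : vander κ b c d * ((κ a - κ p) * (κ a - κ q)) -
        vander κ a c d * ((κ b - κ p) * (κ b - κ q)) +
        vander κ a b d * ((κ c - κ p) * (κ c - κ q)) -
        vander κ a b c * ((κ d - κ p) * (κ d - κ q)) = 0 := by
      unfold vander; ring
    linarith

theorem quadDiff_fold_nonpos (hκ : StrictMono κ) {p q a b c d : Fin n} (hpq : p < q) (hab : a < b)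
    (hbc : b < c) (hcd : c < d) (h : ¬ Crossing {p, q} {b, d}) :
    quadDiff κ (fold κ {p, q}) a b c d ≤ 0 := by
  have hbd := hbc.trans hcd
  have wa := vander_pos hκ hbc hcd
  have wc := vander_pos hκ hab hbd
  have fa := mul_nonneg wa.le (neg_nonneg.2 (fold_nonpos (κ := κ) {p, q} a))
  have fc := mul_nonneg wc.le (neg_nonneg.2 (fold_nonpos (κ := κ) {p, q} c))
  rcases not_crossing_cases hpq h with ⟨h1, h2⟩ | h1 | h1 | ⟨h1, h2⟩
  · rw [quadDiff, fold_of_le hκ hpq h1, fold_of_ge hκ hpq h2]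
    linarith
  · rw [quadDiff, fold_of_ge hκ hpq h1, fold_of_ge hκ hpq (h1.trans hbd.le)]
    linarith
  · rw [quadDiff, fold_of_le hκ hpq h1, fold_of_le hκ hpq (hbd.le.trans h1)]
    linarith
  · have e := mul_le_mul_of_nonneg_left (fold_le (κ := κ) hpq a) wa.le
    rw [quadDiff, fold_of_mem hκ hpq h1 (hbd.le.trans h2),
      fold_of_mem hκ hpq (h1.trans hbc.le) (hcd.le.trans h2),
      fold_of_mem hκ hpq (h1.trans hbd.le) h2]
    have z : vander κ b c d * ((κ a - κ p) * (κ a - κ q)) -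
        vander κ a c d * ((κ b - κ p) * (κ b - κ q)) +
        vander κ a b d * ((κ c - κ p) * (κ c - κ q)) -
        vander κ a b c * ((κ d - κ p) * (κ d - κ q)) = 0 := by
      unfold vander; ring
    linarith

theorem quadDiff_sum {ι : Type*} (s : Finset ι) (f : ι → Fin n → ℝ) (a b c d : Fin n) :
    quadDiff κ (fun i => ∑ e ∈ s, f e i) a b c d = ∑ e ∈ s, quadDiff κ (f e) a b c d := by
  simp only [quadDiff, Finset.mul_sum, Finset.sum_add_distrib, Finset.sum_sub_distrib]

/-- The signs of the third differences of a sum of folds along the chords of a triangulation tell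
which one of two crossing chords belongs to the triangulation. -/
theorem exists_quadDiff_sign (hκ : StrictMono κ) {T : Set (Finset (Fin n))}
    (hT : IsTriangulation T) : ∃ h : Fin n → ℝ, ∀ a b c d, a < b → b < c → c < d →
      ({a, c} ∈ T → 0 < quadDiff κ h a b c d) ∧ ({b, d} ∈ T → quadDiff κ h a b c d < 0) := by
  classical
  let s : Finset (Finset (Fin n)) := Finset.univ.filter (· ∈ T)
  have hs : ∀ e, e ∈ s ↔ e ∈ T := fun e => by simp [s]
  refine ⟨fun i => ∑ e ∈ s, fold κ e i, fun a b c d hab hbc hcd => ⟨fun hac => ?_, fun hbd => ?_⟩⟩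
  · rw [quadDiff_sum]
    refine Finset.sum_pos' (fun e he => ?_) ⟨{a, c}, (hs _).2 hac, ?_⟩
    · rw [hs] at he
      obtain ⟨p, q, hpq, rfl⟩ := exists_eq_pair_of_card_eq_two (hT.card_eq_two e he)
      exact quadDiff_fold_nonneg hκ hpq hab hbc hcd (hT.noncrossing _ he _ hac)
    · have hac' := hab.trans hbc
      have wb := vander_pos hκ hac' hcd
      rw [quadDiff, fold_of_le hκ hac' le_rfl, fold_of_ge hκ hac' le_rfl,
        fold_of_ge hκ hac' hcd.le, fold_of_mem hκ hac' hab.le hbc.le]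
      have := mul_pos wb (mul_pos (sub_pos.2 (hκ hab)) (sub_pos.2 (hκ hbc)))
      linarith
  · rw [quadDiff_sum, ← neg_pos, ← Finset.sum_neg_distrib]
    refine Finset.sum_pos' (fun e he => ?_) ⟨{b, d}, (hs _).2 hbd, ?_⟩
    · rw [hs] at he
      obtain ⟨p, q, hpq, rfl⟩ := exists_eq_pair_of_card_eq_two (hT.card_eq_two e he)
      exact neg_nonneg.2 (quadDiff_fold_nonpos hκ hpq hab hbc hcd (hT.noncrossing _ he _ hbd))
    · have hbd' := hbc.trans hcd
      have wc := vander_pos hκ hab hbd'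
      rw [quadDiff, fold_of_le hκ hbd' le_rfl, fold_of_ge hκ hbd' le_rfl,
        fold_of_le hκ hbd' hab.le, fold_of_mem hκ hbd' hbc.le hcd.le]
      have := mul_pos wc (mul_pos (sub_pos.2 (hκ hbc)) (sub_pos.2 (hκ hcd)))
      linarith

/-- After a small cubic perturbation, which makes all third differences nonzero, and scaling, the
third differences are as large as needed. -/
theorem exists_quadDiff_large (hκ : StrictMono κ) {T : Set (Finset (Fin n))}
    (hT : IsTriangulation T) (K : ℝ) : ∃ g : Fin n → ℝ, ∀ a b c d, a < b → b < c → c < d →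
      2 * K * quadWeight κ a b c d < |quadDiff κ g a b c d| ∧
      ({a, c} ∈ T → 0 < quadDiff κ g a b c d) ∧ ({b, d} ∈ T → quadDiff κ g a b c d < 0) := by
  obtain ⟨h, hh⟩ := exists_quadDiff_sign hκ hT
  have hlin : ∀ ε a b c d, quadDiff κ (fun i => h i + ε * κ i ^ 3) a b c d =
      quadDiff κ h a b c d + ε * quadDiff κ (fun i => κ i ^ 3) a b c d := by
    intro ε a b c d
    unfold quadDiff; ring
  obtain ⟨ε, hε⟩ : ∃ ε : ℝ, ∀ a b c d, a < b → b < c → c < d →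
      quadDiff κ (fun i => h i + ε * κ i ^ 3) a b c d ≠ 0 ∧
      ({a, c} ∈ T → 0 < quadDiff κ (fun i => h i + ε * κ i ^ 3) a b c d) ∧
      ({b, d} ∈ T → quadDiff κ (fun i => h i + ε * κ i ^ 3) a b c d < 0) := by
    refine Filter.Eventually.exists (f := 𝓝[>] (0 : ℝ)) ?_
    simp only [Filter.eventually_all]
    intro a b c d hab hbc hcd
    obtain ⟨hac, hbd⟩ := hh a b c d hab hbc hcd
    simp only [hlin]
    have hcont : Filter.Tendsto (fun ε : ℝ => quadDiff κ h a b c d +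
        ε * quadDiff κ (fun i => κ i ^ 3) a b c d) (𝓝[>] 0) (𝓝 (quadDiff κ h a b c d)) := by
      have : Continuous fun ε : ℝ => quadDiff κ h a b c d +
        ε * quadDiff κ (fun i => κ i ^ 3) a b c d := by fun_prop
      have h1 := this.tendsto 0
      simp only [zero_mul, add_zero] at h1
      exact h1.mono_left nhdsWithin_le_nhds
    rcases lt_trichotomy (quadDiff κ h a b c d) 0 with h0 | h0 | h0
    · filter_upwards [hcont.eventually_lt_const h0] with ε hε
      exact ⟨hε.ne, fun hm => absurd (hac hm) h0.not_gt, fun _ => hε⟩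
    · filter_upwards [eventually_mem_nhdsWithin] with ε hε
      have hε' : 0 < ε := hε
      refine ⟨?_, fun hm => absurd h0 (hac hm).ne', fun hm => absurd h0 (hbd hm).ne⟩
      rw [h0, zero_add]
      refine mul_ne_zero hε'.ne' ?_
      have : quadDiff κ (fun i => κ i ^ 3) a b c d =
          -((κ d - κ a) * (κ d - κ b) * (κ d - κ c) * vander κ a b c) := by
        unfold quadDiff vander; ring
      rw [this]
      exact neg_ne_zero.2 (mul_pos (mul_pos (mul_pos (sub_pos.2 (hκ (hab.trans (hbc.trans hcd))))
        (sub_pos.2 (hκ (hbc.trans hcd)))) (sub_pos.2 (hκ hcd))) (vander_pos hκ hab hbc)).ne'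
    · filter_upwards [hcont.eventually_const_lt h0] with ε hε
      exact ⟨hε.ne', fun _ => hε, fun hm => absurd (hbd hm) h0.not_gt⟩
  generalize (fun i => h i + ε * κ i ^ 3) = g at hε
  obtain ⟨M, hM, hM0⟩ : ∃ M : ℝ, (∀ a b c d, a < b → b < c → c < d →
      2 * K * quadWeight κ a b c d < M * |quadDiff κ g a b c d|) ∧ 0 < M := by
    refine Filter.Eventually.exists (f := Filter.atTop) ?_
    refine Filter.Eventually.and ?_ (Filter.eventually_gt_atTop 0)
    simp only [Filter.eventually_all]
    intro a b c d hab hbc hcd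
    have hpos := abs_pos.2 (hε a b c d hab hbc hcd).1
    filter_upwards [Filter.eventually_gt_atTop
      (2 * K * quadWeight κ a b c d / |quadDiff κ g a b c d|)] with M hM
    rwa [div_lt_iff₀ hpos] at hM
  refine ⟨fun i => M * g i, fun a b c d hab hbc hcd => ?_⟩
  obtain ⟨-, h1, h2⟩ := hε a b c d hab hbc hcd
  rw [quadDiff_smul, abs_mul, abs_of_pos hM0]
  exact ⟨hM a b c d hab hbc hcd, fun hm => mul_pos hM0 (h1 hm),
    fun hm => mul_neg_of_pos_of_neg hM0 (h2 hm)⟩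

end ThirdDifference

/-! ### Realization of a given triangulation -/

section Realization

variable {n : ℕ} {κ : Fin n → ℝ}

/-- The third differences of `g` are large, and their signs prefer the chords of `T` to those that
cross them. Here `K` bounds the differences of the constant terms to which `g` is added. -/
structure Separates (κ : Fin n → ℝ) (T : Set (Finset (Fin n))) (K : ℝ) (g : Fin n → ℝ) : Prop where
  large : ∀ a b c d, a < b → b < c → c < d →
    2 * K * quadWeight κ a b c d < |quadDiff κ g a b c d|
  pos : ∀ a b c d, a < b → b < c → c < d → {a, c} ∈ T → 0 < quadDiff κ g a b c d
  neg : ∀ a b c d, a < b → b < c → c < d → {b, d} ∈ T → quadDiff κ g a b c d < 0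

theorem exists_separates (hκ : StrictMono κ) {T : Set (Finset (Fin n))} (hT : IsTriangulation T)
    (K : ℝ) : ∃ g, Separates κ T K g := by
  obtain ⟨g, hg⟩ := exists_quadDiff_large hκ hT K
  exact ⟨g, ⟨fun a b c d h1 h2 h3 => (hg a b c d h1 h2 h3).1,
    fun a b c d h1 h2 h3 => (hg a b c d h1 h2 h3).2.1,
    fun a b c d h1 h2 h3 => (hg a b c d h1 h2 h3).2.2⟩⟩

theorem Separates.add_quadratic {T : Set (Finset (Fin n))} {K : ℝ} {g : Fin n → ℝ}
    (hg : Separates κ T K g) (α β γ : ℝ) :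
    Separates κ T K fun i => g i + (α + β * κ i + γ * κ i ^ 2) := by
  constructor <;> simp only [quadDiff_add_quadratic]
  · exact hg.large
  · exact hg.pos
  · exact hg.neg

/-- `I` attains the maximum of `affineTerm κ c` over all chords at `p`. -/
def IsMaxAt (κ : Fin n → ℝ) (c : Finset (Fin n) → ℝ) (p : ℝ × ℝ) (I : Finset (Fin n)) : Prop :=
  I.card = 2 ∧ ∀ J : Finset (Fin n), J.card = 2 → affineTerm κ c J p ≤ affineTerm κ c I p

variable {c₀ : Finset (Fin n) → ℝ} {T : Set (Finset (Fin n))} {K : ℝ} {g : Fin n → ℝ}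
  {p : ℝ × ℝ}

theorem affineTerm_add_sum (I : Finset (Fin n)) :
    affineTerm κ (fun I => c₀ I + ∑ i ∈ I, g i) I p =
      c₀ I + ∑ i ∈ I, (g i + (0 + p.1 * κ i + p.2 * κ i ^ 2)) := by
  simp only [affineTerm, Finset.sum_add_distrib, ← Finset.mul_sum, zero_add]
  ring

/-- An index in a dominant label has nearly the largest possible value. -/
theorem IsMaxAt.le_add (hK : ∀ I J : Finset (Fin n), c₀ I - c₀ J ≤ K) {i j k : Fin n}
    (h : IsMaxAt κ (fun I => c₀ I + ∑ i ∈ I, g i) p {i, j}) (hk : k ≠ j) :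
    g k + (0 + p.1 * κ k + p.2 * κ k ^ 2) ≤ g i + (0 + p.1 * κ i + p.2 * κ i ^ 2) + K := by
  have hij : i ≠ j := fun hij => by
    have := h.1
    simp [hij] at this
  have h1 := h.2 {k, j} (Finset.card_pair hk)
  rw [affineTerm_add_sum, affineTerm_add_sum, Finset.sum_pair hk, Finset.sum_pair hij] at h1
  have := hK {i, j} {k, j}
  linarith

/-- There are no four indices with nearly the same value. -/
theorem Separates.not_close (hg : Separates κ T K g) (hκ : StrictMono κ) {S : Finset (Fin n)}
    (hS : S.card = 4) (h : ∀ s ∈ S, ∀ t ∈ S, g s ≤ g t + 2 * K) : False := by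
  let e := S.orderEmbOfFin hS
  have he : ∀ i, e i ∈ S := S.orderEmbOfFin_mem hS
  have h01 : e 0 < e 1 := e.strictMono (by decide)
  have h12 : e 1 < e 2 := e.strictMono (by decide)
  have h23 : e 2 < e 3 := e.strictMono (by decide)
  have h1 := hg.large _ _ _ _ h01 h12 h23
  have h2 := neg_le_quadDiff hκ h01 h12 h23 (h _ (he 1) _ (he 0)) (h _ (he 3) _ (he 0))
    (h _ (he 1) _ (he 2)) (h _ (he 3) _ (he 2))
  have h3 := quadDiff_le hκ h01 h12 h23 (h _ (he 0) _ (he 1)) (h _ (he 2) _ (he 1))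
    (h _ (he 0) _ (he 3)) (h _ (he 2) _ (he 3))
  exact absurd h1 (not_lt.2 (abs_le.2 ⟨h2, h3⟩))

/-- Dominant labels belong to the triangulation: a chord that crosses a chord of the
triangulation has the wrong sign of the third difference. -/
theorem IsMaxAt.mem (hκ : StrictMono κ) (hT : IsTriangulation T) (hg : Separates κ T K g)
    (hK : ∀ I J : Finset (Fin n), c₀ I - c₀ J ≤ K) {I : Finset (Fin n)}
    (hI : IsMaxAt κ (fun I => c₀ I + ∑ i ∈ I, g i) p I) : I ∈ T := by
  refine hT.maximal I hI.1 fun J hJ => ?_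
  have hK0 : 0 ≤ K := by simpa using hK ∅ ∅
  have hg' := hg.add_quadratic 0 p.1 p.2
  have hW : ∀ {a b c d : Fin n}, a < b → b < c → c < d → 0 ≤ K * quadWeight κ a b c d :=
    fun h1 h2 h3 => mul_nonneg hK0
      (add_pos (vander_pos hκ h2 h3) (vander_pos hκ h1 (h2.trans h3))).le
  rintro ⟨a, b, c, d, hab, hbc, hcd, ⟨rfl, rfl⟩ | ⟨rfl, rfl⟩⟩
  · have h1 := hg'.pos a b c d hab hbc hcd hJ
    have h2 := hg'.large a b c d hab hbc hcd
    rw [abs_of_pos h1] at h2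
    have hI' := hI
    rw [Finset.pair_comm] at hI'
    have h3 := quadDiff_le hκ hab hbc hcd
      (x := fun i => g i + (0 + p.1 * κ i + p.2 * κ i ^ 2))
      (hI.le_add hK (hab.trans (hbc.trans hcd)).ne)
      (hI.le_add hK hcd.ne) (hI'.le_add hK hab.ne) (hI'.le_add hK hbc.ne')
    have := hW hab hbc hcd
    linarith
  · have h1 := hg'.neg a b c d hab hbc hcd hJ
    have h2 := hg'.large a b c d hab hbc hcd
    rw [abs_of_neg h1] at h2
    have hI' := hI
    rw [Finset.pair_comm] at hI'
    have h3 := neg_le_quadDiff hκ hab hbc hcd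
      (x := fun i => g i + (0 + p.1 * κ i + p.2 * κ i ^ 2)) (hI.le_add hK hbc.ne)
      (hI.le_add hK hcd.ne') (hI'.le_add hK hab.ne') (hI'.le_add hK (hab.trans (hbc.trans hcd)).ne')
    have := hW hab hbc hcd
    linarith

/-- If two disjoint labels were dominant, their four indices would have nearly the same value. -/
theorem IsMaxAt.inter (hκ : StrictMono κ) (hg : Separates κ T K g)
    (hK : ∀ I J : Finset (Fin n), c₀ I - c₀ J ≤ K) {I J : Finset (Fin n)}
    (hI : IsMaxAt κ (fun I => c₀ I + ∑ i ∈ I, g i) p I)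
    (hJ : IsMaxAt κ (fun I => c₀ I + ∑ i ∈ I, g i) p J) (hne : I ≠ J) : (I ∩ J).card = 1 := by
  have hle : (I ∩ J).card ≤ 2 := hI.1 ▸ Finset.card_le_card Finset.inter_subset_left
  have h2 : (I ∩ J).card ≠ 2 := fun h2 => hne <|
    (Finset.eq_of_subset_of_card_le Finset.inter_subset_left (by rw [h2, hI.1])).symm.trans
      (Finset.eq_of_subset_of_card_le Finset.inter_subset_right (by rw [h2, hJ.1]))
  have h0 : (I ∩ J).card ≠ 0 := by
    intro h0
    have hU := Finset.card_union_add_card_inter I J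
    rw [h0, hI.1, hJ.1] at hU
    have hdisj : ∀ s ∈ I, s ∉ J := fun s hs hs' => by
      have := Finset.card_pos.2 ⟨s, Finset.mem_inter.2 ⟨hs, hs'⟩⟩
      omega
    have hK0 : 0 ≤ K := by simpa using hK ∅ ∅
    have step : ∀ I : Finset (Fin n), IsMaxAt κ (fun I => c₀ I + ∑ i ∈ I, g i) p I →
        ∀ s ∈ I, ∀ t, t ∉ I → g t + (0 + p.1 * κ t + p.2 * κ t ^ 2) ≤
          g s + (0 + p.1 * κ s + p.2 * κ s ^ 2) + K := by
      intro I hI s hs t ht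
      obtain ⟨i, j, hij, rfl⟩ := Finset.card_eq_two.1 hI.1
      simp only [Finset.mem_insert, Finset.mem_singleton, not_or] at hs ht
      rcases hs with rfl | rfl
      · exact hI.le_add hK ht.2
      · rw [Finset.pair_comm] at hI
        exact hI.le_add hK ht.1
    obtain ⟨i, hi⟩ := Finset.card_pos.1 (by have := hI.1; omega : 0 < I.card)
    obtain ⟨j, hj⟩ := Finset.card_pos.1 (by have := hJ.1; omega : 0 < J.card)
    have hdisj' : ∀ s ∈ J, s ∉ I := fun s hs hs' => hdisj s hs' hs
    refine (hg.add_quadratic 0 p.1 p.2).not_close hκ (S := I ∪ J) (by omega) ?_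
    intro s hs t ht
    rcases Finset.mem_union.1 hs with hs | hs <;> rcases Finset.mem_union.1 ht with ht | ht
    · have h1 := step J hJ j hj s (hdisj s hs)
      have h2 := step I hI t ht j (hdisj' j hj)
      linarith
    · have h1 := step J hJ t ht s (hdisj s hs)
      linarith
    · have h1 := step I hI t ht s (hdisj' s hs)
      linarith
    · have h1 := step I hI i hi s (hdisj' s hs)
      have h2 := step J hJ t ht i (hdisj i hi)
      linarith
  omega

/-- Four dominant labels cannot have an index in common. -/
theorem IsMaxAt.not_star (hκ : StrictMono κ) (hg : Separates κ T K g)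
    (hK : ∀ I J : Finset (Fin n), c₀ I - c₀ J ≤ K) {a : Fin n} {S : Finset (Fin n)}
    (hS : S.card = 4)
    (h : ∀ s ∈ S, s ≠ a ∧ IsMaxAt κ (fun I => c₀ I + ∑ i ∈ I, g i) p {a, s}) : False := by
  have hK0 : 0 ≤ K := by simpa using hK ∅ ∅
  refine (hg.add_quadratic 0 p.1 p.2).not_close hκ hS fun s hs t ht => ?_
  obtain ⟨hsa, -⟩ := h s hs
  obtain ⟨-, h1⟩ := h t ht
  rw [Finset.pair_comm] at h1
  have := h1.le_add hK hsa
  linarith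

theorem IsMaxAt.card_le_three (hκ : StrictMono κ) (hg : Separates κ T K g)
    (hK : ∀ I J : Finset (Fin n), c₀ I - c₀ J ≤ K) {s : Finset (Finset (Fin n))}
    (hs : ∀ I ∈ s, IsMaxAt κ (fun I => c₀ I + ∑ i ∈ I, g i) p I) : s.card ≤ 3 := by
  by_contra! hcard
  have hinter : ∀ I ∈ s, ∀ J ∈ s, I ≠ J → (I ∩ J).card = 1 := fun I hI J hJ hne =>
    (hs I hI).inter hκ hg hK (hs J hJ) hne
  obtain ⟨I, hI⟩ := Finset.card_pos.1 (by omega : 0 < s.card)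
  obtain ⟨J, hJe, L, hLe, M, hMe, hJL, hJM, hLM⟩ :=
    Finset.two_lt_card.1 (by rw [Finset.card_erase_of_mem hI]; omega : 2 < (s.erase I).card)
  obtain ⟨hJI, hJ⟩ := Finset.mem_erase.1 hJe
  obtain ⟨hLI, hL⟩ := Finset.mem_erase.1 hLe
  obtain ⟨hMI, hM⟩ := Finset.mem_erase.1 hMe
  obtain ⟨a, b, hab, rfl⟩ := Finset.card_eq_two.1 (hs I hI).1
  obtain ⟨x, hxa, hxb, hx⟩ := exists_pair_of_inter (hs J hJ).1 (hinter _ hI _ hJ hJI.symm) hJI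
  obtain ⟨y, hya, hyb, hy⟩ := exists_pair_of_inter (hs L hL).1 (hinter _ hI _ hL hLI.symm) hLI
  obtain ⟨z, hza, hzb, hz⟩ := exists_pair_of_inter (hs M hM).1 (hinter _ hI _ hM hMI.symm) hMI
  have mixed : ∀ {a b x y : Fin n}, a ≠ b → x ≠ b → y ≠ a → {a, x} ∈ s → {b, y} ∈ s → x = y := by
    intro a b x y hab hxb hya hx hy
    by_contra hxy
    obtain ⟨he, hne⟩ := inter_eq_empty_of_ne hab hxb hya hxy
    have := hinter _ hx _ hy hne
    simp [he] at this
  have star : ∀ {a b x y z : Fin n}, a ≠ b → x ≠ a → x ≠ b → y ≠ a → y ≠ b → z ≠ a → z ≠ b →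
      x ≠ y → x ≠ z → y ≠ z → {a, b} ∈ s → {a, x} ∈ s → {a, y} ∈ s → {a, z} ∈ s → False := by
    intro a b x y z hab hxa hxb hya hyb hza hzb hxy hxz hyz h1 h2 h3 h4
    refine IsMaxAt.not_star (p := p) hκ hg hK (a := a) (S := {b, x, y, z}) ?_ ?_
    · rw [Finset.card_insert_of_notMem (by simp [hxb.symm, hyb.symm, hzb.symm]),
        Finset.card_eq_three.2 ⟨x, y, z, hxy, hxz, hyz, rfl⟩]
    · intro t ht
      simp only [Finset.mem_insert, Finset.mem_singleton] at ht
      rcases ht with rfl | rfl | rfl | rfl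
      · exact ⟨hab.symm, hs _ h1⟩
      · exact ⟨hxa, hs _ h2⟩
      · exact ⟨hya, hs _ h3⟩
      · exact ⟨hza, hs _ h4⟩
  rcases hx with rfl | rfl <;> rcases hy with rfl | rfl <;> rcases hz with rfl | rfl
  · exact star hab hxa hxb hya hyb hza hzb (by rintro rfl; exact hJL rfl)
      (by rintro rfl; exact hJM rfl) (by rintro rfl; exact hLM rfl) hI hJ hL hM
  -- two labels at one end of `{a, b}` and one at the other end are impossible
  · exact hJL (by rw [mixed hab hxb hza hJ hM, mixed hab hyb hza hL hM])
  · exact hJM (by rw [mixed hab hxb hya hJ hL, mixed hab hzb hya hM hL])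
  · exact hLM (by rw [← mixed hab hxb hya hJ hL, ← mixed hab hxb hza hJ hM])
  · exact hLM (by rw [mixed hab hyb hxa hL hJ, mixed hab hzb hxa hM hJ])
  · exact hJM (by rw [← mixed hab hyb hxa hL hJ, ← mixed hab hyb hza hL hM])
  · exact hJL (by rw [← mixed hab hzb hxa hM hJ, ← mixed hab hzb hya hM hL])
  · rw [Finset.pair_comm] at hI
    exact star hab.symm hxb hxa hyb hya hzb hza (by rintro rfl; exact hJL rfl)
      (by rintro rfl; exact hJM rfl) (by rintro rfl; exact hLM rfl) hI hJ hL hM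

/-- If the weights separate the chords of `T` from the others, then the plot is generic and
trivalent, and its soliton graph belongs to `T`. -/
theorem Separates.realizes (hn : 3 ≤ n) (hκ : StrictMono κ) (hT : IsTriangulation T)
    (hg : Separates κ T K g) (hK : ∀ I J : Finset (Fin n), c₀ I - c₀ J ≤ K)
    {A : Matrix (Fin 2) (Fin n) ℝ} {t : ℕ → ℝ} (hA : TotallyPositive A)
    (hc : ∀ I : Finset (Fin n), I.card = 2 → constTerm κ A t I = c₀ I + ∑ i ∈ I, g i) :
    IsGenericTrivalent κ A t ∧ DiskGraph.M2Equiv (solitonGraph κ A t) (Psi T) := by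
  have hterm : ∀ (p : ℝ × ℝ) (I : Finset (Fin n)), I.card = 2 → affineTerm κ (constTerm κ A t) I p =
      affineTerm κ (fun I => c₀ I + ∑ i ∈ I, g i) I p := by
    intro p I hI
    simp only [affineTerm, hc I hI]
  have hmax : ∀ p, ∀ I ∈ dominant κ A t p, IsMaxAt κ (fun I => c₀ I + ∑ i ∈ I, g i) p I := by
    intro p I hI
    obtain ⟨h1, h2⟩ := (mem_dominant hn hA).1 hI
    refine ⟨h1, fun J hJ => ?_⟩
    rw [← hterm p J hJ, ← hterm p I h1]
    exact h2 J hJ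
  have hG : IsGenericTrivalent κ A t := isGenericTrivalent_of_dominant hn hκ hA
    (fun p => IsMaxAt.card_le_three hκ hg hK (hmax p))
    (fun p I hI J hJ hne => (hmax p I hI).inter hκ hg hK (hmax p J hJ) hne)
  obtain ⟨hR, hM2⟩ := hG.exists_triangulation hn hκ hA
  have hsub : {I | ∃ p, I ∈ regionsAt κ A t p} ⊆ T := by
    rintro I ⟨p, hp⟩
    exact (hmax p I (mem_regionsAt.1 hp).1).mem hκ hT hg hK
  -- both triangulations are maximal sets of noncrossing chords
  have heq : {I | ∃ p, I ∈ regionsAt κ A t p} = T := Set.Subset.antisymm hsub fun J hJ =>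
    hR.maximal J (hT.card_eq_two J hJ) fun I hI => hT.noncrossing I (hsub hI) J hJ
  exact ⟨hG, heq ▸ hM2⟩

theorem exists_bound (c₀ : Finset (Fin n) → ℝ) : ∃ K, ∀ I J : Finset (Fin n), c₀ I - c₀ J ≤ K := by
  obtain ⟨K, hK⟩ := (Set.finite_range fun x : Finset (Fin n) × Finset (Fin n) =>
    c₀ x.1 - c₀ x.2).bddAbove
  exact ⟨K, fun I J => hK ⟨(I, J), rfl⟩⟩

/-- The higher times take arbitrary values on the indices, up to quadratic polynomials in the
parameters. -/
theorem exists_times (hκ : StrictMono κ) (g : Fin n → ℝ) : ∃ (t : ℕ → ℝ) (α β γ : ℝ), ∀ i,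
    ∑ m ∈ Finset.Icc 3 n, κ i ^ m * t m = g i + (α + β * κ i + γ * κ i ^ 2) := by
  let P := Lagrange.interpolate Finset.univ κ g
  have hP : ∀ i, P.eval (κ i) = g i := fun i =>
    Lagrange.eval_interpolate_at_node g (hκ.injective.injOn) (Finset.mem_univ i)
  have hdeg : P.natDegree < n + 1 := by
    have : P.degree < (Finset.univ : Finset (Fin n)).card :=
      Lagrange.degree_interpolate_lt g hκ.injective.injOn
    rw [Finset.card_univ, Fintype.card_fin] at this
    exact Nat.lt_succ_of_le (Polynomial.natDegree_le_of_degree_le this.le)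
  refine ⟨P.coeff, -P.coeff 0, -P.coeff 1, -P.coeff 2, fun i => ?_⟩
  rw [← hP i, Polynomial.eval_eq_sum_range' (n := n + 3) (by omega), Finset.sum_range_succ',
    Finset.sum_range_succ', Finset.sum_range_succ']
  have h1 : ∑ m ∈ Finset.Icc 3 n, κ i ^ m * P.coeff m =
      ∑ m ∈ Finset.range n, P.coeff (m + 1 + 1 + 1) * κ i ^ (m + 1 + 1 + 1) := by
    have h2 : Finset.Icc 3 n ⊆ Finset.Ico 3 (n + 3) := by
      intro m hm
      simp only [Finset.mem_Icc, Finset.mem_Ico] at hm ⊢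
      omega
    rw [Finset.sum_subset h2, Finset.sum_Ico_eq_sum_range]
    · refine Finset.sum_congr (by simp) fun m _ => ?_
      rw [show 3 + m = m + 1 + 1 + 1 by omega, mul_comm]
    · intro m hm hm'
      simp only [Finset.mem_Icc, Finset.mem_Ico] at hm hm'
      rw [Polynomial.coeff_eq_zero_of_natDegree_lt (by omega), mul_zero]
  rw [h1]
  ring

theorem minor_mul_diagonal (A : Matrix (Fin 2) (Fin n) ℝ) (l : Fin n → ℝ) (I : Finset (Fin n)) :
    minor (A * Matrix.diagonal l) I = (∏ i ∈ I, l i) * minor A I := by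
  unfold minor
  split_ifs with h
  · have hprod : ∏ i ∈ I, l i = ∏ j : Fin 2, l (I.orderEmbOfFin h j) := by
      conv_lhs => rw [← Finset.map_orderEmbOfFin_univ I h]
      rw [Finset.prod_map]
      rfl
    rw [hprod, ← Matrix.det_mul_row]
    congr 1
    ext i j
    simp [Matrix.mul_diagonal, mul_comm]
  · simp

theorem vandermondeFactor_pos (hκ : StrictMono κ) (I : Finset (Fin n)) :
    0 < vandermondeFactor κ I :=
  Finset.prod_pos fun _ _ => Finset.prod_pos fun _ hj =>
    sub_pos.2 (hκ (Finset.mem_filter.1 hj).2)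

/-- The matrix with rows `1` and `κ_i` is totally positive. -/
theorem totallyPositive_vandermonde (hκ : StrictMono κ) :
    TotallyPositive (Matrix.of ![fun _ => (1 : ℝ), κ]) := by
  intro I hI
  have hlt : I.orderEmbOfFin hI 0 < I.orderEmbOfFin hI 1 :=
    (I.orderEmbOfFin hI).strictMono (by decide)
  have := hκ hlt
  rw [minor, dif_pos hI, Matrix.det_fin_two]
  simp
  linarith

/-- Any point of the totally positive Grassmannian realizes `T` at suitable higher times. -/
theorem realize_times {n : ℕ} (hn : 3 ≤ n) {κ : Fin n → ℝ} (hκ : StrictMono κ)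
    {T : Set (Finset (Fin n))} (hT : IsTriangulation T) {A : Matrix (Fin 2) (Fin n) ℝ}
    (hA : TotallyPositive A) :
    ∃ t : ℕ → ℝ, IsGenericTrivalent κ A t ∧
      DiskGraph.M2Equiv (solitonGraph κ A t) (Psi T) := by
  obtain ⟨K, hK⟩ := exists_bound fun I : Finset (Fin n) =>
    Real.log (minor A I * vandermondeFactor κ I)
  obtain ⟨g, hg⟩ := exists_separates hκ hT K
  obtain ⟨t, α, β, γ, ht⟩ := exists_times hκ g
  refine ⟨t, (hg.add_quadratic α β γ).realizes hn hκ hT hK hA fun I _ => ?_⟩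
  simp only [constTerm, ht]

/-- For given higher times, the orbit of any point under the positive torus contains one that
realizes `T`. -/
theorem realize_torus {n : ℕ} (hn : 3 ≤ n) {κ : Fin n → ℝ} (hκ : StrictMono κ)
    {T : Set (Finset (Fin n))} (hT : IsTriangulation T) (t : ℕ → ℝ) {A : Matrix (Fin 2) (Fin n) ℝ}
    (hA : TotallyPositive A) :
    ∃ l : Fin n → ℝ, (∀ i, 0 < l i) ∧ TotallyPositive (A * Matrix.diagonal l) ∧
      IsGenericTrivalent κ (A * Matrix.diagonal l) t ∧
      DiskGraph.M2Equiv (solitonGraph κ (A * Matrix.diagonal l) t) (Psi T) := by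
  obtain ⟨K, hK⟩ := exists_bound fun I : Finset (Fin n) =>
    Real.log (minor A I * vandermondeFactor κ I)
  obtain ⟨g, hg⟩ := exists_separates hκ hT K
  let l : Fin n → ℝ := fun i => Real.exp (g i - ∑ m ∈ Finset.Icc 3 n, κ i ^ m * t m)
  have hl : ∀ i, 0 < l i := fun i => Real.exp_pos _
  have hAl : TotallyPositive (A * Matrix.diagonal l) := fun I hI => by
    rw [minor_mul_diagonal]
    exact mul_pos (Finset.prod_pos fun i _ => hl i) (hA I hI)
  refine ⟨l, hl, hAl, hg.realizes hn hκ hT hK hAl fun I hI => ?_⟩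
  rw [constTerm, minor_mul_diagonal, mul_assoc, Real.log_mul
    (Finset.prod_pos fun i _ => hl i).ne' (mul_pos (hA I hI) (vandermondeFactor_pos hκ I)).ne',
    Real.log_prod fun i _ => (hl i).ne']
  simp only [l, Real.log_exp, Finset.sum_sub_distrib]
  ring

end Realization

end KPSoliton

theorem mainTheorem2 (n : ℕ) (hn : 3 ≤ n) (κ : Fin n → ℝ) (hκ : StrictMono κ) :
    -- every graph `Ψ(T)` is a soliton graph for `(Gr_{2,n})_{>0}`, up to (M2)
    (∀ T : Set (Finset (Fin n)), KPSoliton.IsTriangulation T →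
      ∃ (A : Matrix (Fin 2) (Fin n) ℝ) (t : ℕ → ℝ), KPSoliton.TotallyPositive A ∧
        KPSoliton.IsGenericTrivalent κ A t ∧
        KPSoliton.DiskGraph.M2Equiv (KPSoliton.solitonGraph κ A t) (KPSoliton.Psi T)) ∧
    -- every generic trivalent soliton graph arises in this way, up to (M2)
    (∀ (A : Matrix (Fin 2) (Fin n) ℝ) (t : ℕ → ℝ), KPSoliton.TotallyPositive A →
      KPSoliton.IsGenericTrivalent κ A t →
      ∃ T : Set (Finset (Fin n)), KPSoliton.IsTriangulation T ∧
        KPSoliton.DiskGraph.M2Equiv (KPSoliton.solitonGraph κ A t) (KPSoliton.Psi T)) ∧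
    -- realization for an arbitrary point `A`, by varying the higher times
    (∀ T : Set (Finset (Fin n)), KPSoliton.IsTriangulation T →
      ∀ A : Matrix (Fin 2) (Fin n) ℝ, KPSoliton.TotallyPositive A →
      ∃ t : ℕ → ℝ, KPSoliton.IsGenericTrivalent κ A t ∧
        KPSoliton.DiskGraph.M2Equiv (KPSoliton.solitonGraph κ A t) (KPSoliton.Psi T)) ∧
    -- realization for arbitrary higher times, by the action of the positive torus on `A`
    (∀ T : Set (Finset (Fin n)), KPSoliton.IsTriangulation T →
      ∀ t : ℕ → ℝ, ∀ A : Matrix (Fin 2) (Fin n) ℝ, KPSoliton.TotallyPositive A →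
      ∃ l : Fin n → ℝ, (∀ i, 0 < l i) ∧
        KPSoliton.TotallyPositive (A * Matrix.diagonal l) ∧
        KPSoliton.IsGenericTrivalent κ (A * Matrix.diagonal l) t ∧
        KPSoliton.DiskGraph.M2Equiv (KPSoliton.solitonGraph κ (A * Matrix.diagonal l) t)
          (KPSoliton.Psi T)) := by
  refine ⟨fun T hT => ?_, fun A t hA hG => ⟨_, hG.exists_triangulation hn hκ hA⟩,
    fun T hT A hA => KPSoliton.realize_times hn hκ hT hA,
    fun T hT t A hA => KPSoliton.realize_torus hn hκ hT t hA⟩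
  obtain ⟨t, ht⟩ := KPSoliton.realize_times hn hκ hT (KPSoliton.totallyPositive_vandermonde hκ)
  exact ⟨_, t, KPSoliton.totallyPositive_vandermonde hκ, ht⟩
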